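/- **Setting.** Let $M$ be a von Neumann algebra on a Hilbert space $H$, with commutant $M'$. "Normal" means $\sigma$-weakly continuous, and all inner products are conjugate linear in the first variable. Endomorphisms and automorphisms of $M$ are normal, unital and $*$-preserving. *The Arveson correspondence.* For a normal unital completely positive map $P:M\to M$, let $M\otimes_P H$ be the Hausdorff completion of the algebraic tensor product $M\otimes H$ for the form $\langle S\otimes h,T\otimes k\rangle=\langle h,P(S^*T)k\rangle$. Let $\mathcal E_P$ be the space of all $Y\in B(H)$ for which $S\otimes h\mapsto SY^*h$ extends to a bounded operator $\Phi_Y:M\otimes_P H\to H$. It is stable under left and right multiplication by $M'$, and with these actions and the inner product $\langle Y,Z\rangle=\Phi_Y\Phi_Z^*\in M'$ it is a $W^*$-correspondence over $M'$. For an endomorphism $\alpha$, $\mathcal E_\alpha$ is this space for $P=\alpha$. For an automorphism $\alpha$, $\mathcal E_\alpha^*=\{X^*: X\in\mathcal E_\alpha\}$, with the actions of $M'$ by multiplication and $\langle S,T\rangle=S^*T$. *Correspondences.* A $W^*$-correspondence from $A$ to $B$ is a self-dual Hilbert $B$-module with a normal unital left action of $A$ by adjointable operators. Isomorphisms are bijective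 bimodule maps preserving inner products. The composition $X\otimes_B Y$ of $W^*$-correspondences (from $A$ to $B$ and from $B$ to $C$) is the self-dual completion of the balanced tensor product for $\langle x\otimes y,x'\otimes y'\rangle=\langle y,\langle x,x'\rangle y'\rangle$: if $C$ acts on $K$, it is the $\sigma$-weak closure of the linear span of the operators $h\mapsto x\otimes y\otimes h$ from $K$ to the Hilbert space $X\otimes_B Y\otimes_C K$. An $A$–$B$ equivalence bimodule is a $W^*$-correspondence $X$ from $A$ to $B$ that also carries an $A$-valued definite inner product ${}_A\langle\cdot,\cdot\rangle$, linear in the first variable, making it a self-dual left Hilbert $A$-module on which $B$ acts normally by adjointable operators, such that ${}_A\langle x,y\rangle z=x\langle y,z\rangle_B$, and such that the two inner products span $\sigma$-weakly dense subspaces of $A$ and $B$. Pairs $(A,E)$ and $(B,F)$, where $E$, $F$ are $W^*$-correspondences over $A$ and $B$, are strongly Morita equivalent if $E\otimes_A X\cong X\otimes_B F$ for some $A$–$B$ equivalence bimodule $X$. **Proposition.** (1) Let $\alpha\in\mathrm{Aut}(M)$. Then $\mathcal E_{\alpha^{-1}}=\mathcal E_\alpha^*$, as subspaces of $B(H)$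 and as correspondences over $M'$. The linear spans of $\{XY^*: X,Y\in\mathcal E_\alpha\}$ and of $\{X^*Y: X,Y\in\mathcal E_\alpha\}$ are contained and $\sigma$-weakly dense in $M'$. The correspondence $\mathcal E_\alpha$ is an $M'$–$M'$ equivalence bimodule with left inner product $(X,Y)\mapsto XY^*$. (2) Let $\alpha$ be an endomorphism of $M$ and $Q$ a normal unital completely positive map on $M$. There is an isomorphism of correspondences $\mathcal E_\alpha\otimes_{M'}\mathcal E_Q\cong\mathcal E_{\alpha\circ Q}$ with $Y\otimes Z\mapsto YZ$. (3) Let $\alpha\in\mathrm{Aut}(M)$ and $P$ a normal unital completely positive map on $M$. There is an isomorphism of correspondences $\mathcal E_P\otimes_{M'}\mathcal E_\alpha\cong\mathcal E_{P\circ\alpha}$ with $Y\otimes Z\mapsto YZ$. (4) Let $P$ and $Q$ be normal unital completely positive maps on $M$ and $\alpha\in\mathrm{Aut}(M)$ with $P=\alpha\circ Q\circ\alpha^{-1}$. There is an isomorphism of correspondences $\mathcal E_\alpha\otimes_{M'}\mathcal E_Q\otimes_{M'}\mathcal E_\alpha^*\cong\mathcal E_P$ with $R\otimes S\otimes T^*\mapsto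 RST^*$ for $R,T\in\mathcal E_\alpha$ and $S\in\mathcal E_Q$. Moreover $(M',\mathcal E_P)$ and $(M',\mathcal E_Q)$ are strongly Morita equivalent. -/

import Mathlib

open scoped InnerProductSpace ComplexOrder Topology
universe u

namespace VNCorr
open ContinuousLinearMap (adjoint)

section Algebra

variable {H : Type u} [NormedAddCommGroup H] [InnerProductSpace ℂ H] [CompleteSpace H]

instance instSMulMemClass : SMulMemClass (VonNeumannAlgebra H) ℂ (H →L[ℂ] H) where
  smul_mem {N} c _ hx := N.toStarSubalgebra.smul_mem hx c

theorem mem_of_commute (N : VonNeumannAlgebra H) {x : H →L[ℂ] H}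
    (h : ∀ y ∈ N.commutant, y * x = x * y) : x ∈ N := by
  rw [← N.commutant_commutant]
  exact VonNeumannAlgebra.mem_commutant_iff.2 h

theorem commute_of_mem {N : VonNeumannAlgebra H} {x y : H →L[ℂ] H} (hx : x ∈ N)
    (hy : y ∈ N.commutant) : x * y = y * x :=
  VonNeumannAlgebra.mem_commutant_iff.1 hy x hx

theorem isClosed_coe (N : VonNeumannAlgebra H) : IsClosed (N : Set (H →L[ℂ] H)) := by
  have : (N : Set (H →L[ℂ] H)) = ⋂ y ∈ N.commutant, {x | y * x = x * y} := by
    ext x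
    simp only [Set.mem_iInter, Set.mem_ofPred_eq, SetLike.mem_coe]
    exact ⟨fun hx y hy => (commute_of_mem hx hy).symm, mem_of_commute N⟩
  rw [this]
  exact isClosed_biInter fun y _ => isClosed_eq (by fun_prop) (by fun_prop)

/-- A positive operator in `N` is `c⋆ c` with `c ∈ N`. -/
theorem exists_star_mul_self (N : VonNeumannAlgebra H) {x : H →L[ℂ] H} (hx : x ∈ N)
    (h : 0 ≤ x) : ∃ c ∈ N, star c * c = x := by
  refine ⟨CFC.sqrt x, mem_of_commute N fun y hy => ?_, ?_⟩
  · have : Commute x y := commute_of_mem hx hy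
    exact ((this.cfcₙ_nnreal _).eq).symm
  · rw [(CFC.sqrt_nonneg x).isSelfAdjoint.star_eq, CFC.sqrt_mul_sqrt_self x h]

theorem exists_complement (N : VonNeumannAlgebra H) (x : N) :
    ∃ c : N, star x * x + star c * c = (((‖(x : H →L[ℂ] H)‖ ^ 2 : ℝ) : ℂ)) • (1 : N) := by
  obtain ⟨c, hc, h⟩ := exists_star_mul_self N
    (x := (((‖(x : H →L[ℂ] H)‖ ^ 2 : ℝ) : ℂ)) • 1 - star (x : H →L[ℂ] H) * x)
    (sub_mem (SMulMemClass.smul_mem _ (one_mem N)) (mul_mem (star_mem x.2) x.2)) (by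
      rw [sub_nonneg]
      have := CStarAlgebra.star_mul_le_algebraMap_norm_sq (a := (x : H →L[ℂ] H))
      rw [Algebra.algebraMap_eq_smul_one] at this
      rw [Complex.coe_smul]
      exact this)
  refine ⟨⟨c, hc⟩, Subtype.ext ?_⟩
  change star (x : H →L[ℂ] H) * x + star c * c = (((‖(x : H →L[ℂ] H)‖ ^ 2 : ℝ) : ℂ)) • (1 : H →L[ℂ] H)
  rw [h]; abel


theorem exists_negative_direction {B : Type u} [CStarAlgebra B] [PartialOrder B]
    [StarOrderedRing B] (T : B) (hT : IsSelfAdjoint T) :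
    ∃ b w : B, star b * T * b = -(star w * w) ∧ (w = 0 → ∃ C, T = star C * C) := by
  have hneg : 0 ≤ T⁻ := CFC.negPart_nonneg T
  obtain ⟨s, hs0, hs1⟩ := CStarAlgebra.nonneg_iff_exists_isSelfAdjoint_and_eq_mul_self.1 hneg
  have hsa : star (T⁻) = T⁻ := hneg.isSelfAdjoint.star_eq
  refine ⟨T⁻, s * T⁻, ?_, fun h => ?_⟩
  · have e : T * T⁻ = - (T⁻ * T⁻) := by
      have : T * T⁻ = (T⁺ - T⁻) * T⁻ := by rw [CFC.posPart_sub_negPart T hT]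
      rw [this, sub_mul, CFC.posPart_mul_negPart, zero_sub]
    rw [hsa, mul_assoc, e, star_mul, hsa, hs0.star_eq]
    conv_rhs => rw [mul_assoc, ← mul_assoc s s, ← hs1]
    simp
  · have h2 : T⁻ * T⁻ = 0 := by
      conv_lhs => rw [hs1]
      rw [hs1] at h
      have : s * s * (s * s) = s * (s * (s * s)) := by simp only [mul_assoc]
      rw [this, h, mul_zero]
    have h3 : T⁻ = 0 := by
      rw [← CStarRing.star_mul_self_eq_zero_iff, hsa, h2]
    exact CStarAlgebra.nonneg_iff_eq_star_mul_self.1 ((CFC.negPart_eq_zero_iff T hT).1 h3)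

set_option maxHeartbeats 400000 in
theorem exists_factor_aux {A : Type u} [CStarAlgebra A] [PartialOrder A] [StarOrderedRing A] {n : ℕ} (G : Fin n → Fin n → A)
    (hs : ∀ i j, star (G i j) = G j i)
    (h : ∀ b : Fin n → A, ∃ c, ∑ i, ∑ j, star (b i) * G i j * b j = star c * c) :
    ∃ C : Fin n → Fin n → A, ∀ i j, G i j = ∑ k, star (C k i) * C k j := by
  let T : CStarMatrix (Fin n) (Fin n) A := CStarMatrix.ofMatrix (Matrix.of G)
  have hT : IsSelfAdjoint T := by
    ext i j
    exact hs j i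
  obtain ⟨b, w, hb, hw⟩ := exists_negative_direction T hT
  have w0 : w = 0 := by
    ext i k
    have e := congrFun (congrFun hb k) k
    obtain ⟨c, hc⟩ := h fun i => b i k
    have e' : star c * c = -∑ j, star (w j k) * w j k := by
      rw [← hc]
      refine Eq.trans ?_ e
      rw [CStarMatrix.mul_apply, Finset.sum_comm]
      refine Finset.sum_congr rfl fun j _ => ?_
      rw [CStarMatrix.mul_apply, Finset.sum_mul]
      rfl
    have hsum : ∑ j, star (w j k) * w j k = 0 := by
      refine le_antisymm ?_ (Finset.sum_nonneg fun j _ => star_mul_self_nonneg _)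
      rw [← neg_nonneg, ← e']
      exact star_mul_self_nonneg _
    have := (Finset.sum_eq_zero_iff_of_nonneg fun j _ => star_mul_self_nonneg (w j k)).1 hsum i
      (Finset.mem_univ i)
    exact (CStarRing.star_mul_self_eq_zero_iff _).1 this
  obtain ⟨C, hC⟩ := hw w0
  refine ⟨fun i j => C i j, fun i j => ?_⟩
  have := congrFun (congrFun hC i) j
  exact this


/-- A positive matrix over `N` is `C⋆ C` for a matrix `C` over `N`. -/
theorem exists_factor (N : VonNeumannAlgebra H) {n : ℕ} (A : Matrix (Fin n) (Fin n) N)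
    (hA : (A.map ((↑) : N → H →L[ℂ] H)).PosSemidef) :
    ∃ C : Matrix (Fin n) (Fin n) N, A = C.conjTranspose * C := by
  have _ := isClosed_coe N
  let _ : PartialOrder N := CStarAlgebra.spectralOrder N
  have _ : StarOrderedRing N := CStarAlgebra.spectralOrderedRing N
  obtain ⟨C, hC⟩ := exists_factor_aux (A := N) (fun i j => A i j)
    (fun i j => Subtype.ext (hA.1.apply j i)) (fun b => by
      have h := (Matrix.posSemidef_iff_dotProduct_mulVec.1 hA).2 (fun i => (b i : H →L[ℂ] H))
      have e : star (fun i => (b i : H →L[ℂ] H)) ⬝ᵥ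
          (A.map ((↑) : N → H →L[ℂ] H)).mulVec (fun i => (b i : H →L[ℂ] H)) =
          ((∑ i, ∑ j, star (b i) * A i j * b j : N) : H →L[ℂ] H) := by
        simp [dotProduct, Matrix.mulVec, Finset.mul_sum, mul_assoc]
      rw [e] at h
      obtain ⟨c, hc, hcc⟩ := exists_star_mul_self N (SetLike.coe_mem _) h
      exact ⟨⟨c, hc⟩, Subtype.ext hcc.symm⟩)
  refine ⟨C, ?_⟩
  ext1 i j
  rw [hC]
  rfl

theorem posSemidef_of_finite {X R : Type*} [Ring R] [PartialOrder R] [StarRing R]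
    (K : Matrix X X R) (h : ∀ (n : ℕ) (e : Fin n → X), (K.submatrix e e).PosSemidef) :
    K.PosSemidef := by
  refine ⟨?_, fun f => ?_⟩
  · ext i j
    exact (h 2 ![i, j]).1.apply 0 1
  · let e : Fin f.support.card ≃ f.support := f.support.equivFin.symm
    have h := (Matrix.posSemidef_iff_dotProduct_mulVec.1 (h _ (fun i => (e i : X)))).2
      (fun i => f (e i))
    simp only [dotProduct, Matrix.mulVec, Matrix.submatrix_apply, Pi.star_apply,
      Finset.mul_sum, ← mul_assoc] at h
    rw [e.sum_comp (fun x => ∑ j, star (f x) * K x (e j) * f (e j))] at h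
    simp_rw [fun x : X => e.sum_comp (fun y => star (f x) * K x y * f y)] at h
    rw [Finset.sum_coe_sort f.support (fun x => ∑ y : f.support, star (f x) * K x y * f y)] at h
    simp_rw [fun x : X => Finset.sum_coe_sort f.support (fun y => star (f x) * K x y * f y)] at h
    exact h

end Algebra

section Kernel
variable {X V L L' : Type*}
  [NormedAddCommGroup V] [InnerProductSpace ℂ V] [CompleteSpace V]
  [NormedAddCommGroup L] [InnerProductSpace ℂ L] [CompleteSpace L]
  [NormedAddCommGroup L'] [InnerProductSpace ℂ L'] [CompleteSpace L']
  (K : Matrix X X (V →L[ℂ] V)) [Fact K.PosSemidef]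

/-- `RKHS.OfKernel K` is the Hausdorff completion of the free vector space on pairs `(x, v)` for
the positive semidefinite form `⟪(x, v), (y, w)⟫ = ⟪v, K x y w⟫`; `kvec K x v` is the class of
`(x, v)`. -/
noncomputable def kvec (x : X) : V →L[ℂ] RKHS.OfKernel K := RKHS.kerFun (RKHS.OfKernel K) x

theorem adjoint_kvec_comp_kvec (x y : X) : adjoint (kvec K x) ∘L kvec K y = K x y := by
  have := RKHS.kernel_apply (RKHS.OfKernel K) x y
  rw [RKHS.OfKernel.kernel_ofKernel] at this
  exact this.symm

theorem inner_kvec (x y : X) (v w : V) : ⟪kvec K x v, kvec K y w⟫_ℂ = ⟪v, K x y w⟫_ℂ := by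
  have := adjoint_kvec_comp_kvec K x y
  rw [← this, ContinuousLinearMap.comp_apply, ContinuousLinearMap.adjoint_inner_right]

/-- The linear map `f ↦ ∑ x, g x (f x)` on finitely supported functions. -/
noncomputable def sumMap (g : X → V →L[ℂ] L) : (X →₀ V) →ₗ[ℂ] L :=
  Finsupp.lsum ℂ fun x => (g x : V →ₗ[ℂ] L)

theorem denseRange_sumMap : DenseRange (sumMap (kvec K)) := by
  have h := RKHS.kerFun_dense (𝕜 := ℂ) (X := X) (V := V) (RKHS.OfKernel K)
  rw [← Submodule.dense_iff_topologicalClosure_eq_top] at h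
  refine h.mono ?_
  change _ ⊆ ((LinearMap.range (sumMap (kvec K)) : Submodule ℂ _) : Set (RKHS.OfKernel K))
  rw [SetLike.coe_subset_coe, Submodule.span_le]
  rintro _ ⟨x, v, rfl⟩
  exact ⟨Finsupp.single x v, by simp [sumMap, kvec]⟩

theorem eq_of_kvec {T T' : RKHS.OfKernel K →L[ℂ] L}
    (h : ∀ x v, T (kvec K x v) = T' (kvec K x v)) : T = T' := by
  refine ContinuousLinearMap.ext fun z => ?_
  refine congrFun ((denseRange_sumMap K).equalizer T.continuous T'.continuous ?_) z
  ext f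
  simp [sumMap, Finsupp.sum, h]

theorem norm_sumMap_sq (g : X → V →L[ℂ] L) (f : X →₀ V) :
    ((‖sumMap g f‖ ^ 2 : ℝ) : ℂ) =
      ∑ x ∈ f.support, ∑ y ∈ f.support, ⟪f x, (adjoint (g x) ∘L g y) (f y)⟫_ℂ := by
  have := inner_self_eq_norm_sq_to_K (𝕜 := ℂ) (sumMap g f)
  rw [Complex.ofReal_pow]
  refine this.symm.trans ?_
  simp only [sumMap, Finsupp.lsum_apply, Finsupp.sum, sum_inner, inner_sum,
    ContinuousLinearMap.comp_apply, ContinuousLinearMap.adjoint_inner_right,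
    ContinuousLinearMap.coe_coe]
  exact Finset.sum_comm

/-- Bounded operators on `RKHS.OfKernel K` may be prescribed on the vectors `kvec K x v`. -/
theorem exists_clm (g : X → V →L[ℂ] L) (g' : X → V →L[ℂ] L') (C : ℝ) (hC : 0 ≤ C)
    (h : ∀ x y, adjoint (g x) ∘L g y + adjoint (g' x) ∘L g' y = ((C ^ 2 : ℝ) : ℂ) • K x y) :
    ∃ T : RKHS.OfKernel K →L[ℂ] L, ∀ x v, T (kvec K x v) = g x v := by
  have hb : ∀ f, ‖sumMap g f‖ ≤ C * ‖sumMap (kvec K) f‖ := fun f => by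
    have e : ‖sumMap g f‖ ^ 2 + ‖sumMap g' f‖ ^ 2 = C ^ 2 * ‖sumMap (kvec K) f‖ ^ 2 := by
      apply Complex.ofReal_injective
      rw [Complex.ofReal_add, Complex.ofReal_mul]
      simp only [norm_sumMap_sq, ← Finset.sum_add_distrib, ← inner_add_right,
        ← add_apply, h, adjoint_kvec_comp_kvec, Finset.mul_sum,
        smul_apply, inner_smul_right]
    refine le_of_sq_le_sq ?_ (by positivity)
    rw [mul_pow, ← e]
    exact le_add_of_nonneg_right (by positivity)
  refine ⟨(sumMap g).extendOfNorm (sumMap (kvec K)), fun x v => ?_⟩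
  have := LinearMap.extendOfNorm_eq (denseRange_sumMap K) ⟨C, hb⟩ (Finsupp.single x v)
  simpa [sumMap] using this
end Kernel

section SigmaWeak
variable {H K H' K' : Type*}
  [NormedAddCommGroup H] [InnerProductSpace ℂ H] [CompleteSpace H]
  [NormedAddCommGroup K] [InnerProductSpace ℂ K] [CompleteSpace K]
  [NormedAddCommGroup H'] [InnerProductSpace ℂ H'] [CompleteSpace H']
  [NormedAddCommGroup K'] [InnerProductSpace ℂ K'] [CompleteSpace K']

/-- Square-summable sequences of vectors. -/
def SqSummable (H : Type*) [NormedAddCommGroup H] : Type _ :=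
  {p : ℕ → H // Summable fun n => ‖p n‖ ^ 2}

/-- The functional `T ↦ ∑ ⟪q n, T (p n)⟫`; the series converges absolutely. -/
noncomputable def vectorFunctional (p : SqSummable H) (q : SqSummable K) (T : H →L[ℂ] K) : ℂ :=
  ∑' n, ⟪q.1 n, T (p.1 n)⟫_ℂ

variable (H K) in
/-- The σ-weak (ultraweak) topology on `B(H, K)`. -/
noncomputable def sigmaWeak : TopologicalSpace (H →L[ℂ] K) :=
  TopologicalSpace.induced (fun T (pq : SqSummable H × SqSummable K) => vectorFunctional pq.1 pq.2 T)
    Pi.topologicalSpace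

theorem summable_vectorFunctional (p : SqSummable H) (q : SqSummable K) (T : H →L[ℂ] K) :
    Summable fun n => ⟪q.1 n, T (p.1 n)⟫_ℂ := by
  refine Summable.of_norm_bounded ((p.2.add q.2).mul_left ‖T‖) fun n => ?_
  have h1 := norm_inner_le_norm (𝕜 := ℂ) (q.1 n) (T (p.1 n))
  have h2 := T.le_opNorm (p.1 n)
  have h3 : ‖q.1 n‖ * ‖p.1 n‖ ≤ ‖p.1 n‖ ^ 2 + ‖q.1 n‖ ^ 2 := by
    nlinarith [sq_nonneg (‖q.1 n‖ - ‖p.1 n‖), sq_nonneg ‖q.1 n‖, sq_nonneg ‖p.1 n‖]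
  calc _ ≤ ‖q.1 n‖ * (‖T‖ * ‖p.1 n‖) := h1.trans (by gcongr)
    _ = ‖T‖ * (‖q.1 n‖ * ‖p.1 n‖) := by ring
    _ ≤ _ := by gcongr

/-- The image of a square-summable sequence under a bounded operator. -/
def SqSummable.map (A : H →L[ℂ] K) (p : SqSummable H) : SqSummable K :=
  ⟨fun n => A (p.1 n), by
    refine Summable.of_nonneg_of_le (fun n => by positivity) (fun n => ?_)
      (p.2.mul_left (‖A‖ ^ 2))
    rw [← mul_pow]
    gcongr
    exact A.le_opNorm _⟩

/-- The sequence `(h, 0, 0, …)`. -/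
def SqSummable.single (h : H) : SqSummable H :=
  ⟨Pi.single 0 h, summable_of_ne_finset_zero (s := {0}) fun n hn => by
    simp at hn; simp [hn]⟩

theorem vectorFunctional_single (h : H) (k : K) (T : H →L[ℂ] K) :
    vectorFunctional (SqSummable.single h) (SqSummable.single k) T = ⟪k, T h⟫_ℂ := by
  rw [vectorFunctional, tsum_eq_single 0]
  · simp [SqSummable.single]
  · intro n hn
    simp [SqSummable.single, hn]

theorem continuous_vectorFunctional (p : SqSummable H) (q : SqSummable K) :
    Continuous[sigmaWeak H K, inferInstance] (vectorFunctional p q) :=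
  @Continuous.comp _ _ _ (sigmaWeak H K) _ _ _ _ (continuous_apply (p, q)) continuous_induced_dom

theorem continuous_sigmaWeak (f : (H →L[ℂ] K) → (H' →L[ℂ] K'))
    (h : ∀ p q, ∃ p' q', ∃ c : ℂ, ∀ T, vectorFunctional p q (f T) = vectorFunctional p' q' T + c) :
    Continuous[sigmaWeak H K, sigmaWeak H' K'] f := by
  refine continuous_induced_rng.2 ?_
  refine @continuous_pi _ _ _ (sigmaWeak H K) _ _ fun pq => ?_
  obtain ⟨p', q', c, hc⟩ := h pq.1 pq.2
  have : (fun T => vectorFunctional pq.1 pq.2 (f T)) = (fun z => z + c) ∘ vectorFunctional p' q' := funext hc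
  change Continuous[sigmaWeak H K, _] fun T => vectorFunctional pq.1 pq.2 (f T)
  rw [this]
  exact @Continuous.comp _ _ _ (sigmaWeak H K) _ _ _ _ (continuous_add_const c)
    (continuous_vectorFunctional p' q')

theorem map_mem_sigmaWeak_closure {f : (H →L[ℂ] K) → (H' →L[ℂ] K')}
    (hf : Continuous[sigmaWeak H K, sigmaWeak H' K'] f) {S : Set (H →L[ℂ] K)}
    {S' : Set (H' →L[ℂ] K')} (h : ∀ T ∈ S, f T ∈ @closure _ (sigmaWeak H' K') S') :
    ∀ T ∈ @closure _ (sigmaWeak H K) S, f T ∈ @closure _ (sigmaWeak H' K') S' := by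
  intro T hT
  have := @map_mem_closure _ _ (sigmaWeak H K) (sigmaWeak H' K') f _ _ _ hf hT h
  rwa [@closure_closure _ (sigmaWeak H' K')] at this

theorem continuous_add_right (S : H →L[ℂ] K) :
    Continuous[sigmaWeak H K, sigmaWeak H K] fun T => T + S :=
  continuous_sigmaWeak _ fun p q => ⟨p, q, vectorFunctional p q S, fun T => by
    simp only [vectorFunctional, add_apply, inner_add_right]
    exact (summable_vectorFunctional p q T).tsum_add (summable_vectorFunctional p q S)⟩

theorem continuous_comp_left (A : K →L[ℂ] K') :
    Continuous[sigmaWeak H K, sigmaWeak H K'] fun T => A ∘L T :=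
  continuous_sigmaWeak _ fun p q => ⟨p, q.map (adjoint A), 0, fun T => by
    simp [vectorFunctional, SqSummable.map, ContinuousLinearMap.adjoint_inner_left]⟩

theorem continuous_comp_right (B : H' →L[ℂ] H) :
    Continuous[sigmaWeak H K, sigmaWeak H' K] fun T => T ∘L B :=
  continuous_sigmaWeak _ fun p q => ⟨p.map B, q, 0, fun T => by
    simp [vectorFunctional, SqSummable.map]⟩

theorem inner_eq_of_mem_closure {S : Set (H →L[ℂ] K)} {h h' : H} {k k' : K}
    (e : ∀ T ∈ S, ⟪k, T h⟫_ℂ = ⟪k', T h'⟫_ℂ) :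
    ∀ T ∈ @closure _ (sigmaWeak H K) S, ⟪k, T h⟫_ℂ = ⟪k', T h'⟫_ℂ := by
  simp_rw [← vectorFunctional_single] at e ⊢
  intro T hT
  have hc : IsClosed[sigmaWeak H K] {T | vectorFunctional (SqSummable.single h) (SqSummable.single k) T =
      vectorFunctional (SqSummable.single h') (SqSummable.single k') T} :=
    @isClosed_eq _ _ _ (sigmaWeak H K) _ _ _ (continuous_vectorFunctional _ _) (continuous_vectorFunctional _ _)
  exact (@closure_minimal _ (sigmaWeak H K) _ _ e hc) hT

/-- The σ-weak closure of a linear space of operators. -/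
def sigmaWeakClosure (V : Submodule ℂ (H →L[ℂ] K)) : Submodule ℂ (H →L[ℂ] K) where
  carrier := @closure _ (sigmaWeak H K) V
  zero_mem' := @subset_closure _ (sigmaWeak H K) _ _ V.zero_mem
  add_mem' {T S} hT hS := by
    refine map_mem_sigmaWeak_closure (continuous_add_right S) (fun T hT => ?_) T hT
    rw [add_comm]
    refine map_mem_sigmaWeak_closure (continuous_add_right T) (fun S hS => ?_) S hS
    exact @subset_closure _ (sigmaWeak H K) _ _ (V.add_mem hS hT)
  smul_mem' c T hT := by
    refine map_mem_sigmaWeak_closure (f := fun T => c • T) ?_ (fun T hT => ?_) T hT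
    · simpa using! continuous_comp_left (H := H) (c • ContinuousLinearMap.id ℂ K)
    · exact @subset_closure _ (sigmaWeak H K) _ _ (V.smul_mem c hT)

end SigmaWeak

theorem eq_of_inner_kvec {X V X' V' : Type*}
    [NormedAddCommGroup V] [InnerProductSpace ℂ V] [CompleteSpace V]
    [NormedAddCommGroup V'] [InnerProductSpace ℂ V'] [CompleteSpace V']
    (K : Matrix X X (V →L[ℂ] V)) [Fact K.PosSemidef]
    (K' : Matrix X' X' (V' →L[ℂ] V')) [Fact K'.PosSemidef]
    {T S : RKHS.OfKernel K →L[ℂ] RKHS.OfKernel K'}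
    (h : ∀ x v y w, ⟪T (kvec K x v), kvec K' y w⟫_ℂ = ⟪S (kvec K x v), kvec K' y w⟫_ℂ) :
    T = S := by
  refine eq_of_kvec K fun x v => ?_
  have := eq_of_kvec K' (T := innerSL ℂ (T (kvec K x v))) (T' := innerSL ℂ (S (kvec K x v)))
    (fun y w => h x v y w)
  exact innerSL_inj.1 this

theorem eq_of_inner_kvec_left {X V : Type*}
    [NormedAddCommGroup V] [InnerProductSpace ℂ V] [CompleteSpace V]
    (K : Matrix X X (V →L[ℂ] V)) [Fact K.PosSemidef] {z z' : RKHS.OfKernel K}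
    (h : ∀ x v, ⟪z, kvec K x v⟫_ℂ = ⟪z', kvec K x v⟫_ℂ) : z = z' :=
  innerSL_inj.1 (eq_of_kvec K (T := innerSL ℂ z) (T' := innerSL ℂ z') h)

section Maps
variable {H : Type u} [NormedAddCommGroup H] [InnerProductSpace ℂ H] [CompleteSpace H]
  {H' : Type u} [NormedAddCommGroup H'] [InnerProductSpace ℂ H'] [CompleteSpace H']

/-- Normality: continuity for the σ-weak topologies. -/
def IsNormal {M : VonNeumannAlgebra H} {N : VonNeumannAlgebra H'} (f : M → N) : Prop :=
  @Continuous M N (TopologicalSpace.induced Subtype.val (sigmaWeak H H))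
    (TopologicalSpace.induced Subtype.val (sigmaWeak H' H')) f

/-- Unital completely positive linear maps of `M` into itself: for every `n`, the entrywise map on
`n × n` matrices preserves positivity of operator matrices. -/
structure UCPMap (M : VonNeumannAlgebra H) where
  toLinearMap : M →ₗ[ℂ] M
  map_one' : toLinearMap 1 = 1
  cp' : ∀ (n : ℕ) (A : Matrix (Fin n) (Fin n) M), (A.map ((↑) : M → H →L[ℂ] H)).PosSemidef →
    (A.map fun a => (toLinearMap a : H →L[ℂ] H)).PosSemidef

variable {M : VonNeumannAlgebra H}

noncomputable instance : CoeFun (UCPMap M) fun _ => M → M := ⟨fun P => P.toLinearMap⟩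

/-- The composition `P ∘ Q`. -/
noncomputable def UCPMap.comp (P Q : UCPMap M) : UCPMap M where
  toLinearMap := P.toLinearMap ∘ₗ Q.toLinearMap
  map_one' := by simp [P.map_one', Q.map_one']
  cp' n A hA := P.cp' n (A.map Q) (Q.cp' n A hA)

/-- A unital `⋆`-endomorphism is a unital completely positive map. -/
noncomputable def UCPMap.ofStarAlgHom (α : M →⋆ₐ[ℂ] M) : UCPMap M where
  toLinearMap := α.toAlgHom.toLinearMap
  map_one' := map_one α
  cp' n A hA := by
    obtain ⟨C, rfl⟩ := exists_factor M A hA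
    convert Matrix.posSemidef_conjTranspose_mul_self (C.map fun a => (α a : H →L[ℂ] H))
    ext1 i j
    simp only [Matrix.map_apply, Matrix.mul_apply, Matrix.conjTranspose_apply, map_sum,
      AddSubmonoidClass.coe_finsetSum]
    refine Finset.sum_congr rfl fun k _ => ?_
    change ((α (star (C k i) * C k j) : M) : H →L[ℂ] H) = _
    rw [map_mul, map_star]
    rfl

/-- The kernel `(S, T) ↦ P (S⋆ T)` on `M`. -/
noncomputable def UCPMap.kernel (P : UCPMap M) : Matrix M M (H →L[ℂ] H) :=
  Matrix.of fun S T => (P (star S * T) : H →L[ℂ] H)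

theorem UCPMap.posSemidef_kernel (P : UCPMap M) : P.kernel.PosSemidef := by
  refine posSemidef_of_finite _ fun n e => ?_
  refine P.cp' n (Matrix.of fun i j => star (e i) * e j) ?_
  convert Matrix.posSemidef_conjTranspose_mul_self
    (Matrix.of fun (_ : Fin 1) j => (e j : H →L[ℂ] H))
  ext1 i j
  simp [Matrix.mul_apply]

instance (P : UCPMap M) : Fact P.kernel.PosSemidef := ⟨P.posSemidef_kernel⟩

/-- The Stinespring space `M ⊗_P H`, the Hausdorff completion for the form
`⟪S ⊗ h, T ⊗ k⟫ = ⟪h, P (S⋆ T) k⟫`. (The relations of the algebraic tensor product `M ⊗ H` are null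
vectors of the form on the free vector space on `M × H`.) -/
abbrev UCPMap.Stinespring (P : UCPMap M) : Type u := RKHS.OfKernel P.kernel

/-- The elementary tensor `S ⊗ h` of `M ⊗_P H`, as a bounded operator in `h`. -/
noncomputable def UCPMap.tmul (P : UCPMap M) (S : M) : H →L[ℂ] P.Stinespring := kvec P.kernel S

theorem UCPMap.inner_tmul (P : UCPMap M) (S T : M) (h k : H) :
    ⟪P.tmul S h, P.tmul T k⟫_ℂ = ⟪h, (P (star S * T) : H →L[ℂ] H) k⟫_ℂ :=
  inner_kvec P.kernel S T h k

theorem UCPMap.adjoint_tmul_comp (P : UCPMap M) (S T : M) :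
    adjoint (P.tmul S) ∘L P.tmul T = (P (star S * T) : H →L[ℂ] H) :=
  adjoint_kvec_comp_kvec P.kernel S T

theorem UCPMap.exists_pi (P : UCPMap M) (T : M) :
    ∃ R : P.Stinespring →L[ℂ] P.Stinespring, ∀ S h, R (P.tmul S h) = P.tmul (T * S) h := by
  obtain ⟨c, hc⟩ := exists_complement M T
  refine exists_clm P.kernel (fun S => P.tmul (T * S)) (fun S => P.tmul (c * S)) _
    (norm_nonneg (T : H →L[ℂ] H)) fun S S' => ?_
  rw [P.adjoint_tmul_comp, P.adjoint_tmul_comp]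
  have : star (T * S) * (T * S') + star (c * S) * (c * S') =
      (((‖(T : H →L[ℂ] H)‖ ^ 2 : ℝ) : ℂ)) • (star S * S') := by
    calc _ = star S * (star T * T + star c * c) * S' := by simp only [star_mul]; noncomm_ring
      _ = _ := by rw [hc]; simp
  have := congrArg (fun a => (P a : H →L[ℂ] H)) this
  simpa using! this

theorem UCPMap.exists_one_tensor (P : UCPMap M) (T : M.commutant) :
    ∃ R : P.Stinespring →L[ℂ] P.Stinespring,
      ∀ S h, R (P.tmul S h) = P.tmul S ((T : H →L[ℂ] H) h) := by
  obtain ⟨c, hc⟩ := exists_complement M.commutant T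
  refine exists_clm P.kernel (fun S => P.tmul S ∘L (T : H →L[ℂ] H))
    (fun S => P.tmul S ∘L (c : H →L[ℂ] H)) _ (norm_nonneg (T : H →L[ℂ] H)) fun S S' => ?_
  have h1 : (P (star S * S') : H →L[ℂ] H) * T = T * P (star S * S') :=
    commute_of_mem (P (star S * S')).2 T.2
  have h2 : (P (star S * S') : H →L[ℂ] H) * c = c * P (star S * S') :=
    commute_of_mem (P (star S * S')).2 c.2
  have hc' : star (T : H →L[ℂ] H) * T + star (c : H →L[ℂ] H) * c =
      (((‖(T : H →L[ℂ] H)‖ ^ 2 : ℝ) : ℂ)) • (1 : H →L[ℂ] H) := congrArg Subtype.val hc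
  have e : ∀ R : H →L[ℂ] H, adjoint (P.tmul S ∘L R) ∘L (P.tmul S' ∘L R) =
      star R * (P (star S * S') * R) := fun R => by
    rw [← P.adjoint_tmul_comp, ContinuousLinearMap.adjoint_comp]
    rfl
  rw [e, e, h1, h2, ← mul_assoc, ← mul_assoc, ← add_mul, hc', smul_mul_assoc, one_mul]
  rfl

end Maps

section Corr
variable {H₁ : Type u} [NormedAddCommGroup H₁] [InnerProductSpace ℂ H₁] [CompleteSpace H₁]
  {H₂ : Type u} [NormedAddCommGroup H₂] [InnerProductSpace ℂ H₂] [CompleteSpace H₂]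

/-- Correspondences from `A` to `B`: right inner product modules over `B` with a unital left action
of `A` by adjointable operators. The right action of `b` is `ract (op b)`; inner products are
conjugate linear in the first variable. Self-duality (which entails completeness) and normality of
the left action are expressed by `Correspondence.IsWStar`. -/
structure Correspondence (A : VonNeumannAlgebra H₁) (B : VonNeumannAlgebra H₂) where
  carrier : Type u
  [instAddCommGroup : AddCommGroup carrier]
  [instModule : Module ℂ carrier]
  lact : A →ₐ[ℂ] Module.End ℂ carrier
  ract : Bᵐᵒᵖ →ₐ[ℂ] Module.End ℂ carrier
  inner : carrier → carrier → B
  inner_add_right : ∀ x y z, inner x (y + z) = inner x y + inner x z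
  inner_ract : ∀ x y b, inner x (ract (MulOpposite.op b) y) = inner x y * b
  star_inner : ∀ x y, star (inner x y) = inner y x
  inner_lact : ∀ a x y, inner (lact a x) y = inner x (lact (star a) y)
  inner_self_nonneg : ∀ x, 0 ≤ (inner x x : H₂ →L[ℂ] H₂)
  inner_self_eq_zero : ∀ x, inner x x = 0 → x = 0

attribute [instance] Correspondence.instAddCommGroup Correspondence.instModule

end Corr

section Arveson
variable {H : Type u} [NormedAddCommGroup H] [InnerProductSpace ℂ H] [CompleteSpace H]
  {M : VonNeumannAlgebra H} (P : UCPMap M)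

/-- The Stinespring representation `π_P (T) (S ⊗ h) = T S ⊗ h`. -/
noncomputable def UCPMap.piOp (T : M) : P.Stinespring →L[ℂ] P.Stinespring := (P.exists_pi T).choose

theorem UCPMap.piOp_tmul (T S : M) (h : H) : P.piOp T (P.tmul S h) = P.tmul (T * S) h :=
  (P.exists_pi T).choose_spec S h

/-- The operator `(I ⊗ T) (S ⊗ h) = S ⊗ T h` for `T` in the commutant. -/
noncomputable def UCPMap.oneTensor (T : M.commutant) : P.Stinespring →L[ℂ] P.Stinespring :=
  (P.exists_one_tensor T).choose

theorem UCPMap.oneTensor_tmul (T : M.commutant) (S : M) (h : H) :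
    P.oneTensor T (P.tmul S h) = P.tmul S ((T : H →L[ℂ] H) h) :=
  (P.exists_one_tensor T).choose_spec S h

theorem UCPMap.adjoint_piOp (T : M) : adjoint (P.piOp T) = P.piOp (star T) := by
  refine eq_of_inner_kvec P.kernel P.kernel fun S h S' h' => ?_
  rw [ContinuousLinearMap.adjoint_inner_left]
  change ⟪P.tmul S h, P.piOp T (P.tmul S' h')⟫_ℂ = ⟪P.piOp (star T) (P.tmul S h), P.tmul S' h'⟫_ℂ
  rw [P.piOp_tmul, P.piOp_tmul, P.inner_tmul, P.inner_tmul, star_mul, star_star, mul_assoc]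

theorem UCPMap.adjoint_oneTensor (T : M.commutant) :
    adjoint (P.oneTensor T) = P.oneTensor (star T) := by
  refine eq_of_inner_kvec P.kernel P.kernel fun S h S' h' => ?_
  rw [ContinuousLinearMap.adjoint_inner_left]
  change ⟪P.tmul S h, P.oneTensor T (P.tmul S' h')⟫_ℂ =
    ⟪P.oneTensor (star T) (P.tmul S h), P.tmul S' h'⟫_ℂ
  rw [P.oneTensor_tmul, P.oneTensor_tmul, P.inner_tmul, P.inner_tmul]
  change ⟪h, ((P (star S * S') : H →L[ℂ] H) * (T : H →L[ℂ] H)) h'⟫_ℂ = ⟪adjoint (T : H →L[ℂ] H) h, _⟫_ℂ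
  rw [commute_of_mem (P (star S * S')).2 T.2, ContinuousLinearMap.adjoint_inner_left]
  rfl

theorem UCPMap.ext_tmul {L : Type*} [NormedAddCommGroup L] [InnerProductSpace ℂ L]
    [CompleteSpace L] {T T' : P.Stinespring →L[ℂ] L}
    (h : ∀ S x, T (P.tmul S x) = T' (P.tmul S x)) : T = T' := eq_of_kvec P.kernel h

theorem UCPMap.tmul_eq_of_multiplicative (hP : ∀ S T, P (star S * T) = star (P S) * P T)
    (T : M) (h : H) : P.tmul T h = P.tmul 1 ((P T : H →L[ℂ] H) h) := by
  refine eq_of_inner_kvec_left P.kernel fun S k => ?_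
  have e1 := P.inner_tmul T S h k
  have e2 := P.inner_tmul 1 S ((P T : H →L[ℂ] H) h) k
  have e3 : ⟪h, (star (P T : H →L[ℂ] H)) ((P S : H →L[ℂ] H) k)⟫_ℂ =
      ⟪(P T : H →L[ℂ] H) h, (P S : H →L[ℂ] H) k⟫_ℂ :=
    ContinuousLinearMap.adjoint_inner_right _ _ _
  rw [hP] at e1
  rw [star_one, one_mul] at e2
  exact e1.trans (Eq.trans e3 e2.symm)

/-- The space `𝓔_P` of all `Y ∈ B(H)` such that `S ⊗ h ↦ S Y⋆ h` is continuous on `M ⊗_P H`. -/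
noncomputable def UCPMap.arvesonSpace : Submodule ℂ (H →L[ℂ] H) where
  carrier := {Y | ∃ Φ : P.Stinespring →L[ℂ] H,
    ∀ (S : M) (h : H), Φ (P.tmul S h) = (S : H →L[ℂ] H) (adjoint Y h)}
  zero_mem' := ⟨0, by simp⟩
  add_mem' := by
    rintro Y Z ⟨Φ, hΦ⟩ ⟨Ψ, hΨ⟩
    exact ⟨Φ + Ψ, fun S h => by simp [hΦ, hΨ]⟩
  smul_mem' := by
    rintro c Y ⟨Φ, hΦ⟩
    refine ⟨starRingEnd ℂ c • Φ, fun S h => ?_⟩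
    rw [map_smulₛₗ, smul_apply, smul_apply, map_smul, hΦ]

/-- The bounded operator `Φ_Y : M ⊗_P H → H` with `Φ_Y (S ⊗ h) = S Y⋆ h`. -/
noncomputable def UCPMap.Phi (Y : P.arvesonSpace) : P.Stinespring →L[ℂ] H := Y.2.choose

theorem UCPMap.Phi_tmul (Y : P.arvesonSpace) (S : M) (h : H) :
    P.Phi Y (P.tmul S h) = (S : H →L[ℂ] H) (adjoint (Y : H →L[ℂ] H) h) :=
  Y.2.choose_spec S h

theorem UCPMap.Phi_add (Y Z : P.arvesonSpace) : P.Phi (Y + Z) = P.Phi Y + P.Phi Z :=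
  P.ext_tmul fun S h => by simp [P.Phi_tmul]

theorem UCPMap.mul_mem_arvesonSpace {T : H →L[ℂ] H} (hT : T ∈ M.commutant) {Y : H →L[ℂ] H}
    (hY : Y ∈ P.arvesonSpace) : T * Y ∈ P.arvesonSpace :=
  ⟨P.Phi ⟨Y, hY⟩ ∘L P.oneTensor (star ⟨T, hT⟩), fun S h => by
    rw [ContinuousLinearMap.comp_apply, P.oneTensor_tmul, P.Phi_tmul]
    change _ = (S : H →L[ℂ] H) (adjoint (T ∘L Y) h)
    rw [ContinuousLinearMap.adjoint_comp]
    rfl⟩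

theorem UCPMap.mem_arvesonSpace_mul {T : H →L[ℂ] H} (hT : T ∈ M.commutant) {Y : H →L[ℂ] H}
    (hY : Y ∈ P.arvesonSpace) : Y * T ∈ P.arvesonSpace :=
  ⟨adjoint T ∘L P.Phi ⟨Y, hY⟩, fun S h => by
    rw [ContinuousLinearMap.comp_apply, P.Phi_tmul]
    change _ = (S : H →L[ℂ] H) (adjoint (Y ∘L T) h)
    rw [ContinuousLinearMap.adjoint_comp]
    have := commute_of_mem S.2 (star_mem hT)
    exact (congrArg (fun A : H →L[ℂ] H => A (adjoint Y h)) this).symm⟩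

/-- Left multiplication of `N` on a space of operators stable under it. -/
def leftMulHom (N : VonNeumannAlgebra H) (E : Submodule ℂ (H →L[ℂ] H))
    (hE : ∀ T ∈ N, ∀ Y ∈ E, T * Y ∈ E) : N →ₐ[ℂ] Module.End ℂ E where
  toFun T :=
    { toFun := fun Y => ⟨T * Y, hE T T.2 Y Y.2⟩
      map_add' := fun Y Z => Subtype.ext (mul_add _ _ _)
      map_smul' := fun c Y => Subtype.ext (mul_smul_comm _ _ _) }
  map_one' := LinearMap.ext fun Y => Subtype.ext (one_mul _)
  map_mul' S T := LinearMap.ext fun Y => Subtype.ext (mul_assoc _ _ _)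
  map_zero' := LinearMap.ext fun Y => Subtype.ext (zero_mul _)
  map_add' S T := LinearMap.ext fun Y => Subtype.ext (add_mul _ _ _)
  commutes' c := LinearMap.ext fun Y => Subtype.ext (by
    change (algebraMap ℂ (H →L[ℂ] H) c) * (Y : H →L[ℂ] H) = c • (Y : H →L[ℂ] H)
    rw [Algebra.smul_def])

/-- Right multiplication of `N` on a space of operators stable under it. -/
def rightMulHom (N : VonNeumannAlgebra H) (E : Submodule ℂ (H →L[ℂ] H))
    (hE : ∀ T ∈ N, ∀ Y ∈ E, Y * T ∈ E) : Nᵐᵒᵖ →ₐ[ℂ] Module.End ℂ E where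
  toFun T :=
    { toFun := fun Y => ⟨Y * T.unop, hE _ T.unop.2 Y Y.2⟩
      map_add' := fun Y Z => Subtype.ext (add_mul _ _ _)
      map_smul' := fun c Y => Subtype.ext (smul_mul_assoc _ _ _) }
  map_one' := LinearMap.ext fun Y => Subtype.ext (mul_one _)
  map_mul' S T := LinearMap.ext fun Y => Subtype.ext (mul_assoc _ _ _).symm
  map_zero' := LinearMap.ext fun Y => Subtype.ext (mul_zero _)
  map_add' S T := LinearMap.ext fun Y => Subtype.ext (mul_add _ _ _)
  commutes' c := LinearMap.ext fun Y => Subtype.ext (by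
    change (Y : H →L[ℂ] H) * (algebraMap ℂ (H →L[ℂ] H) c) = c • (Y : H →L[ℂ] H)
    rw [Algebra.smul_def, Algebra.commutes])

theorem UCPMap.Phi_comp_piOp (Y : P.arvesonSpace) (T : M) :
    P.Phi Y ∘L P.piOp T = (T : H →L[ℂ] H) ∘L P.Phi Y :=
  P.ext_tmul fun S h => by
    simp only [ContinuousLinearMap.comp_apply, P.piOp_tmul, P.Phi_tmul]
    rfl

theorem UCPMap.Phi_comp_adjoint_mem (Y Z : P.arvesonSpace) :
    P.Phi Y ∘L adjoint (P.Phi Z) ∈ M.commutant := by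
  refine VonNeumannAlgebra.mem_commutant_iff.2 fun T hT => ?_
  have h1 := P.Phi_comp_piOp Y ⟨T, hT⟩
  have h2 := congrArg adjoint (P.Phi_comp_piOp Z (star ⟨T, hT⟩))
  rw [ContinuousLinearMap.adjoint_comp, ContinuousLinearMap.adjoint_comp, P.adjoint_piOp,
    star_star] at h2
  have h3 : adjoint ((star (⟨T, hT⟩ : M) : M) : H →L[ℂ] H) = T :=
    ContinuousLinearMap.adjoint_adjoint T
  rw [h3] at h2
  calc T ∘L (P.Phi Y ∘L adjoint (P.Phi Z)) = (P.Phi Y ∘L P.piOp ⟨T, hT⟩) ∘L adjoint (P.Phi Z) := by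
        rw [h1, ContinuousLinearMap.comp_assoc]
    _ = P.Phi Y ∘L (adjoint (P.Phi Z) ∘L T) := by rw [← h2, ContinuousLinearMap.comp_assoc]
    _ = _ := by rw [← ContinuousLinearMap.comp_assoc]; rfl

/-- The Arveson correspondence `𝓔_P` over the commutant `M'`: left and right actions by operator
multiplication, inner product `⟨Y, Z⟩ = Φ_Y Φ_Z⋆`. -/
noncomputable def UCPMap.arveson : Correspondence M.commutant M.commutant where
  carrier := P.arvesonSpace
  lact := leftMulHom M.commutant P.arvesonSpace fun _ hT _ hY => P.mul_mem_arvesonSpace hT hY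
  ract := rightMulHom M.commutant P.arvesonSpace fun _ hT _ hY => P.mem_arvesonSpace_mul hT hY
  inner Y Z := ⟨P.Phi Y ∘L adjoint (P.Phi Z), P.Phi_comp_adjoint_mem Y Z⟩
  inner_add_right X Y Z := Subtype.ext (by
    simp only [P.Phi_add, map_add]
    exact ContinuousLinearMap.comp_add _ _ _)
  inner_ract X Y b := Subtype.ext (by
    have : P.Phi ⟨Y * (b : H →L[ℂ] H), P.mem_arvesonSpace_mul b.2 Y.2⟩ = adjoint (b : H →L[ℂ] H) ∘L P.Phi Y :=
      P.ext_tmul fun S h => by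
        rw [ContinuousLinearMap.comp_apply, P.Phi_tmul, P.Phi_tmul]
        change (S : H →L[ℂ] H) (adjoint ((Y : H →L[ℂ] H) ∘L (b : H →L[ℂ] H)) h) = _
        rw [ContinuousLinearMap.adjoint_comp]
        have := commute_of_mem S.2 (star_mem b.2)
        exact (congrArg (fun A : H →L[ℂ] H => A (adjoint (Y : H →L[ℂ] H) h)) this)
    change P.Phi X ∘L adjoint (P.Phi ⟨Y * (b : H →L[ℂ] H), P.mem_arvesonSpace_mul b.2 Y.2⟩) = _
    rw [this, ContinuousLinearMap.adjoint_comp, ContinuousLinearMap.adjoint_adjoint]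
    rfl)
  star_inner X Y := Subtype.ext (by
    change adjoint (P.Phi X ∘L adjoint (P.Phi Y)) = _
    rw [ContinuousLinearMap.adjoint_comp, ContinuousLinearMap.adjoint_adjoint])
  inner_lact T X Y := Subtype.ext (by
    have e : ∀ (T : M.commutant) (X : P.arvesonSpace),
        P.Phi ⟨T * X, P.mul_mem_arvesonSpace T.2 X.2⟩ = P.Phi X ∘L P.oneTensor (star T) :=
      fun T X => P.ext_tmul fun S h => by
        rw [ContinuousLinearMap.comp_apply, P.oneTensor_tmul, P.Phi_tmul, P.Phi_tmul]
        change (S : H →L[ℂ] H) (adjoint ((T : H →L[ℂ] H) ∘L (X : H →L[ℂ] H)) h) = _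
        rw [ContinuousLinearMap.adjoint_comp]
        rfl
    change P.Phi ⟨T * X, P.mul_mem_arvesonSpace T.2 X.2⟩ ∘L adjoint (P.Phi Y) =
      P.Phi X ∘L adjoint (P.Phi ⟨(star T : M.commutant) * Y,
        P.mul_mem_arvesonSpace (star T).2 Y.2⟩)
    rw [e, e, ContinuousLinearMap.adjoint_comp, P.adjoint_oneTensor, star_star]
    rfl)
  inner_self_nonneg X := by
    rw [ContinuousLinearMap.nonneg_iff_isPositive]
    simpa using ContinuousLinearMap.isPositive_self_comp_adjoint (P.Phi X)
  inner_self_eq_zero X h := by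
    have h0 : P.Phi X ∘L adjoint (P.Phi X) = 0 := congrArg Subtype.val h
    have h1 : adjoint (P.Phi X) = 0 := by
      rw [← ContinuousLinearMap.adjoint_comp_self_eq_zero_iff,
        ContinuousLinearMap.adjoint_adjoint, h0]
    have h2 : P.Phi X = 0 := by
      simpa using congrArg adjoint h1
    have h3 : adjoint (X : H →L[ℂ] H) = 0 := by
      ext h
      have := P.Phi_tmul X 1 h
      rw [h2] at this
      simpa using this.symm
    exact Subtype.ext (by simpa using congrArg adjoint h3)

end Arveson

section AdjointSpace
variable {H : Type u} [NormedAddCommGroup H] [InnerProductSpace ℂ H] [CompleteSpace H]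
  {M : VonNeumannAlgebra H}

/-- `Y T = α (T) Y` for `Y ∈ 𝓔_α`. -/
theorem intertwines_of_mem (α : M →⋆ₐ[ℂ] M) {Y : H →L[ℂ] H}
    (hY : Y ∈ (UCPMap.ofStarAlgHom α).arvesonSpace) (T : M) : Y * T = α T * Y := by
  obtain ⟨Φ, hΦ⟩ := hY
  have key : ∀ (T : M) (h : H), (UCPMap.ofStarAlgHom α).tmul T h =
      (UCPMap.ofStarAlgHom α).tmul 1 ((α T : H →L[ℂ] H) h) := fun T h =>
    (UCPMap.ofStarAlgHom α).tmul_eq_of_multiplicative (fun S T => by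
      change α (star S * T) = star (α S) * α T
      rw [map_mul, map_star]) T h
  have h1 : ∀ T : M, (T : H →L[ℂ] H) ∘L adjoint Y = adjoint Y ∘L (α T : H →L[ℂ] H) := fun T => by
    ext h
    have e := hΦ T h
    rw [key T h, hΦ] at e
    simpa using e.symm
  have h2 := congrArg adjoint (h1 (star T))
  rw [ContinuousLinearMap.adjoint_comp, ContinuousLinearMap.adjoint_comp,
    ContinuousLinearMap.adjoint_adjoint, map_star] at h2
  have e1 : adjoint ((star T : M) : H →L[ℂ] H) = T := ContinuousLinearMap.adjoint_adjoint _
  have e2 : adjoint ((star (α T) : M) : H →L[ℂ] H) = α T := ContinuousLinearMap.adjoint_adjoint _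
  rw [e1, e2] at h2
  exact h2

/-- `𝓔_P⋆ = {Y⋆ | Y ∈ 𝓔_P}`. -/
noncomputable def UCPMap.adjointSpace (P : UCPMap M) : Submodule ℂ (H →L[ℂ] H) where
  carrier := {T | adjoint T ∈ P.arvesonSpace}
  zero_mem' := by simp
  add_mem' {S T} hS hT := by
    have := P.arvesonSpace.add_mem hS hT
    simpa using this
  smul_mem' c T hT := by
    have := P.arvesonSpace.smul_mem (starRingEnd ℂ c) hT
    change adjoint (c • T) ∈ P.arvesonSpace
    rwa [map_smulₛₗ]

/-- A `⋆`-automorphism is a unital completely positive map. -/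
noncomputable def UCPMap.ofAut (α : M ≃⋆ₐ[ℂ] M) : UCPMap M := UCPMap.ofStarAlgHom (α : M →⋆ₐ[ℂ] M)

theorem adjoint_comp_mem_commutant (α : M ≃⋆ₐ[ℂ] M) {S T : H →L[ℂ] H}
    (hS : S ∈ (UCPMap.ofAut α).adjointSpace) (hT : T ∈ (UCPMap.ofAut α).adjointSpace) :
    adjoint S ∘L T ∈ M.commutant := by
  refine VonNeumannAlgebra.mem_commutant_iff.2 fun g hg => ?_
  obtain ⟨a, ha⟩ : ∃ a, α a = ⟨g, hg⟩ := EquivLike.surjective α ⟨g, hg⟩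
  have h1 : adjoint S * a = g * adjoint S := by
    have := intertwines_of_mem (α : M →⋆ₐ[ℂ] M) hS a
    change _ = ((α a : M) : H →L[ℂ] H) * _ at this
    rwa [ha] at this
  have h2 : T * g = a * T := by
    have := congrArg adjoint (intertwines_of_mem (α : M →⋆ₐ[ℂ] M) hT (star a))
    change adjoint (adjoint T ∘L _) = adjoint (((α (star a) : M) : H →L[ℂ] H) ∘L _) at this
    rw [map_star, ha, ContinuousLinearMap.adjoint_comp, ContinuousLinearMap.adjoint_comp,
      ContinuousLinearMap.adjoint_adjoint] at this
    have e1 : adjoint ((star a : M) : H →L[ℂ] H) = a := ContinuousLinearMap.adjoint_adjoint _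
    have e2 : adjoint ((star (⟨g, hg⟩ : M) : M) : H →L[ℂ] H) = g :=
      ContinuousLinearMap.adjoint_adjoint _
    rw [e1, e2] at this
    exact this.symm
  change g * (adjoint S * T) = (adjoint S * T) * g
  rw [← mul_assoc, ← h1, mul_assoc, mul_assoc, h2]

/-- For an automorphism `α`, the space `𝓔_α⋆` of adjoints as a correspondence over `M'`: actions by
operator multiplication and inner product `⟨S, T⟩ = S⋆ T`. -/
noncomputable def arvesonAdjoint (α : M ≃⋆ₐ[ℂ] M) : Correspondence M.commutant M.commutant where
  carrier := (UCPMap.ofAut α).adjointSpace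
  lact := leftMulHom M.commutant (UCPMap.ofAut α).adjointSpace fun R hR T hT => by
    change adjoint (R ∘L T) ∈ (UCPMap.ofAut α).arvesonSpace
    rw [ContinuousLinearMap.adjoint_comp]
    exact UCPMap.mem_arvesonSpace_mul _ (star_mem hR) hT
  ract := rightMulHom M.commutant (UCPMap.ofAut α).adjointSpace fun R hR T hT => by
    change adjoint (T ∘L R) ∈ (UCPMap.ofAut α).arvesonSpace
    rw [ContinuousLinearMap.adjoint_comp]
    exact UCPMap.mul_mem_arvesonSpace _ (star_mem hR) hT
  inner S T := ⟨adjoint (S : H →L[ℂ] H) ∘L (T : H →L[ℂ] H),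
    adjoint_comp_mem_commutant α S.2 T.2⟩
  inner_add_right S T R := Subtype.ext (ContinuousLinearMap.comp_add _ _ _)
  inner_ract S T R := Subtype.ext (mul_assoc _ _ _).symm
  star_inner S T := Subtype.ext (by
    change adjoint (adjoint (S : H →L[ℂ] H) ∘L (T : H →L[ℂ] H)) = _
    rw [ContinuousLinearMap.adjoint_comp, ContinuousLinearMap.adjoint_adjoint])
  inner_lact R S T := Subtype.ext (by
    change adjoint ((R : H →L[ℂ] H) ∘L (S : H →L[ℂ] H)) ∘L (T : H →L[ℂ] H) = _
    rw [ContinuousLinearMap.adjoint_comp, ContinuousLinearMap.comp_assoc]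
    rfl)
  inner_self_nonneg S := by
    rw [ContinuousLinearMap.nonneg_iff_isPositive]
    exact ContinuousLinearMap.isPositive_adjoint_comp_self _
  inner_self_eq_zero S h := Subtype.ext
    (ContinuousLinearMap.adjoint_comp_self_eq_zero_iff.1 (congrArg Subtype.val h))

end AdjointSpace

namespace Correspondence
variable {H₁ : Type u} [NormedAddCommGroup H₁] [InnerProductSpace ℂ H₁] [CompleteSpace H₁]
  {H₂ : Type u} [NormedAddCommGroup H₂] [InnerProductSpace ℂ H₂] [CompleteSpace H₂]
  {H₃ : Type u} [NormedAddCommGroup H₃] [InnerProductSpace ℂ H₃] [CompleteSpace H₃]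
  {A : VonNeumannAlgebra H₁} {B : VonNeumannAlgebra H₂} {C : VonNeumannAlgebra H₃}

section Basic
variable (X : Correspondence A B)

noncomputable def innerHom (x : X.carrier) : X.carrier →+ B :=
  AddMonoidHom.mk' (X.inner x) (X.inner_add_right x)

theorem inner_sum_right {ι : Type*} (s : Finset ι) (x : X.carrier) (f : ι → X.carrier) :
    X.inner x (∑ i ∈ s, f i) = ∑ i ∈ s, X.inner x (f i) := map_sum (X.innerHom x) f s

theorem inner_sum_left {ι : Type*} (s : Finset ι) (x : X.carrier) (f : ι → X.carrier) :
    X.inner (∑ i ∈ s, f i) x = ∑ i ∈ s, X.inner (f i) x := by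
  rw [← X.star_inner, inner_sum_right, star_sum]
  simp only [X.star_inner]

theorem inner_ract_left (x y : X.carrier) (b : B) :
    X.inner (X.ract (MulOpposite.op b) x) y = star b * X.inner x y := by
  rw [← X.star_inner, X.inner_ract, star_mul, X.star_inner]

theorem inner_smul_right (x y : X.carrier) (c : ℂ) : X.inner x (c • y) = c • X.inner x y := by
  have := X.inner_ract x y (algebraMap ℂ B c)
  rw [← MulOpposite.algebraMap_apply, AlgHom.commutes, Module.algebraMap_end_apply] at this
  rw [this, ← Algebra.commutes, ← Algebra.smul_def]

theorem exists_gram_factor {n : ℕ} (x : Fin n → X.carrier) :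
    ∃ D : Fin n → Fin n → B, ∀ i j, X.inner (x i) (x j) = ∑ k, star (D k i) * D k j := by
  have _ := isClosed_coe B
  let _ : PartialOrder B := CStarAlgebra.spectralOrder B
  have _ : StarOrderedRing B := CStarAlgebra.spectralOrderedRing B
  refine exists_factor_aux (A := B) (fun i j => X.inner (x i) (x j))
    (fun i j => X.star_inner _ _) fun b => ?_
  have e : ∑ i, ∑ j, star (b i) * X.inner (x i) (x j) * b j =
      X.inner (∑ i, X.ract (MulOpposite.op (b i)) (x i))
        (∑ i, X.ract (MulOpposite.op (b i)) (x i)) := by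
    rw [Finset.sum_comm]
    simp only [inner_sum_left, inner_sum_right, inner_ract_left, X.inner_ract, Finset.sum_mul]
  obtain ⟨c, hc, h⟩ := exists_star_mul_self B (SetLike.coe_mem _)
    (X.inner_self_nonneg (∑ i, X.ract (MulOpposite.op (b i)) (x i)))
  exact ⟨⟨c, hc⟩, e.trans (Subtype.ext h.symm)⟩

end Basic

section Tensor
variable (X : Correspondence A B) (Y : Correspondence B C)

/-- The kernel `((x, y), (x', y')) ↦ ⟨y, ⟨x, x'⟩ y'⟩`. -/
noncomputable def tensorKernel : Matrix (X.carrier × Y.carrier) (X.carrier × Y.carrier) (H₃ →L[ℂ] H₃) :=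
  Matrix.of fun p q => (Y.inner p.2 (Y.lact (X.inner p.1 q.1) q.2) : H₃ →L[ℂ] H₃)

theorem posSemidef_tensorKernel : (tensorKernel X Y).PosSemidef := by
  refine posSemidef_of_finite _ fun n e => ?_
  obtain ⟨D, hD⟩ := X.exists_gram_factor fun i => (e i).1
  choose F hF using fun k => Y.exists_gram_factor fun i => Y.lact (D k i) (e i).2
  convert Matrix.posSemidef_sum Finset.univ fun k _ => Matrix.posSemidef_conjTranspose_mul_self
    (Matrix.of fun i j => (F k i j : H₃ →L[ℂ] H₃))
  ext1 i j
  simp only [Matrix.submatrix_apply, tensorKernel, Matrix.of_apply, hD, map_sum, map_mul,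
    LinearMap.sum_apply, inner_sum_right, Module.End.mul_apply, Matrix.sum_apply,
    Matrix.mul_apply, Matrix.conjTranspose_apply, AddSubmonoidClass.coe_finsetSum]
  refine Finset.sum_congr rfl fun k _ => ?_
  have := Y.inner_lact (D k i) (e i).2 (Y.lact (D k j) (e j).2)
  rw [← this, hF]
  simp

instance : Fact (tensorKernel X Y).PosSemidef := ⟨posSemidef_tensorKernel X Y⟩

/-- The Hilbert space `X ⊗ Y ⊗ H₃`. -/
abbrev TensorSpace : Type u := RKHS.OfKernel (tensorKernel X Y)

/-- The operator `h ↦ x ⊗ y ⊗ h` representing the elementary tensor `x ⊗ y`. -/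
noncomputable def creation (x : X.carrier) (y : Y.carrier) : H₃ →L[ℂ] TensorSpace X Y :=
  kvec (tensorKernel X Y) (x, y)

theorem adjoint_creation_comp (x x' : X.carrier) (y y' : Y.carrier) :
    adjoint (creation X Y x y) ∘L creation X Y x' y' =
      (Y.inner y (Y.lact (X.inner x x') y') : H₃ →L[ℂ] H₃) :=
  adjoint_kvec_comp_kvec (tensorKernel X Y) (x, y) (x', y')

theorem inner_creation (x x' : X.carrier) (y y' : Y.carrier) (h h' : H₃) :
    ⟪creation X Y x y h, creation X Y x' y' h'⟫_ℂ =
      ⟪h, (Y.inner y (Y.lact (X.inner x x') y') : H₃ →L[ℂ] H₃) h'⟫_ℂ :=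
  inner_kvec (tensorKernel X Y) (x, y) (x', y') h h'

theorem ext_creation {L : Type*} [NormedAddCommGroup L] [InnerProductSpace ℂ L]
    [CompleteSpace L] {T T' : TensorSpace X Y →L[ℂ] L}
    (h : ∀ x y v, T (creation X Y x y v) = T' (creation X Y x y v)) : T = T' :=
  eq_of_kvec (tensorKernel X Y) fun p v => h p.1 p.2 v

theorem exists_leftOp (a : A) : ∃ T : TensorSpace X Y →L[ℂ] TensorSpace X Y,
    ∀ x y h, T (creation X Y x y h) = creation X Y (X.lact a x) y h := by
  obtain ⟨c, hc⟩ := exists_complement A a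
  obtain ⟨T, hT⟩ := exists_clm (tensorKernel X Y)
    (fun p => creation X Y (X.lact a p.1) p.2) (fun p => creation X Y (X.lact c p.1) p.2) _
    (norm_nonneg (a : H₁ →L[ℂ] H₁)) fun p q => by
      rw [adjoint_creation_comp, adjoint_creation_comp, X.inner_lact, X.inner_lact]
      have e : X.inner p.1 (X.lact (star a) (X.lact a q.1)) +
          X.inner p.1 (X.lact (star c) (X.lact c q.1)) =
          (((‖(a : H₁ →L[ℂ] H₁)‖ ^ 2 : ℝ) : ℂ)) • X.inner p.1 q.1 := by
        rw [← X.inner_add_right, ← Module.End.mul_apply, ← Module.End.mul_apply, ← map_mul,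
          ← map_mul, ← LinearMap.add_apply, ← map_add, hc, map_smul, map_one, LinearMap.smul_apply,
          inner_smul_right, Module.End.one_apply]
      have e2 := congrArg (fun b => (Y.inner p.2 (Y.lact b q.2) : H₃ →L[ℂ] H₃)) e
      simp only [map_add, map_smul, LinearMap.add_apply, LinearMap.smul_apply, Y.inner_add_right,
        inner_smul_right] at e2
      exact e2
  exact ⟨T, fun x y h => hT (x, y) h⟩

/-- The operator `x ⊗ y ⊗ h ↦ a x ⊗ y ⊗ h`. -/
noncomputable def leftOp (a : A) : TensorSpace X Y →L[ℂ] TensorSpace X Y :=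
  (exists_leftOp X Y a).choose

theorem leftOp_creation_apply (a : A) (x : X.carrier) (y : Y.carrier) (h : H₃) :
    leftOp X Y a (creation X Y x y h) = creation X Y (X.lact a x) y h :=
  (exists_leftOp X Y a).choose_spec x y h

theorem leftOp_comp_creation (a : A) (x : X.carrier) (y : Y.carrier) :
    leftOp X Y a ∘L creation X Y x y = creation X Y (X.lact a x) y :=
  ContinuousLinearMap.ext fun h => leftOp_creation_apply X Y a x y h

end Tensor
end Correspondence

namespace Correspondence
variable {H₁ : Type u} [NormedAddCommGroup H₁] [InnerProductSpace ℂ H₁] [CompleteSpace H₁]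
  {H₂ : Type u} [NormedAddCommGroup H₂] [InnerProductSpace ℂ H₂] [CompleteSpace H₂]
  {H₃ : Type u} [NormedAddCommGroup H₃] [InnerProductSpace ℂ H₃] [CompleteSpace H₃]
  {A : VonNeumannAlgebra H₁} {B : VonNeumannAlgebra H₂} {C : VonNeumannAlgebra H₃}

section Tensor
variable (X : Correspondence A B) (Y : Correspondence B C)

/-- The balanced algebraic tensor product, as a space of operators from `H₃` to `X ⊗ Y ⊗ H₃`. -/
noncomputable def algTensor : Submodule ℂ (H₃ →L[ℂ] TensorSpace X Y) :=
  Submodule.span ℂ (Set.range fun p : X.carrier × Y.carrier => creation X Y p.1 p.2)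

/-- The σ-weak closure of the algebraic tensor product. -/
noncomputable def tensorCarrier : Submodule ℂ (H₃ →L[ℂ] TensorSpace X Y) :=
  sigmaWeakClosure (algTensor X Y)

variable {X Y} in
theorem map_mem_tensorCarrier (f : (H₃ →L[ℂ] TensorSpace X Y) →ₗ[ℂ] (H₃ →L[ℂ] TensorSpace X Y))
    (hf : Continuous[sigmaWeak H₃ (TensorSpace X Y), sigmaWeak H₃ (TensorSpace X Y)] f)
    (h : ∀ x y, f (creation X Y x y) ∈ algTensor X Y) :
    ∀ T ∈ tensorCarrier X Y, f T ∈ tensorCarrier X Y := by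
  refine map_mem_sigmaWeak_closure hf fun T hT => ?_
  refine @subset_closure _ (sigmaWeak _ _) _ _ ?_
  have : algTensor X Y ≤ (algTensor X Y).comap f := by
    refine Submodule.span_le.2 ?_
    rintro _ ⟨p, rfl⟩
    exact h p.1 p.2
  exact this hT

theorem creation_mem (x : X.carrier) (y : Y.carrier) : creation X Y x y ∈ algTensor X Y :=
  Submodule.subset_span ⟨(x, y), rfl⟩

theorem leftOp_comp_mem (a : A) : ∀ T ∈ tensorCarrier X Y, leftOp X Y a ∘L T ∈ tensorCarrier X Y :=
  map_mem_tensorCarrier (X := X) (Y := Y)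
    { toFun := fun T => leftOp X Y a ∘L T
      map_add' := fun _ _ => ContinuousLinearMap.comp_add _ _ _
      map_smul' := fun c T => ContinuousLinearMap.comp_smul _ c T } (continuous_comp_left _)
    fun x y => by
      change leftOp X Y a ∘L creation X Y x y ∈ _
      rw [leftOp_comp_creation]
      exact creation_mem X Y _ _

theorem creation_comp (x : X.carrier) (y : Y.carrier) (b : C) :
    creation X Y x y ∘L (b : H₃ →L[ℂ] H₃) = creation X Y x (Y.ract (MulOpposite.op b) y) := by
  refine ContinuousLinearMap.ext fun h => eq_of_inner_kvec_left (tensorKernel X Y) fun p k => ?_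
  have e1 := inner_creation X Y x p.1 y p.2 ((b : H₃ →L[ℂ] H₃) h) k
  have e2 := inner_creation X Y x p.1 (Y.ract (MulOpposite.op b) y) p.2 h k
  rw [inner_ract_left] at e2
  refine e1.trans (Eq.trans ?_ e2.symm)
  exact (ContinuousLinearMap.adjoint_inner_right _ _ _).symm

theorem comp_mem (b : C) : ∀ T ∈ tensorCarrier X Y,
    T ∘L (b : H₃ →L[ℂ] H₃) ∈ tensorCarrier X Y :=
  map_mem_tensorCarrier (X := X) (Y := Y)
    { toFun := fun T => T ∘L (b : H₃ →L[ℂ] H₃)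
      map_add' := fun _ _ => ContinuousLinearMap.add_comp _ _ _
      map_smul' := fun c T => ContinuousLinearMap.smul_comp c T _ } (continuous_comp_right _)
    fun x y => by
      change creation X Y x y ∘L (b : H₃ →L[ℂ] H₃) ∈ _
      rw [creation_comp]
      exact creation_mem X Y _ _

theorem adjoint_comp_mem_of_algTensor {S T : H₃ →L[ℂ] TensorSpace X Y} (hS : S ∈ algTensor X Y)
    (hT : T ∈ algTensor X Y) : adjoint S ∘L T ∈ C := by
  have h1 : ∀ x y, adjoint (creation X Y x y) ∘L T ∈ C := fun x y => by
    induction hT using Submodule.span_induction with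
    | mem T h =>
      obtain ⟨p, rfl⟩ := h
      change adjoint (creation X Y x y) ∘L creation X Y p.1 p.2 ∈ C
      rw [adjoint_creation_comp]
      exact SetLike.coe_mem _
    | zero => rw [ContinuousLinearMap.comp_zero]; exact zero_mem C
    | add T T' _ _ h h' => rw [ContinuousLinearMap.comp_add]; exact add_mem h h'
    | smul c T _ h => rw [ContinuousLinearMap.comp_smul]; exact SMulMemClass.smul_mem c h
  induction hS using Submodule.span_induction with
  | mem S h =>
    obtain ⟨p, rfl⟩ := h
    exact h1 p.1 p.2
  | zero => rw [map_zero, ContinuousLinearMap.zero_comp]; exact zero_mem C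
  | add T T' _ _ h h' => rw [map_add, ContinuousLinearMap.add_comp]; exact add_mem h h'
  | smul c T _ h =>
    rw [map_smulₛₗ, ContinuousLinearMap.smul_comp]; exact SMulMemClass.smul_mem _ h

theorem adjoint_comp_mem_iff {K : Type*} [NormedAddCommGroup K] [InnerProductSpace ℂ K]
    [CompleteSpace K] (S T : H₃ →L[ℂ] K) : adjoint S ∘L T ∈ C ↔
      ∀ g ∈ C.commutant, ∀ h k, ⟪S (adjoint g k), T h⟫_ℂ = ⟪S k, T (g h)⟫_ℂ := by
  constructor
  · intro h g hg x k
    have := congrArg (fun R : H₃ →L[ℂ] H₃ => ⟪k, R x⟫_ℂ) (commute_of_mem h hg)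
    simpa [ContinuousLinearMap.adjoint_inner_right, ← ContinuousLinearMap.adjoint_inner_left]
      using! this.symm
  · intro h
    refine mem_of_commute C fun g hg => ContinuousLinearMap.ext fun x => ext_inner_left ℂ fun k => ?_
    have := h g hg x k
    change ⟪k, g (adjoint S (T x))⟫_ℂ = ⟪k, adjoint S (T (g x))⟫_ℂ
    rw [ContinuousLinearMap.adjoint_inner_right, ← this, ← ContinuousLinearMap.adjoint_inner_left,
      ContinuousLinearMap.adjoint_inner_right]

theorem adjoint_comp_mem {S T : H₃ →L[ℂ] TensorSpace X Y} (hS : S ∈ tensorCarrier X Y)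
    (hT : T ∈ tensorCarrier X Y) : adjoint S ∘L T ∈ C := by
  have step : ∀ S ∈ algTensor X Y, ∀ T ∈ tensorCarrier X Y, adjoint S ∘L T ∈ C := by
    intro S hS T hT
    rw [adjoint_comp_mem_iff]
    intro g hg h k
    exact inner_eq_of_mem_closure
      (fun T hT => (adjoint_comp_mem_iff S T).1 (adjoint_comp_mem_of_algTensor X Y hS hT) g hg h k)
      T hT
  have hT' : ∀ S ∈ algTensor X Y, adjoint T ∘L S ∈ C := fun S hS => by
    have := star_mem (step S hS T hT)
    change adjoint (adjoint S ∘L T) ∈ C at this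
    rwa [ContinuousLinearMap.adjoint_comp, ContinuousLinearMap.adjoint_adjoint] at this
  have : adjoint T ∘L S ∈ C := by
    rw [adjoint_comp_mem_iff]
    intro g hg h k
    exact inner_eq_of_mem_closure
      (fun S hS => (adjoint_comp_mem_iff T S).1 (hT' S hS) g hg h k) S hS
  have := star_mem this
  change adjoint (adjoint T ∘L S) ∈ C at this
  rwa [ContinuousLinearMap.adjoint_comp, ContinuousLinearMap.adjoint_adjoint] at this

theorem adjoint_leftOp (a : A) : adjoint (leftOp X Y a) = leftOp X Y (star a) := by
  refine eq_of_inner_kvec (tensorKernel X Y) (tensorKernel X Y) fun p h q k => ?_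
  rw [ContinuousLinearMap.adjoint_inner_left]
  have e1 := inner_creation X Y p.1 (X.lact a q.1) p.2 q.2 h k
  have e2 := inner_creation X Y (X.lact (star a) p.1) q.1 p.2 q.2 h k
  rw [X.inner_lact, star_star] at e2
  rw [← leftOp_creation_apply] at e1 e2
  exact e1.trans e2.symm

theorem leftOp_one : leftOp X Y 1 = ContinuousLinearMap.id ℂ _ :=
  ext_creation X Y fun x y v => by
    rw [leftOp_creation_apply, map_one]; rfl

theorem leftOp_mul (a a' : A) : leftOp X Y (a * a') = leftOp X Y a ∘L leftOp X Y a' :=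
  ext_creation X Y fun x y v => by
    rw [ContinuousLinearMap.comp_apply, leftOp_creation_apply, leftOp_creation_apply,
      leftOp_creation_apply, map_mul]; rfl

theorem creation_add_left (x x' : X.carrier) (y : Y.carrier) :
    creation X Y (x + x') y = creation X Y x y + creation X Y x' y := by
  refine ContinuousLinearMap.ext fun h => eq_of_inner_kvec_left (tensorKernel X Y) fun p k => ?_
  have e := inner_creation X Y (x + x') p.1 y p.2 h k
  have e1 := inner_creation X Y x p.1 y p.2 h k
  have e2 := inner_creation X Y x' p.1 y p.2 h k
  have e3 : X.inner (x + x') p.1 = X.inner x p.1 + X.inner x' p.1 := by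
    rw [← X.star_inner, X.inner_add_right, star_add, X.star_inner, X.star_inner]
  rw [e3, map_add, LinearMap.add_apply, Y.inner_add_right] at e
  refine e.trans ?_
  rw [add_apply, inner_add_left]
  refine Eq.trans ?_ (congrArg₂ (· + ·) e1 e2).symm
  rw [← _root_.inner_add_right]
  rfl

theorem creation_smul_left (c : ℂ) (x : X.carrier) (y : Y.carrier) :
    creation X Y (c • x) y = c • creation X Y x y := by
  refine ContinuousLinearMap.ext fun h => eq_of_inner_kvec_left (tensorKernel X Y) fun p k => ?_
  have e := inner_creation X Y (c • x) p.1 y p.2 h k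
  have e1 := inner_creation X Y x p.1 y p.2 h k
  have e3 : X.inner (c • x) p.1 = starRingEnd ℂ c • X.inner x p.1 := by
    rw [← X.star_inner, inner_smul_right, star_smul, X.star_inner]; rfl
  rw [e3, map_smul, LinearMap.smul_apply, inner_smul_right] at e
  refine e.trans ?_
  rw [smul_apply, inner_smul_left]
  refine Eq.trans ?_ (congrArg (starRingEnd ℂ c * ·) e1).symm
  exact _root_.inner_smul_right _ _ _

theorem leftOp_add (a a' : A) : leftOp X Y (a + a') = leftOp X Y a + leftOp X Y a' :=
  ext_creation X Y fun x y v => by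
    rw [add_apply, leftOp_creation_apply, leftOp_creation_apply,
      leftOp_creation_apply, map_add, LinearMap.add_apply, creation_add_left, add_apply]

theorem leftOp_algebraMap (c : ℂ) :
    leftOp X Y (algebraMap ℂ A c) = c • ContinuousLinearMap.id ℂ _ :=
  ext_creation X Y fun x y v => by
    rw [leftOp_creation_apply, AlgHom.commutes, Module.algebraMap_end_apply, creation_smul_left]
    rfl

/-- The left action on the tensor product. -/
noncomputable def tensorLact : A →ₐ[ℂ] Module.End ℂ (tensorCarrier X Y) :=
  { toFun := fun a =>
      { toFun := fun T => ⟨leftOp X Y a ∘L T, leftOp_comp_mem X Y a T T.2⟩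
        map_add' := fun _ _ => Subtype.ext (ContinuousLinearMap.comp_add _ _ _)
        map_smul' := fun c T => Subtype.ext (ContinuousLinearMap.comp_smul _ c _) }
    map_one' := LinearMap.ext fun T => Subtype.ext (by
      change leftOp X Y 1 ∘L _ = _
      rw [leftOp_one]; rfl)
    map_mul' := fun a a' => LinearMap.ext fun T => Subtype.ext (by
      change leftOp X Y (a * a') ∘L _ = leftOp X Y a ∘L (leftOp X Y a' ∘L _)
      rw [leftOp_mul, ContinuousLinearMap.comp_assoc])
    map_zero' := LinearMap.ext fun T => Subtype.ext (by
      change leftOp X Y 0 ∘L _ = 0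
      have := leftOp_algebraMap X Y 0
      rw [map_zero, zero_smul] at this
      rw [this, ContinuousLinearMap.zero_comp])
    map_add' := fun a a' => LinearMap.ext fun T => Subtype.ext (by
      change leftOp X Y (a + a') ∘L _ = leftOp X Y a ∘L _ + leftOp X Y a' ∘L _
      rw [leftOp_add, ContinuousLinearMap.add_comp])
    commutes' := fun c => LinearMap.ext fun T => Subtype.ext (by
      change leftOp X Y (algebraMap ℂ A c) ∘L _ = c • _
      rw [leftOp_algebraMap]; rfl) }

/-- The right action on the tensor product. -/
noncomputable def tensorRact : Cᵐᵒᵖ →ₐ[ℂ] Module.End ℂ (tensorCarrier X Y) :=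
  { toFun := fun b =>
      { toFun := fun T => ⟨T ∘L (b.unop : H₃ →L[ℂ] H₃), comp_mem X Y b.unop T T.2⟩
        map_add' := fun _ _ => Subtype.ext (ContinuousLinearMap.add_comp _ _ _)
        map_smul' := fun c T => Subtype.ext (ContinuousLinearMap.smul_comp c _ _) }
    map_one' := LinearMap.ext fun T => Subtype.ext (ContinuousLinearMap.comp_id _)
    map_mul' := fun b b' => LinearMap.ext fun T =>
      Subtype.ext (ContinuousLinearMap.comp_assoc _ _ _).symm
    map_zero' := LinearMap.ext fun T => Subtype.ext (ContinuousLinearMap.comp_zero _)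
    map_add' := fun b b' => LinearMap.ext fun T =>
      Subtype.ext (ContinuousLinearMap.comp_add _ _ _)
    commutes' := fun c => LinearMap.ext fun T => Subtype.ext (ContinuousLinearMap.ext fun h =>
      map_smul (T : H₃ →L[ℂ] TensorSpace X Y) c h) }

/-- The composition `X ⊗_B Y` of `W⋆`-correspondences: the balanced tensor product with
`⟨x ⊗ y, x' ⊗ y'⟩ = ⟨y, ⟨x, x'⟩ y'⟩`, completed to a self-dual module, i.e. realized by operators
`h ↦ x ⊗ y ⊗ h` and closed σ-weakly. -/
noncomputable def tensor : Correspondence A C where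
  carrier := tensorCarrier X Y
  lact := tensorLact X Y
  ract := tensorRact X Y
  inner S T := ⟨adjoint (S : H₃ →L[ℂ] TensorSpace X Y) ∘L (T : H₃ →L[ℂ] TensorSpace X Y),
    adjoint_comp_mem X Y S.2 T.2⟩
  inner_add_right S T R := Subtype.ext (ContinuousLinearMap.comp_add _ _ _)
  inner_ract S T b := Subtype.ext (ContinuousLinearMap.comp_assoc _ _ _).symm
  star_inner S T := Subtype.ext (by
    change adjoint (adjoint (S : H₃ →L[ℂ] TensorSpace X Y) ∘L (T : H₃ →L[ℂ] TensorSpace X Y)) = _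
    rw [ContinuousLinearMap.adjoint_comp, ContinuousLinearMap.adjoint_adjoint])
  inner_lact a S T := Subtype.ext (by
    change adjoint (leftOp X Y a ∘L (S : H₃ →L[ℂ] TensorSpace X Y)) ∘L _ =
      adjoint (S : H₃ →L[ℂ] TensorSpace X Y) ∘L (leftOp X Y (star a) ∘L _)
    rw [ContinuousLinearMap.adjoint_comp, adjoint_leftOp, ContinuousLinearMap.comp_assoc])
  inner_self_nonneg S := by
    rw [ContinuousLinearMap.nonneg_iff_isPositive]
    exact ContinuousLinearMap.isPositive_adjoint_comp_self _
  inner_self_eq_zero S h := Subtype.ext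
    (ContinuousLinearMap.adjoint_comp_self_eq_zero_iff.1 (congrArg Subtype.val h))

variable {X Y} in
/-- The elementary tensor `x ⊗ y`. -/
noncomputable def tmul (x : X.carrier) (y : Y.carrier) : (tensor X Y).carrier :=
  ⟨creation X Y x y, @subset_closure _ (sigmaWeak _ _) _ _ (creation_mem X Y x y)⟩

end Tensor

/-- Isomorphisms of correspondences: bijective bimodule maps preserving inner products. -/
structure Iso (X Y : Correspondence A B) where
  toLinearEquiv : X.carrier ≃ₗ[ℂ] Y.carrier
  map_lact : ∀ a x, toLinearEquiv (X.lact a x) = Y.lact a (toLinearEquiv x)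
  map_ract : ∀ b x, toLinearEquiv (X.ract b x) = Y.ract b (toLinearEquiv x)
  map_inner : ∀ x x', Y.inner (toLinearEquiv x) (toLinearEquiv x') = X.inner x x'

/-- `W⋆`-correspondences: every bounded `B`-module map `X → B` is `⟨ξ, ·⟩` for some `ξ`, and the left
action of `A` is normal. -/
structure IsWStar (X : Correspondence A B) : Prop where
  selfDual : ∀ Φ : X.carrier →ₗ[ℂ] B,
    (∀ x b, Φ (X.ract (MulOpposite.op b) x) = Φ x * b) →
    (∃ c : ℝ, ∀ x, ‖(Φ x : H₂ →L[ℂ] H₂)‖ ^ 2 ≤ c * ‖(X.inner x x : H₂ →L[ℂ] H₂)‖) →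
    ∃ ξ, ∀ x, Φ x = X.inner ξ x
  normal : ∀ x y, IsNormal fun a : A => X.inner x (X.lact a y)

/-- `X` is a (normal) `A`-`B` equivalence bimodule with left inner product `l`: a `W⋆`-module on both
sides, with `l x y · z = x · ⟨y, z⟩`, each inner product spanning a σ-weakly dense subspace. -/
structure IsEquivalenceBimoduleWith (X : Correspondence A B) (l : X.carrier → X.carrier → A) :
    Prop where
  isWStar : X.IsWStar
  add_left : ∀ x y z, l (x + y) z = l x z + l y z
  lact_left : ∀ a x y, l (X.lact a x) y = a * l x y
  star_l : ∀ x y, star (l x y) = l y x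
  nonneg : ∀ x, 0 ≤ (l x x : H₁ →L[ℂ] H₁)
  definite : ∀ x, l x x = 0 → x = 0
  ract_left : ∀ b x y, l (X.ract (MulOpposite.op b) x) y = l x (X.ract (MulOpposite.op (star b)) y)
  compat : ∀ x y z, X.lact (l x y) z = X.ract (MulOpposite.op (X.inner y z)) x
  selfDual_left : ∀ Φ : X.carrier →ₗ[ℂ] A,
    (∀ a x, Φ (X.lact a x) = a * Φ x) →
    (∃ c : ℝ, ∀ x, ‖(Φ x : H₁ →L[ℂ] H₁)‖ ^ 2 ≤ c * ‖(l x x : H₁ →L[ℂ] H₁)‖) →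
    ∃ ξ, ∀ x, Φ x = l x ξ
  normal_left : ∀ x y, IsNormal fun b : B => l (X.ract (MulOpposite.op b) x) y
  full_right : (sigmaWeakClosure (Submodule.span ℂ
    (Set.range fun p : X.carrier × X.carrier => (X.inner p.1 p.2 : H₂ →L[ℂ] H₂))) :
      Set (H₂ →L[ℂ] H₂)) = B
  full_left : (sigmaWeakClosure (Submodule.span ℂ
    (Set.range fun p : X.carrier × X.carrier => (l p.1 p.2 : H₁ →L[ℂ] H₁))) :
      Set (H₁ →L[ℂ] H₁)) = A

/-- `X` is an `A`-`B` equivalence bimodule for some left inner product. -/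
def IsEquivalenceBimodule (X : Correspondence A B) : Prop :=
  ∃ l : X.carrier → X.carrier → A, X.IsEquivalenceBimoduleWith l

/-- `(A, E)` and `(B, F)` are strongly Morita equivalent: `E ⊗_A X ≅ X ⊗_B F` for some `A`-`B`
equivalence bimodule `X`. -/
def StronglyMoritaEquivalent (E : Correspondence A A) (F : Correspondence B B) : Prop :=
  ∃ X : Correspondence A B, X.IsEquivalenceBimodule ∧ Nonempty (Iso (E.tensor X) (X.tensor F))

end Correspondence

section Operators
variable {H : Type u} [NormedAddCommGroup H] [InnerProductSpace ℂ H] [CompleteSpace H]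
  {M : VonNeumannAlgebra H}

/-- An element of `𝓔_P` as an operator on `H`. -/
def UCPMap.toOp (P : UCPMap M) (Y : P.arveson.carrier) : H →L[ℂ] H :=
  Subtype.val (p := fun Y => Y ∈ P.arvesonSpace) Y

/-- An element of `𝓔_α⋆` as an operator on `H`. -/
def adjointToOp (α : M ≃⋆ₐ[ℂ] M) (T : (arvesonAdjoint α).carrier) : H →L[ℂ] H :=
  Subtype.val (p := fun T => T ∈ (UCPMap.ofAut α).adjointSpace) T

theorem UCPMap.toOp_mem (P : UCPMap M) (Y : P.arveson.carrier) : P.toOp Y ∈ P.arvesonSpace :=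
  Subtype.property (p := fun Y => Y ∈ P.arvesonSpace) Y

theorem UCPMap.mem_adjointSpace (P : UCPMap M) {T : H →L[ℂ] H} :
    T ∈ P.adjointSpace ↔ adjoint T ∈ P.arvesonSpace := Iff.rfl

theorem UCPMap.adjoint_mem_adjointSpace (P : UCPMap M) {Y : H →L[ℂ] H} (hY : Y ∈ P.arvesonSpace) :
    adjoint Y ∈ P.adjointSpace := by
  rwa [P.mem_adjointSpace, ContinuousLinearMap.adjoint_adjoint]

/-- An element of `𝓔_α⋆` as an element of the correspondence. -/
def adjointOf (α : M ≃⋆ₐ[ℂ] M) (T : (UCPMap.ofAut α).adjointSpace) : (arvesonAdjoint α).carrier := T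

/-- The element `T⋆` of `𝓔_α⋆` for `T ∈ 𝓔_α`. -/
noncomputable def adjointMk (α : M ≃⋆ₐ[ℂ] M) (T : (UCPMap.ofAut α).arveson.carrier) :
    (arvesonAdjoint α).carrier :=
  adjointOf α ⟨adjoint ((UCPMap.ofAut α).toOp T),
    (UCPMap.ofAut α).adjoint_mem_adjointSpace ((UCPMap.ofAut α).toOp_mem T)⟩

end Operators

end VNCorr

/-!
Everything is read off from intertwiners. For a unital completely positive map `P` with Stinespring
representation `π_P` of `M` on `M ⊗_P H`, the map `Y ↦ Φ_Y⋆` identifies `𝓔_P` with the space of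
operators `V : H → M ⊗_P H` satisfying `V T = π_P(T) V`, and the inner product becomes `V⋆ W`. For an
endomorphism `α`, `𝓔_α` is the space of all `Y ∈ B(H)` with `Y T = α(T) Y`, with inner product
`Y⋆ Z`; so for an automorphism taking adjoints gives `𝓔_{α⁻¹}`.

Three facts about the intertwiners `H → K` of a representation `π` of `M` on `K` carry the proof.

* *Totality* (`inner_eq_zero_of_normal`): if the vector states of `π` are normal, the ranges of the
  intertwiners span a dense subspace of `K`. A normal positive functional `⟨k, π(·) k⟩` is dominated
  by a vector functional of the infinite amplification of `M` on `ℓ²(H)`, and this gives an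
  intertwiner `ℓ²(H) → K` with `k` in its range.
* *Density* (`intertwiners_le_sigmaWeakClosure`): a right `M'`-submodule of the intertwiners with
  dense total range is σ-weakly dense in all intertwiners. By Hahn–Banach for normal functionals this
  is a statement about one vector of `ℓ²(K)`, where the proof of the double commutant theorem
  applies.
* *Self-duality* (`exists_eq_adjoint_comp`): if the ranges are total, every bounded `M'`-linear map
  from the intertwiners to `M'` has the form `V ↦ ξ⋆ V`.

Density reduces an isomorphism `X ⊗ Y ≅ 𝓔_P` to a map `X × Y → 𝓔_P` that has the right inner products
and total range (`exists_iso_of_total`). For the products `Y Z` the inner products are computed with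
the operators `S ⊗ h ↦ S ⊗ Y h` from `M ⊗_Q H` to `M ⊗_{α ∘ Q} H` for composition with an
endomorphism on the left, and with the unitary `S ⊗ h ↦ α⁻¹(S) ⊗ h` from `M ⊗_P H` to
`M ⊗_{P ∘ α} H` for composition with an automorphism on the right; totality is inherited from the
factors. The ranges of `𝓔_α⋆` are total because the projection onto the common kernel of `𝓔_α` lies in
`M` and is annihilated by `α` (`eq_zero_of_inner_endRep_symm`); the normality of `α⁻¹` is not needed.
For Morita equivalence both `𝓔_P ⊗ 𝓔_α` and `𝓔_α ⊗ 𝓔_Q` are identified with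
`𝓔_{P ∘ α} = 𝓔_{α ∘ Q}`.
-/

set_option linter.unusedSectionVars false

namespace VNCorr
open ContinuousLinearMap (adjoint)

/-! ### Normal functionals and σ-weak closures -/

section NormalFunctionals
variable {H K L : Type*}
  [NormedAddCommGroup H] [InnerProductSpace ℂ H] [CompleteSpace H]
  [NormedAddCommGroup K] [InnerProductSpace ℂ K] [CompleteSpace K]
  [NormedAddCommGroup L] [InnerProductSpace ℂ L] [CompleteSpace L]

/-- The linear functional `T ↦ ∑ ⟪q n, T (p n)⟫` on `B(H, K)`. -/
noncomputable def vectorFunctionalₗ (p : SqSummable H) (q : SqSummable K) :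
    (H →L[ℂ] K) →ₗ[ℂ] ℂ where
  toFun := vectorFunctional p q
  map_add' S T := by
    simp only [vectorFunctional, add_apply, inner_add_right]
    exact (summable_vectorFunctional p q S).tsum_add (summable_vectorFunctional p q T)
  map_smul' c T := by
    simp only [vectorFunctional, smul_apply, inner_smul_right, RingHom.id_apply, smul_eq_mul]
    exact tsum_mul_left

theorem vectorFunctionalₗ_apply (p : SqSummable H) (q : SqSummable K) (T : H →L[ℂ] K) :
    vectorFunctionalₗ p q T = vectorFunctional p q T := rfl

/-- Two square-summable sequences interleaved into one. -/
def SqSummable.interleave (p p' : SqSummable H) : SqSummable H :=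
  ⟨fun n => Sum.elim p.1 p'.1 (Equiv.natSumNatEquivNat.symm n), by
    refine (Equiv.natSumNatEquivNat.symm.summable_iff
      (f := fun s => ‖Sum.elim p.1 p'.1 s‖ ^ 2)).2 ?_
    exact Summable.sum (f := fun s => ‖Sum.elim p.1 p'.1 s‖ ^ 2) p.2 p'.2⟩

theorem vectorFunctional_interleave (p p' : SqSummable H) (q q' : SqSummable K) (T : H →L[ℂ] K) :
    vectorFunctional (p.interleave p') (q.interleave q') T =
      vectorFunctional p q T + vectorFunctional p' q' T := by
  refine (Equiv.natSumNatEquivNat.symm.tsum_eq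
    (fun s => ⟪Sum.elim q.1 q'.1 s, T (Sum.elim p.1 p'.1 s)⟫_ℂ)).trans ?_
  exact Summable.tsum_sum (summable_vectorFunctional p q T) (summable_vectorFunctional p' q' T)

theorem exists_eq_vectorFunctionalₗ {f : (H →L[ℂ] K) →ₗ[ℂ] ℂ}
    (hf : f ∈ Submodule.span ℂ (Set.range fun pq : SqSummable H × SqSummable K =>
      vectorFunctionalₗ pq.1 pq.2)) : ∃ p q, f = vectorFunctionalₗ p q := by
  induction hf using Submodule.span_induction with
  | mem f h =>
    obtain ⟨pq, rfl⟩ := h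
    exact ⟨pq.1, pq.2, rfl⟩
  | zero => exact ⟨SqSummable.single 0, SqSummable.single 0, LinearMap.ext fun T => by
      rw [vectorFunctionalₗ_apply, vectorFunctional_single]; simp⟩
  | add f g _ _ hf hg =>
    obtain ⟨p, q, rfl⟩ := hf
    obtain ⟨p', q', rfl⟩ := hg
    exact ⟨p.interleave p', q.interleave q', LinearMap.ext fun T =>
      (vectorFunctional_interleave p p' q q' T).symm⟩
  | smul c f _ hf =>
    obtain ⟨p, q, rfl⟩ := hf
    refine ⟨p.map (c • ContinuousLinearMap.id ℂ H), q, LinearMap.ext fun T => ?_⟩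
    refine ((vectorFunctionalₗ p q).map_smul c T).symm.trans (tsum_congr fun n => ?_)
    simp [SqSummable.map]

/-- A σ-weakly continuous linear functional on `M` has the form `T ↦ ∑ ⟪q n, T (p n)⟫`. -/
theorem exists_vectorFunctional_of_continuous {M : VonNeumannAlgebra H} (φ : M →ₗ[ℂ] ℂ)
    (hφ : Continuous[TopologicalSpace.induced Subtype.val (sigmaWeak H H), inferInstance] φ) :
    ∃ p q, ∀ T : M, φ T = vectorFunctional p q (T : H →L[ℂ] H) := by
  let ι : M →ₗ[ℂ] (H →L[ℂ] H) := M.toStarSubalgebra.subtype.toAlgHom.toLinearMap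
  let f : SqSummable H × SqSummable H → M →ₗ[ℂ] ℂ := fun pq => vectorFunctionalₗ pq.1 pq.2 ∘ₗ ι
  have htop : TopologicalSpace.induced (Subtype.val : M → H →L[ℂ] H) (sigmaWeak H H) =
      ⨅ pq, TopologicalSpace.induced (f pq) inferInstance := by
    rw [sigmaWeak, induced_compose, Pi.topologicalSpace, induced_iInf]
    simp only [induced_compose]
    rfl
  rw [htop, ← LinearMap.mem_span_iff_continuous] at hφ
  have hr : Set.range f = ι.lcomp ℂ ℂ '' Set.range fun pq : SqSummable H × SqSummable H =>
      vectorFunctionalₗ pq.1 pq.2 := by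
    rw [← Set.range_comp]; rfl
  rw [hr, Submodule.span_image] at hφ
  obtain ⟨g, hg, rfl⟩ := hφ
  obtain ⟨p, q, rfl⟩ := exists_eq_vectorFunctionalₗ hg
  exact ⟨p, q, fun T => rfl⟩

/-- Hahn–Banach for the σ-weak topology: an operator on which every normal functional that
annihilates `V` vanishes lies in the σ-weak closure of `V`. -/
theorem mem_sigmaWeakClosure_of_functional {V : Submodule ℂ (H →L[ℂ] K)} {T : H →L[ℂ] K}
    (h : ∀ p q, (∀ S ∈ V, vectorFunctional p q S = 0) → vectorFunctional p q T = 0) :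
    T ∈ sigmaWeakClosure V := by
  let Φ : (H →L[ℂ] K) → (SqSummable H × SqSummable K) → ℂ := fun T pq =>
    vectorFunctional pq.1 pq.2 T
  change T ∈ @closure _ (TopologicalSpace.induced Φ Pi.topologicalSpace) V
  rw [closure_induced, mem_closure_iff]
  intro U hU hT
  obtain ⟨F, u, hu, hFU⟩ := isOpen_pi_iff.1 hU _ hT
  -- On finitely many coordinates the image of `V` is closed, so it has to contain that of `T`.
  let Ψ : (H →L[ℂ] K) →ₗ[ℂ] (F → ℂ) := LinearMap.pi fun pq => vectorFunctionalₗ pq.1.1 pq.1.2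
  have hmem : Ψ T ∈ V.map Ψ := by
    by_contra hn
    obtain ⟨f, hf, hle⟩ := Submodule.exists_le_ker_of_notMem hn
    classical
    have hspan : f ∘ₗ Ψ ∈ Submodule.span ℂ (Set.range fun pq : SqSummable H × SqSummable K =>
        vectorFunctionalₗ pq.1 pq.2) := by
      have e : f ∘ₗ Ψ = ∑ i, f (Pi.single i 1) • vectorFunctionalₗ i.1.1 i.1.2 := by
        refine LinearMap.ext fun S => ?_
        rw [LinearMap.comp_apply, LinearMap.pi_apply_eq_sum_univ f]
        simp only [LinearMap.sum_apply, LinearMap.smul_apply, smul_eq_mul]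
        refine Finset.sum_congr rfl fun i _ => ?_
        rw [mul_comm]
        congr 2
        ext j
        simp [Pi.single_apply, eq_comm]
      rw [e]
      exact Submodule.sum_mem _ fun i _ => Submodule.smul_mem _ _ (Submodule.subset_span ⟨i, rfl⟩)
    obtain ⟨p, q, hpq⟩ := exists_eq_vectorFunctionalₗ hspan
    refine hf ((LinearMap.congr_fun hpq T).trans (h p q fun S hS => ?_))
    refine (LinearMap.congr_fun hpq S).symm.trans ?_
    exact hle (Submodule.mem_map_of_mem hS)
  obtain ⟨S, hS, hST⟩ := hmem
  refine ⟨Φ S, hFU fun i hi => ?_, S, hS, rfl⟩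
  have : Φ S i = Φ T i := congrFun hST ⟨i, hi⟩
  rw [this]
  exact (hu i hi).2

end NormalFunctionals

/-! ### Infinite amplifications -/

section Amplification
variable {H K L : Type*}
  [NormedAddCommGroup H] [InnerProductSpace ℂ H] [CompleteSpace H]
  [NormedAddCommGroup K] [InnerProductSpace ℂ K] [CompleteSpace K]
  [NormedAddCommGroup L] [InnerProductSpace ℂ L] [CompleteSpace L]

/-- The countable Hilbert sum of copies of `H`. -/
abbrev EllTwo (H : Type*) [NormedAddCommGroup H] : Type _ := lp (fun _ : ℕ => H) 2

theorem memℓp_two_iff {f : ℕ → H} : Memℓp f 2 ↔ Summable fun n => ‖f n‖ ^ 2 := by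
  rw [memℓp_gen_iff (by norm_num)]
  simp

/-- A square-summable sequence as an element of `ℓ²(H)`. -/
def SqSummable.toEllTwo (p : SqSummable H) : EllTwo H := ⟨p.1, memℓp_two_iff.2 p.2⟩

/-- An element of `ℓ²(H)` as a square-summable sequence. -/
def SqSummable.ofEllTwo (x : EllTwo H) : SqSummable H := ⟨x, memℓp_two_iff.1 (lp.memℓp x)⟩

theorem EllTwo.norm_sq (x : EllTwo H) : ‖x‖ ^ 2 = ∑' n, ‖x n‖ ^ 2 := by
  simpa using lp.norm_rpow_eq_tsum (p := 2) (by norm_num) x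

/-- The amplification `(x n) ↦ (T (x n))` of a bounded operator. -/
noncomputable def ampl (T : H →L[ℂ] K) : EllTwo H →L[ℂ] EllTwo K :=
  LinearMap.mkContinuous
    { toFun := fun x => ((SqSummable.ofEllTwo x).map T).toEllTwo
      map_add' := fun x y => lp.ext (funext fun n => map_add T _ _)
      map_smul' := fun c x => lp.ext (funext fun n => map_smul T _ _) } ‖T‖ fun x => by
    refine le_of_sq_le_sq ?_ (by positivity)
    rw [mul_pow, EllTwo.norm_sq, EllTwo.norm_sq, ← tsum_mul_left]
    refine Summable.tsum_le_tsum (fun n => ?_) ((SqSummable.ofEllTwo x).map T).2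
      ((SqSummable.ofEllTwo x).2.mul_left _)
    rw [← mul_pow]
    gcongr
    exact T.le_opNorm _

theorem ampl_apply (T : H →L[ℂ] K) (x : EllTwo H) (n : ℕ) : ampl T x n = T (x n) := rfl

theorem ampl_comp (S : K →L[ℂ] L) (T : H →L[ℂ] K) (x : EllTwo H) :
    ampl S (ampl T x) = ampl (S ∘L T) x := rfl

theorem inner_ampl (T : H →L[ℂ] K) (x : EllTwo H) (y : EllTwo K) :
    ⟪y, ampl T x⟫_ℂ = ⟪ampl (adjoint T) y, x⟫_ℂ := by
  rw [lp.inner_eq_tsum, lp.inner_eq_tsum]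
  exact tsum_congr fun n => (ContinuousLinearMap.adjoint_inner_left _ _ _).symm

theorem vectorFunctional_eq_inner (p : SqSummable H) (q : SqSummable K) (T : H →L[ℂ] K) :
    vectorFunctional p q T = ⟪q.toEllTwo, ampl T p.toEllTwo⟫_ℂ :=
  (lp.inner_eq_tsum q.toEllTwo (ampl T p.toEllTwo)).symm

end Amplification

/-! ### Intertwiners -/

section Intertwiners
variable {H K : Type*}
  [NormedAddCommGroup H] [InnerProductSpace ℂ H] [CompleteSpace H]
  [NormedAddCommGroup K] [InnerProductSpace ℂ K] [CompleteSpace K]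
  {M : VonNeumannAlgebra H} (π : M →⋆ₐ[ℂ] (K →L[ℂ] K))

/-- The space of operators `V : H → K` with `V T = π T V` for all `T ∈ M`. -/
def intertwiners : Submodule ℂ (H →L[ℂ] K) where
  carrier := {V | ∀ T : M, V ∘L (T : H →L[ℂ] H) = π T ∘L V}
  zero_mem' T := by simp
  add_mem' {V W} hV hW T := by
    rw [ContinuousLinearMap.add_comp, hV T, hW T, ContinuousLinearMap.comp_add]
  smul_mem' c V hV T := by
    rw [ContinuousLinearMap.smul_comp, hV T, ContinuousLinearMap.comp_smul]

variable {π}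

theorem coe_star (T : M) : ((star T : M) : H →L[ℂ] H) = adjoint (T : H →L[ℂ] H) := rfl

theorem adjoint_map (T : M) : adjoint (π T) = π (star T) := (map_star π T).symm

theorem comp_adjoint_of_mem_intertwiners {V : H →L[ℂ] K} (hV : V ∈ intertwiners π) (T : M) :
    (T : H →L[ℂ] H) ∘L adjoint V = adjoint V ∘L π T := by
  have := congrArg adjoint (hV (star T))
  rwa [ContinuousLinearMap.adjoint_comp, ContinuousLinearMap.adjoint_comp, coe_star,
    ContinuousLinearMap.adjoint_adjoint, adjoint_map, star_star] at this

theorem adjoint_comp_mem_commutant_of_mem_intertwiners {V W : H →L[ℂ] K}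
    (hV : V ∈ intertwiners π) (hW : W ∈ intertwiners π) : adjoint V ∘L W ∈ M.commutant := by
  refine VonNeumannAlgebra.mem_commutant_iff.2 fun T hT => ?_
  change (T ∘L adjoint V) ∘L W = (adjoint V ∘L W) ∘L T
  rw [comp_adjoint_of_mem_intertwiners hV ⟨T, hT⟩, ContinuousLinearMap.comp_assoc,
    ContinuousLinearMap.comp_assoc, hW ⟨T, hT⟩]

theorem sigmaWeakClosure_le_intertwiners {J : Submodule ℂ (H →L[ℂ] K)} (hJ : J ≤ intertwiners π) :
    sigmaWeakClosure J ≤ intertwiners π := by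
  intro V hV T
  refine ContinuousLinearMap.ext fun h => ext_inner_left ℂ fun k => ?_
  rw [ContinuousLinearMap.comp_apply, ContinuousLinearMap.comp_apply,
    ← ContinuousLinearMap.adjoint_inner_left (π T)]
  refine inner_eq_of_mem_closure (fun W hW => ?_) V hV
  rw [ContinuousLinearMap.adjoint_inner_left]
  exact congrArg (fun A : H →L[ℂ] K => ⟪k, A h⟫_ℂ) (hJ hW T)

/-- A density theorem of double commutant type: a right `M'`-submodule of the space of intertwiners
whose ranges span a dense subspace is σ-weakly dense in it. -/
theorem intertwiners_le_sigmaWeakClosure {J : Submodule ℂ (H →L[ℂ] K)} (hJ : J ≤ intertwiners π)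
    (hmul : ∀ V ∈ J, ∀ b ∈ M.commutant, V ∘L b ∈ J)
    (htot : ∀ k, (∀ V ∈ J, ∀ h, ⟪k, V h⟫_ℂ = 0) → k = 0) :
    intertwiners π ≤ sigmaWeakClosure J := by
  intro V hV
  refine mem_sigmaWeakClosure_of_functional fun p q hpq => ?_
  rw [vectorFunctional_eq_inner]
  let g : (H →L[ℂ] K) →ₗ[ℂ] EllTwo K :=
    { toFun := fun S => ampl S p.toEllTwo
      map_add' := fun _ _ => rfl
      map_smul' := fun _ _ => rfl }
  let D := (J.map g).topologicalClosure
  have hgD : ∀ S ∈ J, g S ∈ D := fun S hS =>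
    (J.map g).le_topologicalClosure (Submodule.mem_map_of_mem hS)
  have hD : ∀ d ∈ D, ⟪q.toEllTwo, d⟫_ℂ = 0 := by
    intro d hd
    have h0 : IsClosed {d : EllTwo K | ⟪q.toEllTwo, d⟫_ℂ = 0} :=
      isClosed_eq (by fun_prop) continuous_const
    refine closure_minimal ?_ h0 hd
    rintro _ ⟨S, hS, rfl⟩
    exact (vectorFunctional_eq_inner p q S).symm.trans (hpq S hS)
  have : CompleteSpace D := (J.map g).isClosed_topologicalClosure.completeSpace_coe
  obtain ⟨d, hd, y, hy, hz⟩ := D.exists_add_mem_mem_orthogonal (g V)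
  -- `y`, the component of `V p` orthogonal to `D`, is killed by all `X X⋆` with `X ∈ J`.
  have hinv : ∀ X ∈ J, ∀ d ∈ D, ampl (X ∘L adjoint X) d ∈ D := by
    intro X hX d hd
    refine map_mem_closure (ampl (X ∘L adjoint X)).continuous hd ?_
    rintro _ ⟨S, hS, rfl⟩
    refine ⟨X ∘L (adjoint X ∘L S), hmul X hX _ ?_, rfl⟩
    exact adjoint_comp_mem_commutant_of_mem_intertwiners (hJ hX) (hJ hS)
  have hker : ∀ X ∈ J, ampl (X ∘L adjoint X) y = 0 := by
    intro X hX
    have h1 : ampl (X ∘L adjoint X) (g V) ∈ D := by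
      refine hgD (X ∘L (adjoint X ∘L V)) (hmul X hX _ ?_)
      exact adjoint_comp_mem_commutant_of_mem_intertwiners (hJ hX) hV
    have h2 : ampl (X ∘L adjoint X) y ∈ D := by
      have e : ampl (X ∘L adjoint X) y =
          ampl (X ∘L adjoint X) (g V) - ampl (X ∘L adjoint X) d := by
        rw [hz, map_add, add_sub_cancel_left]
      rw [e]
      exact D.sub_mem h1 (hinv X hX d hd)
    have h3 := hy _ (hinv X hX _ h2)
    have h4 := inner_ampl (X ∘L adjoint X) y (ampl (X ∘L adjoint X) y)
    rw [ContinuousLinearMap.adjoint_comp, ContinuousLinearMap.adjoint_adjoint, h3] at h4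
    exact inner_self_eq_zero.1 h4
  have hy0 : y = 0 := by
    refine lp.ext (funext fun n => htot _ fun X hX h => ?_)
    have h1 : X (adjoint X (y n)) = 0 := congrArg (fun x : EllTwo K => x n) (hker X hX)
    have h2 : adjoint X (y n) = 0 := by
      rw [← inner_self_eq_zero (𝕜 := ℂ), ContinuousLinearMap.adjoint_inner_left, h1,
        inner_zero_right]
    rw [← ContinuousLinearMap.adjoint_inner_left, h2, inner_zero_left]
  have := hD d hd
  rw [hy0, add_zero] at hz
  rwa [← hz] at this

/-- If the vector state of `k` for the representation `π` is normal, then `k` is a limit of sums of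
vectors `V h` with `V : H → K` an intertwiner. The functional is dominated by a vector functional of
the infinite amplification of `M`, which gives an intertwiner from `ℓ²(H)` to `K` attaining `k`. -/
theorem inner_eq_zero_of_normal {k x : K}
    (hk : Continuous[TopologicalSpace.induced Subtype.val (sigmaWeak H H), inferInstance]
      fun T : M => ⟪k, π T k⟫_ℂ)
    (hx : ∀ V ∈ intertwiners π, ∀ h, ⟪x, V h⟫_ℂ = 0) : ⟪x, k⟫_ℂ = 0 := by
  let ω : M →ₗ[ℂ] ℂ :=
    { toFun := fun T => ⟪k, π T k⟫_ℂ
      map_add' := fun S T => by simp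
      map_smul' := fun c S => by simp }
  obtain ⟨p, q, hpq⟩ := exists_vectorFunctional_of_continuous ω hk
  let ξ : EllTwo H := (2⁻¹ : ℂ) • (p.toEllTwo + q.toEllTwo)
  let g : M →ₗ[ℂ] EllTwo H :=
    { toFun := fun S => ampl (S : H →L[ℂ] H) ξ
      map_add' := fun _ _ => rfl
      map_smul' := fun _ _ => rfl }
  let f : M →ₗ[ℂ] K :=
    { toFun := fun S => π S k
      map_add' := fun S T => by simp
      map_smul' := fun c S => by simp }
  have hfg : ∀ T, ‖f T‖ ≤ ‖g T‖ := by
    intro T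
    have h1 : ⟪f T, f T⟫_ℂ =
        ⟪ampl (T : H →L[ℂ] H) q.toEllTwo, ampl (T : H →L[ℂ] H) p.toEllTwo⟫_ℂ := by
      have e1 : ⟪f T, f T⟫_ℂ = ω (star T * T) := by
        change ⟪π T k, π T k⟫_ℂ = ⟪k, π (star T * T) k⟫_ℂ
        rw [map_mul, map_star]
        exact (ContinuousLinearMap.adjoint_inner_right _ _ _).symm
      rw [e1, hpq, vectorFunctional_eq_inner, inner_ampl (T : H →L[ℂ] H)]
      rw [show (((star T * T : M) : H →L[ℂ] H)) = adjoint (T : H →L[ℂ] H) ∘L (T : H →L[ℂ] H) from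
        rfl, ← ampl_comp, inner_ampl, inner_ampl, ContinuousLinearMap.adjoint_adjoint]
    have h2 : g T = (2⁻¹ : ℂ) • (ampl (T : H →L[ℂ] H) p.toEllTwo +
        ampl (T : H →L[ℂ] H) q.toEllTwo) := by
      change ampl (T : H →L[ℂ] H) ξ = _
      rw [map_smul, map_add]
    set a := ampl (T : H →L[ℂ] H) p.toEllTwo
    set b := ampl (T : H →L[ℂ] H) q.toEllTwo
    have h3 : ‖f T‖ ^ 2 = RCLike.re ⟪b, a⟫_ℂ := by
      rw [← h1, ← norm_sq_eq_re_inner]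
    have h4 : ‖g T‖ ^ 2 = 4⁻¹ * ‖a + b‖ ^ 2 := by
      rw [h2, norm_smul, mul_pow]; norm_num
    have h5 := norm_add_sq (𝕜 := ℂ) b a
    have h6 := norm_sub_sq (𝕜 := ℂ) b a
    rw [add_comm b a] at h5
    refine le_of_sq_le_sq ?_ (norm_nonneg _)
    nlinarith [sq_nonneg ‖b - a‖]
  let D := (LinearMap.range g).topologicalClosure
  have : CompleteSpace D := (LinearMap.range g).isClosed_topologicalClosure.completeSpace_coe
  let g' : M →ₗ[ℂ] D := g.codRestrict D fun T =>
    (LinearMap.range g).le_topologicalClosure ⟨T, rfl⟩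
  have hg' : DenseRange g' := by
    intro d
    rw [closure_subtype, ← Set.range_comp]
    exact d.2
  let F : D →L[ℂ] K := f.extendOfNorm g'
  have hF : ∀ T, F (g' T) = f T := LinearMap.extendOfNorm_eq hg' ⟨1, fun T => by
    rw [one_mul]; exact hfg T⟩
  let V : EllTwo H →L[ℂ] K := F ∘L D.orthogonalProjectionOnto
  have hVg : ∀ T, V (g T) = f T := fun T => by
    rw [← hF]
    exact congrArg F (D.orthogonalProjectionOnto_mem_subspace_eq_self (g' T))
  have hVy : ∀ y ∈ Dᗮ, V y = 0 := fun y hy => by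
    change F (D.orthogonalProjectionOnto y) = 0
    rw [Submodule.orthogonalProjectionOnto_eq_zero_iff.2 hy, map_zero]
  have hVmul : ∀ (T : M) z, V (ampl (T : H →L[ℂ] H) z) = π T (V z) := by
    intro T z
    obtain ⟨d, hd, y, hy, rfl⟩ := D.exists_add_mem_mem_orthogonal z
    have h1 : V (ampl (T : H →L[ℂ] H) d) = π T (V d) := by
      have hc : IsClosed {d : EllTwo H | V (ampl (T : H →L[ℂ] H) d) = π T (V d)} :=
        isClosed_eq (by fun_prop) (by fun_prop)
      refine closure_minimal ?_ hc hd
      rintro _ ⟨S, rfl⟩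
      change V (g (T * S)) = π T (V (g S))
      rw [hVg, hVg]
      change π (T * S) k = π T (π S k)
      rw [map_mul]; rfl
    have h2 : ampl (T : H →L[ℂ] H) y ∈ Dᗮ := by
      rw [Submodule.orthogonal_closure] at hy ⊢
      rintro _ ⟨S, rfl⟩
      rw [inner_ampl]
      exact hy _ ⟨star T * S, rfl⟩
    rw [map_add, map_add, h1, hVy _ h2, map_add, hVy y hy, map_add, map_zero]
  have hVξ : V ξ = k := by
    have e1 : g 1 = ξ := rfl
    have e2 : f 1 = k := by
      change π 1 k = k
      rw [map_one]; rfl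
    rw [← e1, hVg, e2]
  rw [← hVξ]
  have hz : innerSL ℂ x ∘L V = 0 := by
    refine lp.ext_continuousLinearMap (by norm_num) fun n => ContinuousLinearMap.ext fun h => ?_
    refine hx (V ∘L lp.singleContinuousLinearMap ℂ (fun _ : ℕ => H) 2 n) (fun T => ?_) h
    refine ContinuousLinearMap.ext fun h => ?_
    have e : ampl (T : H →L[ℂ] H) (lp.single 2 n h) = lp.single 2 n ((T : H →L[ℂ] H) h) := by
      refine lp.ext (funext fun m => ?_)
      rw [ampl_apply]
      by_cases hm : m = n
      · subst hm; simp
      · simp [hm]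
    have := hVmul T (lp.single 2 n h)
    rw [e] at this
    exact this
  exact congrArg (fun A : EllTwo H →L[ℂ] ℂ => A ξ) hz

end Intertwiners

/-! ### The Arveson correspondence as a space of intertwiners -/

section Stinespring
variable {H : Type u} [NormedAddCommGroup H] [InnerProductSpace ℂ H] [CompleteSpace H]
  {M : VonNeumannAlgebra H} (P : UCPMap M)

theorem UCPMap.tmul_add (S T : M) (h : H) : P.tmul (S + T) h = P.tmul S h + P.tmul T h := by
  refine eq_of_inner_kvec_left P.kernel fun R k => ?_
  rw [inner_add_left]
  have e := P.inner_tmul (S + T) R h k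
  rw [star_add, add_mul, map_add] at e
  refine e.trans (Eq.trans ?_ (congrArg₂ (· + ·) (P.inner_tmul S R h k)
    (P.inner_tmul T R h k)).symm)
  exact inner_add_right _ _ _

theorem UCPMap.tmul_smul (c : ℂ) (T : M) (h : H) : P.tmul (c • T) h = c • P.tmul T h := by
  refine eq_of_inner_kvec_left P.kernel fun R k => ?_
  rw [inner_smul_left]
  have e := P.inner_tmul (c • T) R h k
  rw [star_smul, smul_mul_assoc, map_smul] at e
  refine e.trans (Eq.trans ?_ (congrArg (starRingEnd ℂ c * ·) (P.inner_tmul T R h k)).symm)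
  exact inner_smul_right _ _ _

/-- The Stinespring representation as a `⋆`-homomorphism. -/
noncomputable def UCPMap.pi : M →⋆ₐ[ℂ] (P.Stinespring →L[ℂ] P.Stinespring) where
  toFun := P.piOp
  map_one' := P.ext_tmul fun S h => by rw [P.piOp_tmul, one_mul]; rfl
  map_mul' S T := P.ext_tmul fun R h => by
    change _ = P.piOp S (P.piOp T (P.tmul R h))
    rw [P.piOp_tmul, P.piOp_tmul, P.piOp_tmul, mul_assoc]
  map_zero' := P.ext_tmul fun S h => by
    have := P.tmul_smul 0 (0 * S) h
    rw [zero_smul, zero_smul] at this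
    rw [P.piOp_tmul, zero_mul, this]; rfl
  map_add' S T := P.ext_tmul fun R h => by
    change _ = P.piOp S (P.tmul R h) + P.piOp T (P.tmul R h)
    rw [P.piOp_tmul, P.piOp_tmul, P.piOp_tmul, add_mul, P.tmul_add]
  commutes' c := P.ext_tmul fun S h => by
    rw [P.piOp_tmul, ← Algebra.smul_def, P.tmul_smul, Algebra.algebraMap_eq_smul_one]; rfl
  map_star' T := (P.adjoint_piOp T).symm

theorem UCPMap.pi_tmul (T S : M) (h : H) : P.pi T (P.tmul S h) = P.tmul (T * S) h :=
  P.piOp_tmul T S h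

theorem UCPMap.adjoint_Phi_mem (Y : P.arvesonSpace) : adjoint (P.Phi Y) ∈ intertwiners P.pi := by
  intro T
  have := congrArg adjoint (P.Phi_comp_piOp Y (star T))
  rw [ContinuousLinearMap.adjoint_comp, ContinuousLinearMap.adjoint_comp, P.adjoint_piOp,
    star_star, coe_star, ContinuousLinearMap.adjoint_adjoint] at this
  exact this.symm

theorem UCPMap.Phi_eq {Y : H →L[ℂ] H} {Φ : P.Stinespring →L[ℂ] H}
    (hΦ : ∀ (S : M) h, Φ (P.tmul S h) = (S : H →L[ℂ] H) (adjoint Y h)) :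
    P.Phi ⟨Y, Φ, hΦ⟩ = Φ :=
  P.ext_tmul fun S h => (P.Phi_tmul _ S h).trans (hΦ S h).symm

/-- An intertwiner `V` gives the element `Y` of `𝓔_P` with `Y⋆ h = V⋆ (1 ⊗ h)`. -/
theorem UCPMap.adjoint_apply_tmul_of_mem_intertwiners {V : H →L[ℂ] P.Stinespring}
    (hV : V ∈ intertwiners P.pi) (S : M) (h : H) :
    adjoint V (P.tmul S h) = (S : H →L[ℂ] H) (adjoint (adjoint (P.tmul 1) ∘L V) h) := by
  have e := congrArg (fun A : P.Stinespring →L[ℂ] H => A (P.tmul 1 h))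
    (comp_adjoint_of_mem_intertwiners hV S)
  rw [ContinuousLinearMap.adjoint_comp, ContinuousLinearMap.adjoint_adjoint]
  refine Eq.trans ?_ e.symm
  rw [ContinuousLinearMap.comp_apply, P.pi_tmul, mul_one]

/-- `Y ↦ Φ_Y⋆` identifies `𝓔_P` with the space of intertwiners from `H` to `M ⊗_P H`. -/
noncomputable def UCPMap.intertwinerEquiv : P.arvesonSpace ≃ₗ[ℂ] intertwiners P.pi where
  toFun Y := ⟨adjoint (P.Phi Y), P.adjoint_Phi_mem Y⟩
  map_add' Y Z := Subtype.ext (by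
    change adjoint (P.Phi (Y + Z)) = adjoint (P.Phi Y) + adjoint (P.Phi Z)
    rw [P.Phi_add, map_add])
  map_smul' c Y := Subtype.ext (by
    change adjoint (P.Phi (c • Y)) = c • adjoint (P.Phi Y)
    have : P.Phi (c • Y) = starRingEnd ℂ c • P.Phi Y := P.ext_tmul fun S h => by
      rw [smul_apply, P.Phi_tmul, P.Phi_tmul]
      change (S : H →L[ℂ] H) (adjoint (c • (Y : H →L[ℂ] H)) h) = _
      rw [map_smulₛₗ, smul_apply, map_smul]
    rw [this, map_smulₛₗ, RingHomCompTriple.comp_apply]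
    rfl)
  invFun V := ⟨adjoint (P.tmul 1) ∘L V, adjoint (V : H →L[ℂ] P.Stinespring),
    P.adjoint_apply_tmul_of_mem_intertwiners V.2⟩
  left_inv Y := Subtype.ext (by
    have h1 : P.Phi Y ∘L P.tmul 1 = adjoint (Y : H →L[ℂ] H) := by
      ext h
      exact P.Phi_tmul Y 1 h
    have := congrArg adjoint h1
    rwa [ContinuousLinearMap.adjoint_comp, ContinuousLinearMap.adjoint_adjoint] at this)
  right_inv V := Subtype.ext (by
    change adjoint (P.Phi _) = _
    rw [P.Phi_eq (P.adjoint_apply_tmul_of_mem_intertwiners V.2),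
      ContinuousLinearMap.adjoint_adjoint])

theorem UCPMap.coe_intertwinerEquiv (Y : P.arvesonSpace) :
    (P.intertwinerEquiv Y : H →L[ℂ] P.Stinespring) = adjoint (P.Phi Y) := rfl

theorem UCPMap.coe_inner (Y Z : P.arveson.carrier) :
    (P.arveson.inner Y Z : H →L[ℂ] H) = P.Phi Y ∘L adjoint (P.Phi Z) := rfl

theorem UCPMap.adjoint_Phi_lact (T : M.commutant) (Y : P.arveson.carrier) :
    adjoint (P.Phi (P.arveson.lact T Y)) = P.oneTensor T ∘L adjoint (P.Phi Y) := by
  have : P.Phi (P.arveson.lact T Y) = P.Phi Y ∘L P.oneTensor (star T) :=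
    P.ext_tmul fun S h => by
      rw [ContinuousLinearMap.comp_apply, P.oneTensor_tmul]
      refine (P.Phi_tmul _ S h).trans (Eq.trans ?_ (P.Phi_tmul Y S _).symm)
      change (S : H →L[ℂ] H) (adjoint ((T : H →L[ℂ] H) ∘L (P.toOp Y)) h) = _
      rw [ContinuousLinearMap.adjoint_comp]
      rfl
  rw [this, ContinuousLinearMap.adjoint_comp, P.adjoint_oneTensor, star_star]

theorem UCPMap.adjoint_Phi_ract (T : M.commutant) (Y : P.arveson.carrier) :
    adjoint (P.Phi (P.arveson.ract (MulOpposite.op T) Y)) =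
      adjoint (P.Phi Y) ∘L (T : H →L[ℂ] H) := by
  have : P.Phi (P.arveson.ract (MulOpposite.op T) Y) = adjoint (T : H →L[ℂ] H) ∘L P.Phi Y :=
    P.ext_tmul fun S h => by
      refine (P.Phi_tmul _ S h).trans (Eq.trans ?_
        (congrArg (adjoint (T : H →L[ℂ] H)) (P.Phi_tmul Y S h)).symm)
      change (S : H →L[ℂ] H) (adjoint ((P.toOp Y) ∘L (T : H →L[ℂ] H)) h) = _
      rw [ContinuousLinearMap.adjoint_comp]
      exact congrArg (fun A : H →L[ℂ] H => A (adjoint (P.toOp Y) h))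
        (commute_of_mem S.2 (star_mem T.2))
  rw [this, ContinuousLinearMap.adjoint_comp, ContinuousLinearMap.adjoint_adjoint]

/-- Maps of the form `T ↦ A T B` between von Neumann algebras are normal. -/
theorem isNormal_of_eq_comp {N N' : VonNeumannAlgebra H} {f : N → N'} (A B : H →L[ℂ] H)
    (hf : ∀ T, (f T : H →L[ℂ] H) = A ∘L ((T : H →L[ℂ] H) ∘L B)) : IsNormal f := by
  let _ := TopologicalSpace.induced (Subtype.val : N → H →L[ℂ] H) (sigmaWeak H H)
  refine continuous_induced_rng.2 ?_
  have h1 := @Continuous.comp _ _ _ (sigmaWeak H H) (sigmaWeak H H) (sigmaWeak H H) _ _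
    (continuous_comp_left (H := H) A) (continuous_comp_right (H := H) (K := H) B)
  have h2 := @Continuous.comp _ _ _ _ (sigmaWeak H H) (sigmaWeak H H) _ _ h1
    (continuous_induced_dom (f := (Subtype.val : N → H →L[ℂ] H)) (t := sigmaWeak H H))
  exact (funext hf : Subtype.val ∘ f = _) ▸ h2

theorem IsNormal.continuous_inner {f : M → M} (hf : IsNormal (M := M) (N := M) f) (h k : H) :
    Continuous[TopologicalSpace.induced Subtype.val (sigmaWeak H H), inferInstance]
      fun T : M => ⟪h, (f T : H →L[ℂ] H) k⟫_ℂ := by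
  let _ := TopologicalSpace.induced (Subtype.val : M → H →L[ℂ] H) (sigmaWeak H H)
  have h1 : Continuous fun T : M => vectorFunctional (SqSummable.single k) (SqSummable.single h)
      (f T : H →L[ℂ] H) :=
    @Continuous.comp _ _ _ _ (sigmaWeak H H) _ _ _ (continuous_vectorFunctional _ _)
      (@Continuous.comp _ _ _ _ _ (sigmaWeak H H) _ _ continuous_induced_dom hf)
  simpa only [vectorFunctional_single] using h1

/-- For normal `P` the vectors `Φ_Y⋆ h` span a dense subspace of `M ⊗_P H`. -/
theorem UCPMap.eq_zero_of_inner_adjoint_Phi (hP : IsNormal (M := M) (N := M) P)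
    {x : P.Stinespring} (hx : ∀ (Y : P.arvesonSpace) (h : H), ⟪x, adjoint (P.Phi Y) h⟫_ℂ = 0) :
    x = 0 := by
  refine eq_of_inner_kvec_left P.kernel fun S k => ?_
  rw [inner_zero_left]
  refine inner_eq_zero_of_normal (π := P.pi) (k := P.tmul S k) ?_ fun V hV h => ?_
  · have h1 := IsNormal.continuous_inner (f := fun T : M => P (star S * T * S))
      (@Continuous.comp _ _ _ (TopologicalSpace.induced Subtype.val (sigmaWeak H H))
        (TopologicalSpace.induced Subtype.val (sigmaWeak H H))
        (TopologicalSpace.induced Subtype.val (sigmaWeak H H)) _ _ hP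
        (isNormal_of_eq_comp (star S : M) S fun T => mul_assoc _ _ _)) k k
    convert h1 using 2 with T
    rw [P.pi_tmul, P.inner_tmul, mul_assoc]
  · have := hx (P.intertwinerEquiv.symm ⟨V, hV⟩) h
    rwa [← P.coe_intertwinerEquiv, LinearEquiv.apply_symm_apply] at this

end Stinespring

/-! ### Recognizing `𝓔_P` as a composition of correspondences -/

section Recognition
variable {H : Type u} [NormedAddCommGroup H] [InnerProductSpace ℂ H] [CompleteSpace H]
  {H₂ : Type u} [NormedAddCommGroup H₂] [InnerProductSpace ℂ H₂] [CompleteSpace H₂]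
  {M : VonNeumannAlgebra H} {B : VonNeumannAlgebra H₂}

namespace Correspondence

theorem comp_mem_algTensor (X : Correspondence M.commutant B) (Y : Correspondence B M.commutant)
    {T : H →L[ℂ] TensorSpace X Y} (hT : T ∈ algTensor X Y) (b : M.commutant) :
    T ∘L (b : H →L[ℂ] H) ∈ algTensor X Y := by
  induction hT using Submodule.span_induction with
  | mem S h =>
    obtain ⟨p, rfl⟩ := h
    change creation X Y p.1 p.2 ∘L (b : H →L[ℂ] H) ∈ _
    rw [creation_comp]
    exact creation_mem X Y _ _
  | zero => rw [ContinuousLinearMap.zero_comp]; exact zero_mem _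
  | add T T' _ _ h h' => rw [ContinuousLinearMap.add_comp]; exact add_mem h h'
  | smul c T _ h => rw [ContinuousLinearMap.smul_comp]; exact Submodule.smul_mem _ _ h

/-- A left-linear map `m : X × Y → 𝓔_P` that takes the values of the inner product of `X ⊗ Y` and
is total, in the sense that the vectors `Φ_{m(x,y)}⋆ h` span a dense subspace of `M ⊗_P H`, induces
an isomorphism of `X ⊗ Y` onto `𝓔_P`: it extends to a unitary of `X ⊗ Y ⊗ H` onto `M ⊗_P H`, and
density of submodules of intertwiners identifies the σ-weak closures. -/
theorem exists_iso_of_total (X : Correspondence M.commutant B) (Y : Correspondence B M.commutant)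
    (P : UCPMap M) (m : X.carrier → Y.carrier → P.arveson.carrier)
    (hinner : ∀ x y x' y', P.arveson.inner (m x y) (m x' y') =
      Y.inner y (Y.lact (X.inner x x') y'))
    (hl : ∀ a x y, m (X.lact a x) y = P.arveson.lact a (m x y))
    (htot : ∀ z, (∀ x y h, ⟪z, adjoint (P.Phi (m x y)) h⟫_ℂ = 0) → z = 0) :
    ∃ u : Iso (X.tensor Y) P.arveson, ∀ x y, u.toLinearEquiv (tmul x y) = m x y := by
  obtain ⟨U, hU⟩ := exists_clm (tensorKernel X Y)
    (fun p => adjoint (P.Phi (m p.1 p.2))) (fun _ => (0 : H →L[ℂ] H)) 1 zero_le_one fun p q => by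
      rw [ContinuousLinearMap.adjoint_adjoint, ContinuousLinearMap.comp_zero, add_zero]
      refine (congrArg Subtype.val (hinner p.1 p.2 q.1 q.2)).trans ?_
      simp [tensorKernel]
  replace hU : ∀ x y h, U (creation X Y x y h) = adjoint (P.Phi (m x y)) h :=
    fun x y h => hU (x, y) h
  have hUc : ∀ x y, U ∘L creation X Y x y = adjoint (P.Phi (m x y)) := fun x y =>
    ContinuousLinearMap.ext (hU x y)
  have hUU : adjoint U ∘L U = ContinuousLinearMap.id ℂ _ := by
    refine eq_of_inner_kvec (tensorKernel X Y) (tensorKernel X Y) fun p h q k => ?_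
    rw [ContinuousLinearMap.comp_apply, ContinuousLinearMap.adjoint_inner_left]
    have e1 := hU p.1 p.2 h
    have e2 := hU q.1 q.2 k
    have e3 := inner_creation X Y p.1 q.1 p.2 q.2 h k
    rw [← hinner] at e3
    refine (congrArg₂ (fun a b => ⟪a, b⟫_ℂ) e1 e2).trans (Eq.trans ?_ e3.symm)
    rw [ContinuousLinearMap.adjoint_inner_left]; rfl
  have hUU' : U ∘L adjoint U = ContinuousLinearMap.id ℂ _ := by
    refine ContinuousLinearMap.ext fun z => sub_eq_zero.1 (htot _ fun x y h => ?_)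
    rw [← hU, ← ContinuousLinearMap.adjoint_inner_left, map_sub]
    have := congrArg (fun A : TensorSpace X Y →L[ℂ] TensorSpace X Y => A (adjoint U z)) hUU
    change adjoint U (U (adjoint U z)) = adjoint U z at this
    change ⟪adjoint U (U (adjoint U z)) - adjoint U z, _⟫_ℂ = 0
    rw [this, sub_self, inner_zero_left]
  let J : Submodule ℂ (H →L[ℂ] P.Stinespring) :=
    (algTensor X Y).map ((ContinuousLinearMap.compL ℂ H (TensorSpace X Y) P.Stinespring U).toLinearMap)
  have hJ : J ≤ intertwiners P.pi := by
    rw [Submodule.map_le_iff_le_comap, algTensor, Submodule.span_le]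
    rintro _ ⟨p, rfl⟩
    change U ∘L creation X Y p.1 p.2 ∈ intertwiners P.pi
    rw [hUc]
    exact P.adjoint_Phi_mem _
  have hto : ∀ T ∈ tensorCarrier X Y, U ∘L T ∈ intertwiners P.pi := fun T hT => by
    refine sigmaWeakClosure_le_intertwiners hJ ?_
    refine map_mem_sigmaWeak_closure (continuous_comp_left U) (fun T hT => ?_) T hT
    exact @subset_closure _ (sigmaWeak _ _) _ _ (Submodule.mem_map_of_mem hT)
  have hfrom : ∀ V ∈ intertwiners P.pi, adjoint U ∘L V ∈ tensorCarrier X Y := fun V hV => by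
    have hV' : V ∈ sigmaWeakClosure J := by
      refine intertwiners_le_sigmaWeakClosure hJ ?_ ?_ hV
      · rintro _ ⟨T, hT, rfl⟩ b hb
        exact ⟨_, comp_mem_algTensor X Y hT ⟨b, hb⟩, rfl⟩
      · refine fun z hz => htot z fun x y h => ?_
        have := hz _ (Submodule.mem_map_of_mem (creation_mem X Y x y)) h
        rw [← hU]
        exact this
    refine map_mem_sigmaWeak_closure (continuous_comp_left (adjoint U)) (fun T hT => ?_) V hV'
    obtain ⟨T, hT, rfl⟩ := hT
    refine @subset_closure _ (sigmaWeak _ _) _ _ ?_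
    change adjoint U ∘L (U ∘L T) ∈ algTensor X Y
    rwa [← ContinuousLinearMap.comp_assoc, hUU, ContinuousLinearMap.id_comp]
  let e : tensorCarrier X Y ≃ₗ[ℂ] intertwiners P.pi :=
    { toFun := fun T => ⟨U ∘L T, hto T T.2⟩
      map_add' := fun S T => Subtype.ext (ContinuousLinearMap.comp_add _ _ _)
      map_smul' := fun c T => Subtype.ext (ContinuousLinearMap.comp_smul _ _ _)
      invFun := fun V => ⟨adjoint U ∘L V, hfrom V V.2⟩
      left_inv := fun T => Subtype.ext (by
        change adjoint U ∘L (U ∘L _) = _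
        rw [← ContinuousLinearMap.comp_assoc, hUU, ContinuousLinearMap.id_comp])
      right_inv := fun T => Subtype.ext (by
        change U ∘L (adjoint U ∘L _) = _
        rw [← ContinuousLinearMap.comp_assoc, hUU', ContinuousLinearMap.id_comp]) }
  let v : (X.tensor Y).carrier ≃ₗ[ℂ] P.arveson.carrier := e.trans P.intertwinerEquiv.symm
  have hv : ∀ T : (X.tensor Y).carrier,
      adjoint (P.Phi (v T)) = U ∘L (show tensorCarrier X Y from T).1 := fun T =>
    congrArg Subtype.val (P.intertwinerEquiv.apply_symm_apply (e T))
  have hinj : ∀ {y y' : P.arveson.carrier}, adjoint (P.Phi y) = adjoint (P.Phi y') → y = y' :=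
    fun {y y'} h => P.intertwinerEquiv.injective (Subtype.ext h)
  refine ⟨⟨v, fun a T => hinj ?_, fun b T => hinj ?_, fun S T => Subtype.ext ?_⟩,
    fun x y => hinj ?_⟩
  · have hleft : U ∘L leftOp X Y a = P.oneTensor a ∘L U := ext_creation X Y fun x y h => by
      rw [ContinuousLinearMap.comp_apply, leftOp_creation_apply, hU, hl, P.adjoint_Phi_lact,
        ContinuousLinearMap.comp_apply, ContinuousLinearMap.comp_apply, hU]
    rw [hv, P.adjoint_Phi_lact, hv]
    change U ∘L (leftOp X Y a ∘L _) = _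
    rw [← ContinuousLinearMap.comp_assoc, hleft, ContinuousLinearMap.comp_assoc]
  · induction b using MulOpposite.rec' with
    | _ b =>
      rw [hv, P.adjoint_Phi_ract, hv]
      rfl
  · rw [P.coe_inner, ← ContinuousLinearMap.adjoint_adjoint (P.Phi (v S)), hv, hv,
      ContinuousLinearMap.adjoint_comp, ContinuousLinearMap.comp_assoc,
      ← ContinuousLinearMap.comp_assoc _ U, hUU, ContinuousLinearMap.id_comp]
    rfl
  · rw [hv]
    exact hUc x y

end Correspondence
end Recognition

/-! ### Self-duality of spaces of intertwiners -/

section SelfDual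
variable {H K : Type*}
  [NormedAddCommGroup H] [InnerProductSpace ℂ H] [CompleteSpace H]
  [NormedAddCommGroup K] [InnerProductSpace ℂ K] [CompleteSpace K]
  {M : VonNeumannAlgebra H} {π : M →⋆ₐ[ℂ] (K →L[ℂ] K)}

theorem adjoint_ampl (T : H →L[ℂ] K) : adjoint (ampl T) = ampl (adjoint T) :=
  ((ContinuousLinearMap.eq_adjoint_iff _ _).2 fun x y => (inner_ampl T y x).symm).symm

/-- The operator `(x i) ↦ ∑ i, A i (x i)` on `ℓ²(H)` of a finite row of operators. -/
noncomputable def rowOp {n : ℕ} (A : Fin n → H →L[ℂ] K) : EllTwo H →L[ℂ] K :=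
  ∑ i, A i ∘L lp.evalCLM ℂ (fun _ : ℕ => H) 2 i

theorem rowOp_apply {n : ℕ} (A : Fin n → H →L[ℂ] K) (x : EllTwo H) :
    rowOp A x = ∑ i, A i (x i) := by
  simp [rowOp]
  rfl

theorem rowOp_ampl {n : ℕ} {A : Fin n → H →L[ℂ] K} {S : H →L[ℂ] H} {T : K →L[ℂ] K}
    (h : ∀ i, A i ∘L S = T ∘L A i) : rowOp A ∘L ampl S = T ∘L rowOp A := by
  refine ContinuousLinearMap.ext fun x => ?_
  simp only [ContinuousLinearMap.comp_apply, rowOp_apply, map_sum, ampl_apply]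
  exact Finset.sum_congr rfl fun i _ => congrArg (fun B : H →L[ℂ] K => B (x i)) (h i)

/-- A positive operator becomes invertible after adding `ε > 0`. -/
theorem exists_inverse_add_smul (V : H →L[ℂ] K) {ε : ℝ} (hε : 0 < ε) :
    ∃ S : H →L[ℂ] H, (adjoint V ∘L V + (ε : ℂ) • 1) * S = 1 ∧
      S * (adjoint V ∘L V + (ε : ℂ) • 1) = 1 := by
  have h0 : 0 ≤ adjoint V ∘L V := by
    rw [ContinuousLinearMap.nonneg_iff_isPositive]
    exact ContinuousLinearMap.isPositive_adjoint_comp_self _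
  have h1 : IsUnit (adjoint V ∘L V + (ε : ℂ) • 1) :=
    ((isStrictlyPositive_one.smul (Complex.zero_lt_real.2 hε)).nonneg_add h0).isUnit
  obtain ⟨u, hu⟩ := h1
  exact ⟨(u⁻¹ : (H →L[ℂ] H)ˣ), by rw [← hu]; simp, by rw [← hu]; simp⟩

/-- If `B = (V⋆ V + ε)⁻¹ R⋆`, then a bound for `R B` by `V B` gives a bound for `R` by `V` up to
`ε`: the operator `R B = R (V⋆ V + ε)⁻¹ R⋆` has norm at most `c`, and Cauchy–Schwarz for the form
`⟪V x, V y⟫ + ε ⟪x, y⟫` does the rest. -/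
theorem norm_sq_le_of_regularized {L : Type*} [NormedAddCommGroup L] [InnerProductSpace ℂ L]
    [CompleteSpace L] {V : L →L[ℂ] K} {R : L →L[ℂ] H} {B : H →L[ℂ] L} {ε c : ℝ} (hε : 0 < ε)
    (hGB : ∀ k, adjoint V (V (B k)) + (ε : ℂ) • B k = adjoint R k) (hc0 : 0 ≤ c)
    (hc1 : ‖R ∘L B‖ ^ 2 ≤ c * ‖V ∘L B‖ ^ 2) (x : L) :
    ‖R x‖ ^ 2 ≤ c * (‖V x‖ ^ 2 + ε * ‖x‖ ^ 2) := by
  have hquad : ∀ k, ‖V (B k)‖ ^ 2 + ε * ‖B k‖ ^ 2 = RCLike.re ⟪R (B k), k⟫_ℂ := fun k => by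
    rw [← ContinuousLinearMap.adjoint_inner_right, ← hGB, inner_add_right, inner_smul_right,
      ContinuousLinearMap.adjoint_inner_right, map_add, ← norm_sq_eq_re_inner,
      norm_sq_eq_re_inner (𝕜 := ℂ) (B k)]
    simp
  have hle : ∀ k, RCLike.re ⟪R (B k), k⟫_ℂ ≤ ‖R ∘L B‖ * ‖k‖ ^ 2 := fun k => by
    refine (re_inner_le_norm _ _).trans ?_
    rw [pow_two, ← mul_assoc]
    gcongr
    exact (R ∘L B).le_opNorm k
  have hVB : ‖V ∘L B‖ ^ 2 ≤ ‖R ∘L B‖ := by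
    rw [← Real.le_sqrt (norm_nonneg _) (norm_nonneg _)]
    refine ContinuousLinearMap.opNorm_le_bound _ (Real.sqrt_nonneg _) fun k => ?_
    refine le_of_sq_le_sq ?_ (by positivity)
    rw [mul_pow, Real.sq_sqrt (norm_nonneg _), ContinuousLinearMap.comp_apply]
    have := hquad k
    have := hle k
    nlinarith [mul_nonneg hε.le (sq_nonneg ‖B k‖)]
  have hRB : ‖R ∘L B‖ ≤ c := by
    have h1 : ‖R ∘L B‖ ^ 2 ≤ c * ‖R ∘L B‖ :=
      hc1.trans (mul_le_mul_of_nonneg_left hVB hc0)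
    by_contra! hlt
    nlinarith [norm_nonneg (R ∘L B)]
  set k := R x with hk
  have h1 : ‖k‖ ^ 2 ≤ ‖V (B k)‖ * ‖V x‖ + ε * (‖B k‖ * ‖x‖) := by
    have e1 : ⟪k, k⟫_ℂ = ⟪V (B k), V x⟫_ℂ + ε * ⟪B k, x⟫_ℂ := by
      conv_lhs => rw [hk]
      rw [← ContinuousLinearMap.adjoint_inner_left, ← hk, ← hGB, inner_add_left, inner_smul_left,
        ContinuousLinearMap.adjoint_inner_left, Complex.conj_ofReal]
    rw [norm_sq_eq_re_inner (𝕜 := ℂ) k, e1, map_add]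
    refine add_le_add (re_inner_le_norm _ _) ?_
    have e2 : RCLike.re ((ε : ℂ) * ⟪B k, x⟫_ℂ) = ε * RCLike.re ⟪B k, x⟫_ℂ := by simp
    rw [e2]
    exact mul_le_mul_of_nonneg_left (re_inner_le_norm _ _) hε.le
  have h2 : ‖V (B k)‖ ^ 2 + ε * ‖B k‖ ^ 2 ≤ c * ‖k‖ ^ 2 := by
    rw [hquad]
    exact (hle k).trans (mul_le_mul_of_nonneg_right hRB (sq_nonneg _))
  have h3 : ∀ a b a' b' : ℝ, (a * a' + ε * (b * b')) ^ 2 ≤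
      (a ^ 2 + ε * b ^ 2) * (a' ^ 2 + ε * b' ^ 2) := fun a b a' b' => by
    nlinarith [mul_nonneg hε.le (sq_nonneg (a * b' - b * a'))]
  have h4 : ‖k‖ ^ 2 * ‖k‖ ^ 2 ≤ ‖k‖ ^ 2 * (c * (‖V x‖ ^ 2 + ε * ‖x‖ ^ 2)) := by
    calc ‖k‖ ^ 2 * ‖k‖ ^ 2 = (‖k‖ ^ 2) ^ 2 := by ring
      _ ≤ (‖V (B k)‖ * ‖V x‖ + ε * (‖B k‖ * ‖x‖)) ^ 2 := by gcongr
      _ ≤ _ := h3 _ _ _ _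
      _ ≤ (c * ‖k‖ ^ 2) * (‖V x‖ ^ 2 + ε * ‖x‖ ^ 2) := by gcongr
      _ = _ := by ring
  rcases eq_or_lt_of_le (sq_nonneg ‖k‖) with h0 | h0
  · rw [← h0]; positivity
  · exact le_of_mul_le_mul_left h4 h0

/-- The complete boundedness of bounded module maps: the estimate `‖Φ V‖² ≤ c ‖V⋆ V‖` on single
intertwiners implies the corresponding estimate on finite rows. For `R = (Φ V_i)` and `V = (V_i)` it
is applied to the combination `W = V b` with `b = (V⋆ V + ε)⁻¹ R⋆`, for which
`Φ W = R (V⋆ V + ε)⁻¹ R⋆ ≥ W⋆ W`. -/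
theorem norm_sum_sq_le (Φ : intertwiners π →ₗ[ℂ] M.commutant)
    (hΦ : ∀ (V W : intertwiners π) (b : M.commutant),
      (W : H →L[ℂ] K) = (V : H →L[ℂ] K) ∘L (b : H →L[ℂ] H) → Φ W = Φ V * b)
    {c : ℝ} (hc0 : 0 ≤ c)
    (hc : ∀ V : intertwiners π, ‖(Φ V : H →L[ℂ] H)‖ ^ 2 ≤ c * ‖(V : H →L[ℂ] K)‖ ^ 2)
    {n : ℕ} (v : Fin n → intertwiners π) (x : EllTwo H) :
    ‖∑ i, (Φ (v i) : H →L[ℂ] H) (x i)‖ ^ 2 ≤ c * ‖∑ i, (v i : H →L[ℂ] K) (x i)‖ ^ 2 := by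
  set V := rowOp fun i => (v i : H →L[ℂ] K) with hV
  set R := rowOp fun i => (Φ (v i) : H →L[ℂ] H) with hR
  rw [← rowOp_apply (fun i => (v i : H →L[ℂ] K)), ← rowOp_apply (fun i => (Φ (v i) : H →L[ℂ] H)),
    ← hV, ← hR]
  have hVT : ∀ T : M, V ∘L ampl (T : H →L[ℂ] H) = π T ∘L V := fun T =>
    rowOp_ampl fun i => (v i).2 T
  have hRT : ∀ T : M, R ∘L ampl (T : H →L[ℂ] H) = (T : H →L[ℂ] H) ∘L R := fun T =>
    rowOp_ampl fun i => (commute_of_mem T.2 (Φ (v i)).2).symm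
  have hVT' : ∀ T : M, ampl (T : H →L[ℂ] H) ∘L adjoint V = adjoint V ∘L π T := fun T => by
    have := congrArg adjoint (hVT (star T))
    rwa [ContinuousLinearMap.adjoint_comp, ContinuousLinearMap.adjoint_comp, coe_star,
      adjoint_ampl, ContinuousLinearMap.adjoint_adjoint, adjoint_map, star_star] at this
  have hRT' : ∀ T : M, ampl (T : H →L[ℂ] H) ∘L adjoint R = adjoint R ∘L (T : H →L[ℂ] H) :=
    fun T => by
      have := congrArg adjoint (hRT (star T))
      rwa [ContinuousLinearMap.adjoint_comp, ContinuousLinearMap.adjoint_comp, coe_star,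
        adjoint_ampl, ContinuousLinearMap.adjoint_adjoint] at this
  suffices key : ∀ ε : ℝ, 0 < ε → ‖R x‖ ^ 2 ≤ c * ‖V x‖ ^ 2 + ε * (c * ‖x‖ ^ 2) by
    refine le_of_forall_pos_le_add fun δ hδ => ?_
    have := key (δ / (c * ‖x‖ ^ 2 + 1)) (by positivity)
    refine this.trans (add_le_add le_rfl ?_)
    rw [div_mul_eq_mul_div, div_le_iff₀ (by positivity)]
    nlinarith
  intro ε hε
  obtain ⟨S, hS, hS'⟩ := exists_inverse_add_smul V hε
  let B : H →L[ℂ] EllTwo H := S ∘L adjoint R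
  have hGT : ∀ T : M, ampl (T : H →L[ℂ] H) * (adjoint V ∘L V + (ε : ℂ) • 1) =
      (adjoint V ∘L V + (ε : ℂ) • 1) * ampl (T : H →L[ℂ] H) := fun T => by
    rw [mul_add, add_mul, mul_smul_comm, smul_mul_assoc, mul_one, one_mul]
    congr 1
    change ampl (T : H →L[ℂ] H) ∘L (adjoint V ∘L V) = adjoint V ∘L (V ∘L ampl (T : H →L[ℂ] H))
    rw [← ContinuousLinearMap.comp_assoc, hVT', hVT, ContinuousLinearMap.comp_assoc]
  have hST : ∀ T : M, ampl (T : H →L[ℂ] H) * S = S * ampl (T : H →L[ℂ] H) := fun T => by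
    calc ampl (T : H →L[ℂ] H) * S
        = S * ((adjoint V ∘L V + (ε : ℂ) • 1) * ampl (T : H →L[ℂ] H)) * S := by
          rw [← mul_assoc, hS', one_mul]
      _ = S * ampl (T : H →L[ℂ] H) * ((adjoint V ∘L V + (ε : ℂ) • 1) * S) := by
          rw [← hGT]; simp only [mul_assoc]
      _ = _ := by rw [hS, mul_one]
  have hBT : ∀ T : M, ampl (T : H →L[ℂ] H) ∘L B = B ∘L (T : H →L[ℂ] H) := fun T => by
    change ampl (T : H →L[ℂ] H) ∘L (S ∘L adjoint R) = S ∘L (adjoint R ∘L (T : H →L[ℂ] H))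
    rw [← hRT', ← ContinuousLinearMap.comp_assoc, ← ContinuousLinearMap.comp_assoc]
    exact congrArg (fun A : EllTwo H →L[ℂ] EllTwo H => A ∘L adjoint R) (hST T)
  let b : Fin n → M.commutant := fun i => ⟨lp.evalCLM ℂ (fun _ : ℕ => H) 2 i ∘L B,
    VonNeumannAlgebra.mem_commutant_iff.2 fun T hT => by
      refine ContinuousLinearMap.ext fun h => ?_
      exact congrArg (fun A : H →L[ℂ] EllTwo H => A h i) (hBT ⟨T, hT⟩)⟩
  let vb : Fin n → intertwiners π := fun i => ⟨(v i : H →L[ℂ] K) ∘L (b i : H →L[ℂ] H), fun T => by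
    have e := commute_of_mem T.2 (b i).2
    change (T : H →L[ℂ] H) ∘L (b i : H →L[ℂ] H) = (b i : H →L[ℂ] H) ∘L (T : H →L[ℂ] H) at e
    rw [ContinuousLinearMap.comp_assoc, ← e, ← ContinuousLinearMap.comp_assoc, (v i).2 T,
      ContinuousLinearMap.comp_assoc]⟩
  have hW : ((∑ i, vb i : intertwiners π) : H →L[ℂ] K) = V ∘L B := by
    refine ContinuousLinearMap.ext fun h => ?_
    rw [ContinuousLinearMap.comp_apply, hV, rowOp_apply, AddSubmonoidClass.coe_finsetSum,
      _root_.sum_apply]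
    rfl
  have hΦW : ((Φ (∑ i, vb i) : M.commutant) : H →L[ℂ] H) = R ∘L B := by
    refine ContinuousLinearMap.ext fun h => ?_
    rw [ContinuousLinearMap.comp_apply, hR, rowOp_apply, map_sum, AddSubmonoidClass.coe_finsetSum,
      _root_.sum_apply]
    refine Finset.sum_congr rfl fun i _ => ?_
    rw [hΦ (v i) (vb i) (b i) rfl]
    rfl
  have hc1 := hc (∑ i, vb i)
  rw [hW, hΦW] at hc1
  have hG : ∀ z : EllTwo H, (adjoint V ∘L V + (ε : ℂ) • 1) z = adjoint V (V z) + (ε : ℂ) • z :=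
    fun z => rfl
  have hGB : ∀ k, adjoint V (V (B k)) + (ε : ℂ) • B k = adjoint R k := fun k => by
    rw [← hG]
    exact congrArg (fun A : EllTwo H →L[ℂ] EllTwo H => A (adjoint R k)) hS
  exact (norm_sq_le_of_regularized hε hGB hc0 hc1 x).trans_eq (by ring)

theorem sumMap_single {X V L : Type*} [NormedAddCommGroup V] [InnerProductSpace ℂ V]
    [NormedAddCommGroup L] [InnerProductSpace ℂ L] (a : X → V →L[ℂ] L) (x : X) (v : V) :
    sumMap a (Finsupp.single x v) = a x v := by
  simp [sumMap]

theorem sumMap_eq_sum_fin {X V L : Type*} [NormedAddCommGroup V] [InnerProductSpace ℂ V]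
    [NormedAddCommGroup L] [InnerProductSpace ℂ L] (a : X → V →L[ℂ] L) (s : X →₀ V) :
    sumMap a s = ∑ i, a (s.support.equivFin.symm i) (s (s.support.equivFin.symm i)) := by
  simp only [sumMap, Finsupp.lsum_apply, Finsupp.sum, ContinuousLinearMap.coe_coe]
  rw [s.support.equivFin.symm.sum_comp (fun y => a y (s y))]
  exact (Finset.sum_coe_sort s.support fun y => a y (s y)).symm

/-- Self-duality of a total space of intertwiners: every bounded `M'`-linear map into `M'` has the
form `V ↦ ξ⋆ V`. -/
theorem exists_eq_adjoint_comp (htot : ∀ k, (∀ V ∈ intertwiners π, ∀ h, ⟪k, V h⟫_ℂ = 0) → k = 0)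
    (Φ : intertwiners π →ₗ[ℂ] M.commutant)
    (hΦ : ∀ (V W : intertwiners π) (b : M.commutant),
      (W : H →L[ℂ] K) = (V : H →L[ℂ] K) ∘L (b : H →L[ℂ] H) → Φ W = Φ V * b)
    (hc : ∃ c : ℝ, ∀ V : intertwiners π, ‖(Φ V : H →L[ℂ] H)‖ ^ 2 ≤ c * ‖(V : H →L[ℂ] K)‖ ^ 2) :
    ∃ ξ ∈ intertwiners π, ∀ V : intertwiners π,
      (Φ V : H →L[ℂ] H) = adjoint ξ ∘L (V : H →L[ℂ] K) := by
  obtain ⟨c, hc⟩ := hc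
  let g : intertwiners π → H →L[ℂ] K := fun V => V
  let f : intertwiners π → H →L[ℂ] H := fun V => Φ V
  have hdense : DenseRange (sumMap g) := by
    change Dense ((LinearMap.range (sumMap g) : Submodule ℂ K) : Set K)
    rw [Submodule.dense_iff_topologicalClosure_eq_top, Submodule.topologicalClosure_eq_top_iff,
      Submodule.eq_bot_iff]
    refine fun k hk => htot k fun V hV h => ?_
    rw [← inner_conj_symm, (hk (V h) ⟨Finsupp.single ⟨V, hV⟩ h, by simp [sumMap, g]⟩), map_zero]
  have hbound : ∀ s, ‖sumMap f s‖ ≤ √|c| * ‖sumMap g s‖ := by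
    intro s
    let e := s.support.equivFin.symm
    let x : EllTwo H := ∑ i : Fin s.support.card, lp.single 2 (i : ℕ) (s (e i))
    have hx : ∀ i : Fin s.support.card, x i = s (e i) := fun i => by
      simp only [x, lp.coeFn_sum, Finset.sum_apply]
      rw [Finset.sum_eq_single i]
      · exact lp.single_apply_self _ _ _
      · intro j _ hj
        exact lp.single_apply_ne _ _ _ fun h => hj (Fin.ext h.symm)
      · simp
    have h1 := norm_sum_sq_le Φ hΦ (abs_nonneg c) (fun V => (hc V).trans (by
      gcongr; exact le_abs_self c)) (fun i => (e i : intertwiners π)) x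
    simp only [hx] at h1
    refine le_of_sq_le_sq ?_ (by positivity)
    rw [mul_pow, Real.sq_sqrt (abs_nonneg c), sumMap_eq_sum_fin, sumMap_eq_sum_fin]
    exact h1
  let Ξ : K →L[ℂ] H := (sumMap f).extendOfNorm (sumMap g)
  have hΞ : ∀ (V : intertwiners π) (h : H), Ξ ((V : H →L[ℂ] K) h) = (Φ V : H →L[ℂ] H) h :=
    fun V h => by
      have := LinearMap.extendOfNorm_eq hdense ⟨_, hbound⟩ (Finsupp.single V h)
      rwa [sumMap_single, sumMap_single] at this
  refine ⟨adjoint Ξ, fun T => ?_, fun V => ?_⟩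
  · have h1 : (star T : M) ∘L Ξ = Ξ ∘L π (star T) := by
      have : ((star T : M) : H →L[ℂ] H) ∘L Ξ - Ξ ∘L π (star T) = 0 := by
        have hz : adjoint (((star T : M) : H →L[ℂ] H) ∘L Ξ - Ξ ∘L π (star T)) = 0 := by
          refine ContinuousLinearMap.ext fun k => htot _ fun V hV h => ?_
          rw [ContinuousLinearMap.adjoint_inner_left]
          have e1 := congrArg (fun A : H →L[ℂ] H => A h) (commute_of_mem (star T).2 (Φ ⟨V, hV⟩).2)
          have e2 := congrArg (fun A : H →L[ℂ] K => Ξ (A h)) (hV (star T))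
          have e3 := hΞ ⟨V, hV⟩ (((star T : M) : H →L[ℂ] H) h)
          have e4 := hΞ ⟨V, hV⟩ h
          have e5 : ((star T : M) : H →L[ℂ] H) (Ξ (V h)) = Ξ (π (star T) (V h)) := by
            refine Eq.trans ?_ (e3.symm.trans e2)
            rw [e4]
            exact e1
          change ⟪k, ((star T : M) : H →L[ℂ] H) (Ξ (V h)) - Ξ (π (star T) (V h))⟫_ℂ = 0
          rw [e5, sub_self, inner_zero_right]
        simpa using congrArg adjoint hz
      exact sub_eq_zero.1 this
    have h2 := congrArg adjoint h1
    rwa [ContinuousLinearMap.adjoint_comp, ContinuousLinearMap.adjoint_comp, coe_star,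
      ContinuousLinearMap.adjoint_adjoint, adjoint_map, star_star] at h2
  · rw [ContinuousLinearMap.adjoint_adjoint]
    exact ContinuousLinearMap.ext fun h => (hΞ V h).symm

end SelfDual

/-! ### The correspondence of an endomorphism -/

section Endomorphism
variable {H : Type u} [NormedAddCommGroup H] [InnerProductSpace ℂ H] [CompleteSpace H]
  {M : VonNeumannAlgebra H}

/-- An operator in the space `𝓔_P`, as an element of the correspondence. -/
def UCPMap.mkArveson (P : UCPMap M) {T : H →L[ℂ] H} (hT : T ∈ P.arvesonSpace) :
    P.arveson.carrier := Subtype.mk (p := fun T => T ∈ P.arvesonSpace) T hT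

theorem UCPMap.toOp_mkArveson (P : UCPMap M) {T : H →L[ℂ] H} (hT : T ∈ P.arvesonSpace) :
    P.toOp (P.mkArveson hT) = T := rfl

theorem UCPMap.toOp_injective (P : UCPMap M) : Function.Injective P.toOp := Subtype.val_injective

theorem UCPMap.toOp_add (P : UCPMap M) (X Y : P.arveson.carrier) :
    P.toOp (X + Y) = P.toOp X + P.toOp Y := rfl

theorem UCPMap.toOp_smul (P : UCPMap M) (c : ℂ) (X : P.arveson.carrier) :
    P.toOp (c • X) = c • P.toOp X := rfl

theorem UCPMap.toOp_lact (P : UCPMap M) (a : M.commutant) (X : P.arveson.carrier) :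
    P.toOp (P.arveson.lact a X) = (a : H →L[ℂ] H) * P.toOp X := rfl

theorem UCPMap.toOp_ract (P : UCPMap M) (b : M.commutantᵐᵒᵖ) (X : P.arveson.carrier) :
    P.toOp (P.arveson.ract b X) = P.toOp X * (b.unop : H →L[ℂ] H) := rfl

/-- An endomorphism of `M` as a representation of `M` on `H`. -/
noncomputable def endRep (α : M →⋆ₐ[ℂ] M) : M →⋆ₐ[ℂ] (H →L[ℂ] H) := M.toStarSubalgebra.subtype.comp α

theorem endRep_apply (α : M →⋆ₐ[ℂ] M) (T : M) : endRep α T = (α T : H →L[ℂ] H) := rfl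

theorem UCPMap.tmul_one_ofStarAlgHom (α : M →⋆ₐ[ℂ] M) (S : M) (h : H) :
    adjoint ((UCPMap.ofStarAlgHom α).tmul 1) ((UCPMap.ofStarAlgHom α).tmul S h) =
      (α S : H →L[ℂ] H) h := by
  have := congrArg (fun A : H →L[ℂ] H => A h) ((UCPMap.ofStarAlgHom α).adjoint_tmul_comp 1 S)
  rw [star_one, one_mul] at this
  exact this

theorem adjoint_comp_adjoint_tmul_apply (α : M →⋆ₐ[ℂ] M) {Y : H →L[ℂ] H}
    (hY : Y ∈ intertwiners (endRep α)) (S : M) (h : H) :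
    (adjoint Y ∘L adjoint ((UCPMap.ofStarAlgHom α).tmul 1)) ((UCPMap.ofStarAlgHom α).tmul S h) =
      (S : H →L[ℂ] H) (adjoint Y h) := by
  rw [ContinuousLinearMap.comp_apply, UCPMap.tmul_one_ofStarAlgHom]
  exact (congrArg (fun A : H →L[ℂ] H => A h) (comp_adjoint_of_mem_intertwiners hY S)).symm

theorem arvesonSpace_ofStarAlgHom (α : M →⋆ₐ[ℂ] M) :
    (UCPMap.ofStarAlgHom α).arvesonSpace = intertwiners (endRep α) := by
  ext Y
  exact ⟨fun hY T => intertwines_of_mem α hY T,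
    fun hY => ⟨_, adjoint_comp_adjoint_tmul_apply α hY⟩⟩

/-- In `𝓔_α` the inner product is `⟨Y, Z⟩ = Y⋆ Z`. -/
theorem coe_inner_ofStarAlgHom (α : M →⋆ₐ[ℂ] M) (Y Z : (UCPMap.ofStarAlgHom α).arveson.carrier) :
    ((UCPMap.ofStarAlgHom α).arveson.inner Y Z : H →L[ℂ] H) =
      adjoint ((UCPMap.ofStarAlgHom α).toOp Y) ∘L (UCPMap.ofStarAlgHom α).toOp Z := by
  have hΦ : ∀ Y : (UCPMap.ofStarAlgHom α).arvesonSpace, (UCPMap.ofStarAlgHom α).Phi Y =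
      adjoint (Y : H →L[ℂ] H) ∘L adjoint ((UCPMap.ofStarAlgHom α).tmul 1) := fun Y =>
    (UCPMap.ofStarAlgHom α).Phi_eq (adjoint_comp_adjoint_tmul_apply α
      (arvesonSpace_ofStarAlgHom α ▸ Y.2))
  have h1 : adjoint ((UCPMap.ofStarAlgHom α).tmul 1) ∘L (UCPMap.ofStarAlgHom α).tmul 1 =
      ContinuousLinearMap.id ℂ H := by
    refine ContinuousLinearMap.ext fun h => ?_
    rw [ContinuousLinearMap.comp_apply, UCPMap.tmul_one_ofStarAlgHom, map_one]
    rfl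
  have key : ∀ A B : H →L[ℂ] H, (adjoint A ∘L adjoint ((UCPMap.ofStarAlgHom α).tmul 1)) ∘L
      adjoint (adjoint B ∘L adjoint ((UCPMap.ofStarAlgHom α).tmul 1)) = adjoint A ∘L B :=
    fun A B => by
      rw [ContinuousLinearMap.adjoint_comp, ContinuousLinearMap.adjoint_adjoint,
        ContinuousLinearMap.adjoint_adjoint, ContinuousLinearMap.comp_assoc,
        ← ContinuousLinearMap.comp_assoc _ _ B, h1, ContinuousLinearMap.id_comp]
  exact (congrArg₂ (fun A B => A ∘L adjoint B) (hΦ Y) (hΦ Z)).trans (key _ _)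

/-- The ranges of the operators in `𝓔_α` span a dense subspace, for normal `α`. -/
theorem eq_zero_of_inner_endRep {α : M →⋆ₐ[ℂ] M} (hα : IsNormal (M := M) (N := M) α) {x : H}
    (hx : ∀ V ∈ intertwiners (endRep α), ∀ h, ⟪x, V h⟫_ℂ = 0) : x = 0 :=
  inner_self_eq_zero.1 (inner_eq_zero_of_normal (π := endRep α) (hα.continuous_inner x x) hx)

end Endomorphism

/-! ### The correspondence of an automorphism and its adjoint -/

section Automorphism
variable {H : Type u} [NormedAddCommGroup H] [InnerProductSpace ℂ H] [CompleteSpace H]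
  {M : VonNeumannAlgebra H} (α : M ≃⋆ₐ[ℂ] M)

theorem adjoint_mem_intertwiners_symm {Y : H →L[ℂ] H}
    (hY : Y ∈ intertwiners (endRep (α : M →⋆ₐ[ℂ] M))) :
    adjoint Y ∈ intertwiners (endRep (α.symm : M →⋆ₐ[ℂ] M)) := by
  intro T
  have := comp_adjoint_of_mem_intertwiners hY (α.symm T)
  have e : endRep (α : M →⋆ₐ[ℂ] M) (α.symm T) = (T : H →L[ℂ] H) := by
    rw [endRep_apply]
    exact congrArg Subtype.val (α.apply_symm_apply T)
  rw [e] at this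
  exact this.symm

theorem adjoint_mem_intertwiners_symm_iff {Y : H →L[ℂ] H} :
    adjoint Y ∈ intertwiners (endRep (α.symm : M →⋆ₐ[ℂ] M)) ↔
      Y ∈ intertwiners (endRep (α : M →⋆ₐ[ℂ] M)) :=
  ⟨fun h => by
    have := adjoint_mem_intertwiners_symm α.symm h
    rwa [ContinuousLinearMap.adjoint_adjoint] at this, adjoint_mem_intertwiners_symm α⟩

theorem arvesonSpace_ofAut :
    (UCPMap.ofAut α).arvesonSpace = intertwiners (endRep (α : M →⋆ₐ[ℂ] M)) :=
  arvesonSpace_ofStarAlgHom _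

theorem adjointSpace_ofAut :
    (UCPMap.ofAut α).adjointSpace = intertwiners (endRep (α.symm : M →⋆ₐ[ℂ] M)) := by
  ext T
  rw [UCPMap.mem_adjointSpace, arvesonSpace_ofAut, ← adjoint_mem_intertwiners_symm_iff,
    ContinuousLinearMap.adjoint_adjoint]

theorem arvesonSpace_ofAut_symm :
    (UCPMap.ofAut α.symm).arvesonSpace = (UCPMap.ofAut α).adjointSpace :=
  (arvesonSpace_ofAut α.symm).trans (adjointSpace_ofAut α).symm

theorem coe_inner_ofAut (Y Z : (UCPMap.ofAut α).arveson.carrier) :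
    ((UCPMap.ofAut α).arveson.inner Y Z : H →L[ℂ] H) =
      adjoint ((UCPMap.ofAut α).toOp Y) ∘L (UCPMap.ofAut α).toOp Z :=
  coe_inner_ofStarAlgHom _ Y Z

/-- An operator in `𝓔_{α⁻¹}`, as an element of `𝓔_α⋆`. -/
noncomputable def toArvesonAdjoint (T : (UCPMap.ofAut α.symm).arveson.carrier) : (arvesonAdjoint α).carrier :=
  adjointOf α ⟨(UCPMap.ofAut α.symm).toOp T,
    arvesonSpace_ofAut_symm α ▸ (UCPMap.ofAut α.symm).toOp_mem T⟩

theorem adjointToOp_adjointOf {T : H →L[ℂ] H} (hT : T ∈ (UCPMap.ofAut α).adjointSpace) :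
    adjointToOp α (adjointOf α ⟨T, hT⟩) = T := rfl

theorem adjointToOp_mem (T : (arvesonAdjoint α).carrier) :
    adjointToOp α T ∈ (UCPMap.ofAut α).adjointSpace :=
  Subtype.property (p := fun T => T ∈ (UCPMap.ofAut α).adjointSpace) T

/-- An operator in `𝓔_α⋆`, as an element of `𝓔_{α⁻¹}`. -/
noncomputable def ofArvesonAdjoint (T : (arvesonAdjoint α).carrier) : (UCPMap.ofAut α.symm).arveson.carrier :=
  (UCPMap.ofAut α.symm).mkArveson (T := adjointToOp α T)
    (arvesonSpace_ofAut_symm α ▸ adjointToOp_mem α T)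

theorem adjointToOp_toArvesonAdjoint (T : (UCPMap.ofAut α.symm).arveson.carrier) :
    adjointToOp α (toArvesonAdjoint α T) = (UCPMap.ofAut α.symm).toOp T :=
  adjointToOp_adjointOf α _

theorem toOp_ofArvesonAdjoint (T : (arvesonAdjoint α).carrier) :
    (UCPMap.ofAut α.symm).toOp (ofArvesonAdjoint α T) = adjointToOp α T :=
  (UCPMap.ofAut α.symm).toOp_mkArveson _

theorem adjointToOp_injective : Function.Injective (adjointToOp α) := Subtype.val_injective

theorem adjointToOp_add (X Y : (arvesonAdjoint α).carrier) :
    adjointToOp α (X + Y) = adjointToOp α X + adjointToOp α Y := rfl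

theorem adjointToOp_smul (c : ℂ) (X : (arvesonAdjoint α).carrier) :
    adjointToOp α (c • X) = c • adjointToOp α X := rfl

theorem adjointToOp_lact (a : M.commutant) (X : (arvesonAdjoint α).carrier) :
    adjointToOp α ((arvesonAdjoint α).lact a X) = (a : H →L[ℂ] H) * adjointToOp α X := rfl

theorem adjointToOp_ract (b : M.commutantᵐᵒᵖ) (X : (arvesonAdjoint α).carrier) :
    adjointToOp α ((arvesonAdjoint α).ract b X) = adjointToOp α X * (b.unop : H →L[ℂ] H) := rfl

theorem coe_inner_arvesonAdjoint (S T : (arvesonAdjoint α).carrier) :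
    ((arvesonAdjoint α).inner S T : H →L[ℂ] H) =
      adjoint (adjointToOp α S) ∘L adjointToOp α T := rfl

/-- `𝓔_{α⁻¹}` and `𝓔_α⋆` agree as correspondences. -/
theorem exists_iso_arvesonAdjoint :
    ∃ u : Correspondence.Iso (UCPMap.ofAut α.symm).arveson (arvesonAdjoint α),
      ∀ T, adjointToOp α (u.toLinearEquiv T) = (UCPMap.ofAut α.symm).toOp T := by
  let e : (UCPMap.ofAut α.symm).arveson.carrier ≃ₗ[ℂ] (arvesonAdjoint α).carrier :=
    { toFun := toArvesonAdjoint α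
      map_add' := fun X Y => adjointToOp_injective α (by
        rw [adjointToOp_add]
        simp only [adjointToOp_toArvesonAdjoint]
        rw [UCPMap.toOp_add])
      map_smul' := fun c X => adjointToOp_injective α (by
        rw [RingHom.id_apply, adjointToOp_smul, adjointToOp_toArvesonAdjoint,
          adjointToOp_toArvesonAdjoint, UCPMap.toOp_smul])
      invFun := ofArvesonAdjoint α
      left_inv := fun X => UCPMap.toOp_injective _ (by
        rw [toOp_ofArvesonAdjoint, adjointToOp_toArvesonAdjoint])
      right_inv := fun X => adjointToOp_injective α (by
        rw [adjointToOp_toArvesonAdjoint, toOp_ofArvesonAdjoint]) }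
  have he : ∀ T, adjointToOp α (e T) = (UCPMap.ofAut α.symm).toOp T :=
    adjointToOp_toArvesonAdjoint α
  refine ⟨⟨e, fun a X => adjointToOp_injective α ?_, fun b X => adjointToOp_injective α ?_,
    fun S T => Subtype.ext ?_⟩, he⟩
  · rw [he, UCPMap.toOp_lact, adjointToOp_lact, he]
  · rw [he, UCPMap.toOp_ract, adjointToOp_ract, he]
  · rw [coe_inner_arvesonAdjoint, he, he, coe_inner_ofAut]

/-! ### Density in the commutant -/

/-- For an automorphism the ranges of the operators in `𝓔_α⋆` span a dense subspace as well: the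
projection onto the common kernel of `𝓔_α` belongs to `M` and `α` maps it to an operator that
vanishes on the ranges of `𝓔_α`. -/
theorem eq_zero_of_inner_endRep_symm (hα : IsNormal (M := M) (N := M) α) {x : H}
    (hx : ∀ V ∈ intertwiners (endRep (α.symm : M →⋆ₐ[ℂ] M)), ∀ h, ⟪x, V h⟫_ℂ = 0) : x = 0 := by
  let F : Submodule ℂ H := ⨅ Y : intertwiners (endRep (α : M →⋆ₐ[ℂ] M)),
    LinearMap.ker ((Y : H →L[ℂ] H) : H →ₗ[ℂ] H)
  have hF : ∀ {z}, z ∈ F ↔ ∀ Y ∈ intertwiners (endRep (α : M →⋆ₐ[ℂ] M)), Y z = 0 := by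
    simp [F]
  have hFc : IsClosed (F : Set H) := by
    have : (F : Set H) = ⋂ Y : intertwiners (endRep (α : M →⋆ₐ[ℂ] M)),
        {z | (Y : H →L[ℂ] H) z = 0} := by
      ext z
      simp [hF]
    rw [this]
    exact isClosed_iInter fun Y => isClosed_eq (by fun_prop) continuous_const
  have : CompleteSpace F := hFc.completeSpace_coe
  have hmul : ∀ b ∈ M.commutant, ∀ Y ∈ intertwiners (endRep (α : M →⋆ₐ[ℂ] M)),
      Y ∘L b ∈ intertwiners (endRep (α : M →⋆ₐ[ℂ] M)) := fun b hb Y hY T => by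
    have e := commute_of_mem T.2 hb
    change (T : H →L[ℂ] H) ∘L b = b ∘L (T : H →L[ℂ] H) at e
    rw [ContinuousLinearMap.comp_assoc, ← e, ← ContinuousLinearMap.comp_assoc, hY T,
      ContinuousLinearMap.comp_assoc]
  have hbF : ∀ b ∈ M.commutant, F.starProjection * (b * F.starProjection) =
      b * F.starProjection := fun b hb => by
    refine ContinuousLinearMap.ext fun z => ?_
    refine Submodule.starProjection_eq_self_iff.2 (hF.2 fun Y hY => ?_)
    exact hF.1 (F.starProjection_apply_mem z) _ (hmul b hb Y hY)
  have hf : F.starProjection ∈ M := mem_of_commute M fun b hb => by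
    have h1 := congrArg star (hbF (star b) (star_mem hb))
    have h2 : star F.starProjection = F.starProjection := isSelfAdjoint_starProjection F
    rw [star_mul, star_mul, star_star, h2, mul_assoc] at h1
    rw [← hbF b hb, h1]
  let f : M := ⟨F.starProjection, hf⟩
  have hαf : (α f : H →L[ℂ] H) = 0 := by
    have hz : adjoint (α f : H →L[ℂ] H) = 0 := by
      refine ContinuousLinearMap.ext fun z => eq_zero_of_inner_endRep
        (α := (α : M →⋆ₐ[ℂ] M)) hα fun V hV h => ?_
      rw [ContinuousLinearMap.adjoint_inner_left]
      have h1 := congrArg (fun A : H →L[ℂ] H => A h) (hV f)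
      have h2 : V (F.starProjection h) = 0 := hF.1 (F.starProjection_apply_mem h) V hV
      have h3 : (α f : H →L[ℂ] H) (V h) = 0 := h1.symm.trans h2
      rw [h3, inner_zero_right]
    simpa using congrArg adjoint hz
  have hf0 : f = 0 := (map_eq_zero_iff α (EquivLike.injective α)).1 (Subtype.ext hαf)
  have hxF : x ∈ F := hF.2 fun Y hY => by
    rw [← inner_self_eq_zero (𝕜 := ℂ), ← ContinuousLinearMap.adjoint_inner_right]
    exact hx _ (adjoint_mem_intertwiners_symm α hY) _
  rw [← Submodule.starProjection_eq_self_iff.2 hxF]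
  exact congrArg (fun A : M => (A : H →L[ℂ] H) x) hf0

theorem comp_mem_intertwiners_endRep {α : M →⋆ₐ[ℂ] M} {Y b : H →L[ℂ] H}
    (hY : Y ∈ intertwiners (endRep α)) (hb : b ∈ M.commutant) :
    b ∘L Y ∈ intertwiners (endRep α) := fun T => by
  have e := commute_of_mem (α T).2 hb
  rw [ContinuousLinearMap.comp_assoc, hY T, ← ContinuousLinearMap.comp_assoc,
    ← ContinuousLinearMap.comp_assoc]
  exact congrArg (fun A : H →L[ℂ] H => A ∘L Y) e.symm

/-- A von Neumann algebra `M'` is the σ-weak closure of the span of `{X Y⋆ | X, Y ∈ E}` for a space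
`E` of operators, stable under left multiplication by `M'`, with `X Y⋆ ∈ M'`, such that the ranges of
`E` and of `E⋆` span dense subspaces. -/
theorem sigmaWeakClosure_span_mul_star {E : Submodule ℂ (H →L[ℂ] H)}
    (hmul : ∀ b ∈ M.commutant, ∀ Y ∈ E, b ∘L Y ∈ E)
    (hmem : ∀ X ∈ E, ∀ Y ∈ E, X * star Y ∈ M.commutant)
    (htot : ∀ x, (∀ X ∈ E, ∀ h, ⟪x, X h⟫_ℂ = 0) → x = 0)
    (htot' : ∀ x, (∀ X ∈ E, ∀ h, ⟪x, adjoint X h⟫_ℂ = 0) → x = 0) :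
    (sigmaWeakClosure (Submodule.span ℂ {Z : H →L[ℂ] H | ∃ X ∈ E, ∃ Y ∈ E, Z = X * star Y}) :
      Set (H →L[ℂ] H)) = M.commutant := by
  set J := Submodule.span ℂ {Z : H →L[ℂ] H | ∃ X ∈ E, ∃ Y ∈ E, Z = X * star Y}
  have hI : ∀ {T}, T ∈ intertwiners (endRep (StarAlgHom.id ℂ M)) ↔ T ∈ M.commutant := fun {T} =>
    ⟨fun h => VonNeumannAlgebra.mem_commutant_iff.2 fun g hg => (h ⟨g, hg⟩).symm,
      fun h T => (commute_of_mem T.2 h).symm⟩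
  have hJ : J ≤ intertwiners (endRep (StarAlgHom.id ℂ M)) := by
    refine Submodule.span_le.2 ?_
    rintro _ ⟨X, hX, Y, hY, rfl⟩
    exact hI.2 (hmem X hX Y hY)
  refine Set.Subset.antisymm (fun T hT => hI.1 (sigmaWeakClosure_le_intertwiners hJ hT))
    fun T hT => intertwiners_le_sigmaWeakClosure hJ (fun V hV b hb => ?_) (fun x hx => ?_)
      (hI.2 hT)
  · induction hV using Submodule.span_induction with
    | mem V hV =>
      obtain ⟨X, hX, Y, hY, rfl⟩ := hV
      refine Submodule.subset_span ⟨X, hX, star b * Y, hmul _ (star_mem hb) Y hY, ?_⟩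
      rw [star_mul, star_star, ← mul_assoc]
      rfl
    | zero => rw [ContinuousLinearMap.zero_comp]; exact zero_mem _
    | add T T' _ _ h h' => rw [ContinuousLinearMap.add_comp]; exact add_mem h h'
    | smul c T _ h => rw [ContinuousLinearMap.smul_comp]; exact Submodule.smul_mem _ _ h
  · refine htot x fun X hX h => ?_
    have : adjoint X x = 0 := htot' _ fun Y hY k => by
      rw [ContinuousLinearMap.adjoint_inner_left]
      exact hx _ (Submodule.subset_span ⟨X, hX, Y, hY, rfl⟩) k
    rw [← ContinuousLinearMap.adjoint_inner_left, this, inner_zero_left]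

theorem comp_adjoint_mem_commutant {X Y : H →L[ℂ] H}
    (hX : X ∈ intertwiners (endRep (α : M →⋆ₐ[ℂ] M)))
    (hY : Y ∈ intertwiners (endRep (α : M →⋆ₐ[ℂ] M))) : X * star Y ∈ M.commutant := by
  have := adjoint_comp_mem_commutant_of_mem_intertwiners (adjoint_mem_intertwiners_symm α hX)
    (adjoint_mem_intertwiners_symm α hY)
  rwa [ContinuousLinearMap.adjoint_adjoint] at this

variable {α} in
theorem sigmaWeakClosure_span_ofAut (hα : IsNormal (M := M) (N := M) α) :
    (sigmaWeakClosure (Submodule.span ℂ {Z : H →L[ℂ] H |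
        ∃ X ∈ (UCPMap.ofAut α).arvesonSpace, ∃ Y ∈ (UCPMap.ofAut α).arvesonSpace,
          Z = X * star Y}) : Set (H →L[ℂ] H)) = M.commutant := by
  rw [arvesonSpace_ofAut]
  refine sigmaWeakClosure_span_mul_star (fun b hb Y hY => comp_mem_intertwiners_endRep hY hb)
    (fun X hX Y hY => comp_adjoint_mem_commutant α hX hY)
    (fun x => eq_zero_of_inner_endRep (α := (α : M →⋆ₐ[ℂ] M)) hα)
    fun x hx => eq_zero_of_inner_endRep_symm α hα fun V hV h => ?_
  have := hx (adjoint V) ((adjoint_mem_intertwiners_symm_iff α).1 (by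
    rwa [ContinuousLinearMap.adjoint_adjoint])) h
  rwa [ContinuousLinearMap.adjoint_adjoint] at this

variable {α} in
theorem sigmaWeakClosure_span_ofAut' (hα : IsNormal (M := M) (N := M) α) :
    (sigmaWeakClosure (Submodule.span ℂ {Z : H →L[ℂ] H |
        ∃ X ∈ (UCPMap.ofAut α).arvesonSpace, ∃ Y ∈ (UCPMap.ofAut α).arvesonSpace,
          Z = star X * Y}) : Set (H →L[ℂ] H)) = M.commutant := by
  have hset : {Z : H →L[ℂ] H | ∃ X ∈ (UCPMap.ofAut α).arvesonSpace,
      ∃ Y ∈ (UCPMap.ofAut α).arvesonSpace, Z = star X * Y} =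
      {Z | ∃ X ∈ intertwiners (endRep (α.symm : M →⋆ₐ[ℂ] M)),
        ∃ Y ∈ intertwiners (endRep (α.symm : M →⋆ₐ[ℂ] M)), Z = X * star Y} := by
    rw [arvesonSpace_ofAut]
    ext Z
    constructor
    · rintro ⟨X, hX, Y, hY, rfl⟩
      exact ⟨star X, adjoint_mem_intertwiners_symm α hX, star Y,
        adjoint_mem_intertwiners_symm α hY, by rw [star_star]⟩
    · rintro ⟨X, hX, Y, hY, rfl⟩
      exact ⟨star X, adjoint_mem_intertwiners_symm α.symm hX, star Y,
        adjoint_mem_intertwiners_symm α.symm hY, by rw [star_star]⟩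
  rw [hset]
  refine sigmaWeakClosure_span_mul_star (fun b hb Y hY => comp_mem_intertwiners_endRep hY hb)
    (fun X hX Y hY => comp_adjoint_mem_commutant α.symm hX hY)
    (fun x => eq_zero_of_inner_endRep_symm α hα)
    fun x hx => eq_zero_of_inner_endRep (α := (α : M →⋆ₐ[ℂ] M)) hα fun V hV h => ?_
  have := hx (adjoint V) (adjoint_mem_intertwiners_symm α hV) h
  rwa [ContinuousLinearMap.adjoint_adjoint] at this

/-! ### The equivalence bimodule of an automorphism -/

/-- The left inner product `(X, Y) ↦ X Y⋆` of `𝓔_α`. -/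
noncomputable def leftInner (X Y : (UCPMap.ofAut α).arveson.carrier) : M.commutant :=
  ⟨(UCPMap.ofAut α).toOp X * star ((UCPMap.ofAut α).toOp Y),
    comp_adjoint_mem_commutant α (arvesonSpace_ofAut α ▸ (UCPMap.ofAut α).toOp_mem X)
      (arvesonSpace_ofAut α ▸ (UCPMap.ofAut α).toOp_mem Y)⟩

theorem coe_leftInner (X Y : (UCPMap.ofAut α).arveson.carrier) :
    (leftInner α X Y : H →L[ℂ] H) =
      (UCPMap.ofAut α).toOp X * star ((UCPMap.ofAut α).toOp Y) := rfl

variable {α}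

theorem isWStar_ofAut (hα : IsNormal (M := M) (N := M) α) :
    (UCPMap.ofAut α).arveson.IsWStar where
  selfDual Φ hΦ hc := by
    let Ψ : intertwiners (endRep (α : M →⋆ₐ[ℂ] M)) →ₗ[ℂ] M.commutant :=
      (show (UCPMap.ofAut α).arvesonSpace →ₗ[ℂ] M.commutant from Φ) ∘ₗ
        (LinearEquiv.ofEq _ _ (arvesonSpace_ofAut α).symm).toLinearMap
    obtain ⟨c, hc⟩ := hc
    obtain ⟨ξ, hξ, h⟩ := exists_eq_adjoint_comp
      (fun x => eq_zero_of_inner_endRep (α := (α : M →⋆ₐ[ℂ] M)) hα) Ψ (fun V W b hVW => by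
        refine Eq.trans ?_ (hΦ (LinearEquiv.ofEq _ _ (arvesonSpace_ofAut α).symm V) b)
        exact congrArg Φ (Subtype.ext hVW)) ⟨c, fun V => by
        refine (hc (LinearEquiv.ofEq _ _ (arvesonSpace_ofAut α).symm V)).trans_eq ?_
        refine congrArg (c * ·) ((congrArg norm (coe_inner_ofAut α _ _)).trans ?_)
        exact (ContinuousLinearMap.norm_adjoint_comp_self (V : H →L[ℂ] H)).trans
          (pow_two _).symm⟩
    refine ⟨LinearEquiv.ofEq _ _ (arvesonSpace_ofAut α).symm ⟨ξ, hξ⟩, fun X => Subtype.ext ?_⟩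
    refine Eq.trans ?_ (coe_inner_ofAut α _ X).symm
    exact h (LinearEquiv.ofEq _ _ (arvesonSpace_ofAut α) X)
  normal X Y := isNormal_of_eq_comp (adjoint ((UCPMap.ofAut α).toOp X))
    ((UCPMap.ofAut α).toOp Y) fun a => coe_inner_ofAut α X _

theorem exists_eq_leftInner (hα : IsNormal (M := M) (N := M) α)
    (Φ : (UCPMap.ofAut α).arveson.carrier →ₗ[ℂ] M.commutant)
    (hΦ : ∀ a x, Φ ((UCPMap.ofAut α).arveson.lact a x) = a * Φ x)
    (hc : ∃ c : ℝ, ∀ x, ‖(Φ x : H →L[ℂ] H)‖ ^ 2 ≤ c * ‖(leftInner α x x : H →L[ℂ] H)‖) :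
    ∃ ξ, ∀ x, Φ x = leftInner α x ξ := by
  obtain ⟨c, hc⟩ := hc
  have hmem : ∀ Y ∈ intertwiners (endRep (α.symm : M →⋆ₐ[ℂ] M)),
      adjoint Y ∈ (UCPMap.ofAut α).arvesonSpace := fun Y hY => by
    rw [arvesonSpace_ofAut]
    exact adjoint_mem_intertwiners_symm α.symm hY
  let j : intertwiners (endRep (α.symm : M →⋆ₐ[ℂ] M)) → (UCPMap.ofAut α).arveson.carrier :=
    fun Y => (⟨adjoint (Y : H →L[ℂ] H), hmem Y Y.2⟩ : (UCPMap.ofAut α).arvesonSpace)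
  have hjadd : ∀ Y Z, j (Y + Z) = j Y + j Z := fun Y Z => Subtype.ext (map_add _ _ _)
  have hjsmul : ∀ (c : ℂ) Y, j (c • Y) = starRingEnd ℂ c • j Y := fun c Y =>
    Subtype.ext (map_smulₛₗ _ _ _)
  let Ψ : intertwiners (endRep (α.symm : M →⋆ₐ[ℂ] M)) →ₗ[ℂ] M.commutant :=
    { toFun := fun Y => star (Φ (j Y))
      map_add' := fun Y Z => by rw [hjadd, map_add, star_add]
      map_smul' := fun c Y => by
        rw [hjsmul, map_smul, star_smul, RingHom.id_apply]
        congr 1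
        exact star_star c }
  obtain ⟨ξ, hξ, h⟩ := exists_eq_adjoint_comp
    (fun x => eq_zero_of_inner_endRep_symm α hα) Ψ (fun V W b hVW => by
      have e : j W = (UCPMap.ofAut α).arveson.lact (star b) (j V) := by
        refine Subtype.ext ?_
        change adjoint (W : H →L[ℂ] H) = adjoint (b : H →L[ℂ] H) ∘L adjoint (V : H →L[ℂ] H)
        rw [hVW, ContinuousLinearMap.adjoint_comp]
      change star (Φ (j W)) = star (Φ (j V)) * b
      rw [e, hΦ, star_mul, star_star]) ⟨c, fun V => by
      have h1 := hc (j V)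
      have h2 : (leftInner α (j V) (j V) : H →L[ℂ] H) =
          adjoint (V : H →L[ℂ] H) ∘L (V : H →L[ℂ] H) := by
        rw [coe_leftInner]
        exact congrArg (fun A => adjoint (V : H →L[ℂ] H) ∘L A)
          (ContinuousLinearMap.adjoint_adjoint _)
      rw [h2, ContinuousLinearMap.norm_adjoint_comp_self, ← pow_two] at h1
      refine le_of_eq_of_le ?_ h1
      exact congrArg (· ^ 2) (norm_star _)⟩
  refine ⟨j ⟨ξ, hξ⟩, fun x => Subtype.ext ?_⟩
  let x' : intertwiners (endRep (α.symm : M →⋆ₐ[ℂ] M)) :=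
    ⟨adjoint ((UCPMap.ofAut α).toOp x), adjoint_mem_intertwiners_symm α
      (arvesonSpace_ofAut α ▸ (UCPMap.ofAut α).toOp_mem x)⟩
  have hx : j x' = x := Subtype.ext (ContinuousLinearMap.adjoint_adjoint _)
  have h1 := congrArg adjoint (h x')
  rw [ContinuousLinearMap.adjoint_comp, ContinuousLinearMap.adjoint_adjoint] at h1
  have h2 : adjoint ((Ψ x' : M.commutant) : H →L[ℂ] H) = Φ x := by
    change star (star (Φ (j x') : H →L[ℂ] H)) = _
    rw [star_star, hx]
  rw [h2] at h1
  refine h1.trans ?_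
  rw [coe_leftInner]
  rfl

/-- `𝓔_α` is an equivalence bimodule. -/
theorem isEquivalenceBimoduleWith_leftInner (hα : IsNormal (M := M) (N := M) α) :
    (UCPMap.ofAut α).arveson.IsEquivalenceBimoduleWith (leftInner α) where
  isWStar := isWStar_ofAut hα
  add_left X Y Z := Subtype.ext (add_mul _ _ _)
  lact_left a X Y := Subtype.ext (mul_assoc _ _ _)
  star_l X Y := Subtype.ext (by
    change star ((UCPMap.ofAut α).toOp X * star ((UCPMap.ofAut α).toOp Y)) = _
    rw [star_mul, star_star]; rfl)
  nonneg X := mul_star_self_nonneg _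
  definite X hX := Subtype.ext (CStarRing.mul_star_self_eq_zero_iff _ |>.1
    (congrArg Subtype.val hX))
  ract_left b X Y := Subtype.ext (by
    change (UCPMap.ofAut α).toOp X * (b : H →L[ℂ] H) * star ((UCPMap.ofAut α).toOp Y) =
      (UCPMap.ofAut α).toOp X * star ((UCPMap.ofAut α).toOp Y * star (b : H →L[ℂ] H))
    rw [star_mul, star_star, mul_assoc])
  compat X Y Z := Subtype.ext (by
    change (UCPMap.ofAut α).toOp X * star ((UCPMap.ofAut α).toOp Y) * (UCPMap.ofAut α).toOp Z =
      (UCPMap.ofAut α).toOp X * ((UCPMap.ofAut α).arveson.inner Y Z : H →L[ℂ] H)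
    rw [coe_inner_ofAut, mul_assoc]
    rfl)
  selfDual_left := exists_eq_leftInner hα
  normal_left X Y := isNormal_of_eq_comp ((UCPMap.ofAut α).toOp X)
    (star ((UCPMap.ofAut α).toOp Y)) fun b => mul_assoc _ _ _
  full_right := by
    rw [← sigmaWeakClosure_span_ofAut' hα]
    congr 3
    ext Z
    constructor
    · rintro ⟨p, rfl⟩
      exact ⟨_, (UCPMap.ofAut α).toOp_mem p.1, _, (UCPMap.ofAut α).toOp_mem p.2,
        coe_inner_ofAut α p.1 p.2⟩
    · rintro ⟨X, hX, Y, hY, rfl⟩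
      exact ⟨(⟨X, hX⟩, ⟨Y, hY⟩), coe_inner_ofAut α _ _⟩
  full_left := by
    rw [← sigmaWeakClosure_span_ofAut hα]
    congr 3
    ext Z
    constructor
    · rintro ⟨p, rfl⟩
      exact ⟨_, (UCPMap.ofAut α).toOp_mem p.1, _, (UCPMap.ofAut α).toOp_mem p.2, rfl⟩
    · rintro ⟨X, hX, Y, hY, rfl⟩
      exact ⟨(⟨X, hX⟩, ⟨Y, hY⟩), rfl⟩

end Automorphism

/-! ### Isomorphisms of correspondences -/

section Isomorphisms
variable {H₁ : Type u} [NormedAddCommGroup H₁] [InnerProductSpace ℂ H₁] [CompleteSpace H₁]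
  {H₂ : Type u} [NormedAddCommGroup H₂] [InnerProductSpace ℂ H₂] [CompleteSpace H₂]
  {A : VonNeumannAlgebra H₁} {B : VonNeumannAlgebra H₂}

namespace Correspondence

/-- The identity isomorphism. -/
def Iso.refl (X : Correspondence A B) : Iso X X where
  toLinearEquiv := LinearEquiv.refl ℂ X.carrier
  map_lact _ _ := rfl
  map_ract _ _ := rfl
  map_inner _ _ := rfl

/-- The inverse isomorphism. -/
def Iso.symm {X Y : Correspondence A B} (u : Iso X Y) : Iso Y X where
  toLinearEquiv := u.toLinearEquiv.symm
  map_lact a y := u.toLinearEquiv.injective (by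
    rw [u.map_lact, LinearEquiv.apply_symm_apply, LinearEquiv.apply_symm_apply])
  map_ract b y := u.toLinearEquiv.injective (by
    rw [u.map_ract, LinearEquiv.apply_symm_apply, LinearEquiv.apply_symm_apply])
  map_inner y y' := by
    rw [← u.map_inner, LinearEquiv.apply_symm_apply, LinearEquiv.apply_symm_apply]

/-- The composition of isomorphisms. -/
def Iso.trans {X Y Z : Correspondence A B} (u : Iso X Y) (v : Iso Y Z) : Iso X Z where
  toLinearEquiv := u.toLinearEquiv.trans v.toLinearEquiv
  map_lact a x := by
    rw [LinearEquiv.trans_apply, LinearEquiv.trans_apply, u.map_lact, v.map_lact]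
  map_ract b x := by
    rw [LinearEquiv.trans_apply, LinearEquiv.trans_apply, u.map_ract, v.map_ract]
  map_inner x x' := by
    rw [LinearEquiv.trans_apply, LinearEquiv.trans_apply, v.map_inner, u.map_inner]

end Correspondence
end Isomorphisms

section Compositions
variable {H : Type u} [NormedAddCommGroup H] [InnerProductSpace ℂ H] [CompleteSpace H]
  {M : VonNeumannAlgebra H}

open Correspondence

theorem UCPMap.coe_inner_lact (P : UCPMap M) (Z Z' : P.arveson.carrier) (a : M.commutant) :
    (P.arveson.inner Z (P.arveson.lact a Z') : H →L[ℂ] H) =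
      P.Phi Z ∘L (P.oneTensor a ∘L adjoint (P.Phi Z')) := by
  rw [P.coe_inner, P.adjoint_Phi_lact]

theorem UCPMap.Phi_mkArveson (P : UCPMap M) {Y : H →L[ℂ] H} {Φ : P.Stinespring →L[ℂ] H}
    (hΦ : ∀ (S : M) h, Φ (P.tmul S h) = (S : H →L[ℂ] H) (adjoint Y h)) (hY : Y ∈ P.arvesonSpace) :
    P.Phi (P.mkArveson hY) = Φ := P.Phi_eq hΦ

theorem IsNormal.comp {f g : M → M} (hf : IsNormal (M := M) (N := M) f)
    (hg : IsNormal (M := M) (N := M) g) : IsNormal (M := M) (N := M) (f ∘ g) :=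
  @Continuous.comp _ _ _ (TopologicalSpace.induced Subtype.val (sigmaWeak H H))
    (TopologicalSpace.induced Subtype.val (sigmaWeak H H))
    (TopologicalSpace.induced Subtype.val (sigmaWeak H H)) _ _ hf hg

/-! ### Composition with an endomorphism on the left -/

section Left
variable {α : M →⋆ₐ[ℂ] M} {Q R : UCPMap M}

/-- For `Y ∈ 𝓔_α` the operator `S ⊗ h ↦ S ⊗ Y h` from `M ⊗_Q H` to `M ⊗_{α ∘ Q} H` is bounded. -/
theorem exists_tensorMap (hR : ∀ T, R T = α (Q T)) {Y : H →L[ℂ] H}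
    (hY : Y ∈ intertwiners (endRep α)) :
    ∃ B : Q.Stinespring →L[ℂ] R.Stinespring, ∀ S h, B (Q.tmul S h) = R.tmul S (Y h) := by
  have hYY := adjoint_comp_mem_commutant_of_mem_intertwiners hY hY
  obtain ⟨c, hc, hcc⟩ := exists_star_mul_self M.commutant
    (x := (((‖Y‖ ^ 2 : ℝ) : ℂ)) • 1 - star Y * Y)
    (sub_mem (SMulMemClass.smul_mem _ (one_mem M.commutant)) hYY) (by
      rw [sub_nonneg]
      have := CStarAlgebra.star_mul_le_algebraMap_norm_sq (a := Y)
      rw [Algebra.algebraMap_eq_smul_one] at this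
      rw [Complex.coe_smul]
      exact this)
  refine exists_clm Q.kernel (fun S => R.tmul S ∘L Y) (fun S => Q.tmul S ∘L c) ‖Y‖ (norm_nonneg _)
    fun S S' => ?_
  rw [ContinuousLinearMap.adjoint_comp, ContinuousLinearMap.adjoint_comp,
    ContinuousLinearMap.comp_assoc, ContinuousLinearMap.comp_assoc,
    ← ContinuousLinearMap.comp_assoc _ _ Y, ← ContinuousLinearMap.comp_assoc _ _ c,
    R.adjoint_tmul_comp, Q.adjoint_tmul_comp, hR]
  have h1 : ((α (Q (star S * S')) : M) : H →L[ℂ] H) ∘L Y = Y ∘L Q (star S * S') :=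
    (hY (Q (star S * S'))).symm
  have h2 : (Q (star S * S') : H →L[ℂ] H) ∘L c = c ∘L Q (star S * S') :=
    commute_of_mem (Q (star S * S')).2 hc
  rw [h1, h2]
  change star Y * (Y * (Q (star S * S') : H →L[ℂ] H)) +
    star c * (c * (Q (star S * S') : H →L[ℂ] H)) = _
  rw [← mul_assoc, ← mul_assoc, ← add_mul, hcc, add_sub_cancel, smul_mul_assoc, one_mul]
  rfl

theorem adjoint_tensorMap (hR : ∀ T, R T = α (Q T)) {Y : H →L[ℂ] H}
    (hY : Y ∈ intertwiners (endRep α)) {B : Q.Stinespring →L[ℂ] R.Stinespring}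
    (hB : ∀ S h, B (Q.tmul S h) = R.tmul S (Y h)) (S : M) (h : H) :
    adjoint B (R.tmul S h) = Q.tmul S (adjoint Y h) := by
  refine eq_of_inner_kvec_left Q.kernel fun S' k => ?_
  rw [ContinuousLinearMap.adjoint_inner_left]
  change ⟪R.tmul S h, B (Q.tmul S' k)⟫_ℂ = ⟪Q.tmul S (adjoint Y h), Q.tmul S' k⟫_ℂ
  rw [hB, R.inner_tmul, Q.inner_tmul, ContinuousLinearMap.adjoint_inner_left, hR]
  exact congrArg (fun A : H →L[ℂ] H => ⟪h, A k⟫_ℂ) (hY (Q (star S * S'))).symm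

theorem mul_mem_arvesonSpace_left (hR : ∀ T, R T = α (Q T)) {Y Z : H →L[ℂ] H}
    (hY : Y ∈ intertwiners (endRep α)) (hZ : Z ∈ Q.arvesonSpace) :
    Y * Z ∈ R.arvesonSpace := by
  obtain ⟨B, hB⟩ := exists_tensorMap hR hY
  refine ⟨Q.Phi ⟨Z, hZ⟩ ∘L adjoint B, fun S h => ?_⟩
  rw [ContinuousLinearMap.comp_apply, adjoint_tensorMap hR hY hB, Q.Phi_tmul]
  change _ = (S : H →L[ℂ] H) (adjoint (Y ∘L Z) h)
  rw [ContinuousLinearMap.adjoint_comp]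
  rfl

/-- `𝓔_α ⊗ 𝓔_Q ≅ 𝓔_{α ∘ Q}` by multiplication of operators. -/
theorem exists_iso_left (hR : ∀ T, R T = α (Q T)) (hα : IsNormal (M := M) (N := M) α)
    (hQ : IsNormal (M := M) (N := M) Q) :
    ∃ u : Iso ((UCPMap.ofStarAlgHom α).arveson.tensor Q.arveson) R.arveson,
      ∀ Y Z, R.toOp (u.toLinearEquiv (Correspondence.tmul Y Z)) =
        (UCPMap.ofStarAlgHom α).toOp Y * Q.toOp Z := by
  have hmem : ∀ Y, (UCPMap.ofStarAlgHom α).toOp Y ∈ intertwiners (endRep α) := fun Y =>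
    arvesonSpace_ofStarAlgHom α ▸ (UCPMap.ofStarAlgHom α).toOp_mem Y
  choose! B hB using fun (Y : H →L[ℂ] H) (hY : Y ∈ intertwiners (endRep α)) =>
    exists_tensorMap hR hY
  let m : (UCPMap.ofStarAlgHom α).arveson.carrier → Q.arveson.carrier → R.arveson.carrier :=
    fun Y Z => R.mkArveson (mul_mem_arvesonSpace_left hR (hmem Y) (Q.toOp_mem Z))
  have hΦ : ∀ Y Z, R.Phi (m Y Z) = Q.Phi Z ∘L adjoint (B ((UCPMap.ofStarAlgHom α).toOp Y)) :=
    fun Y Z => R.Phi_mkArveson (fun S h => by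
      rw [ContinuousLinearMap.comp_apply, adjoint_tensorMap hR (hmem Y) (hB _ (hmem Y))]
      refine (Q.Phi_tmul Z S _).trans ?_
      change _ = (S : H →L[ℂ] H) (adjoint ((UCPMap.ofStarAlgHom α).toOp Y ∘L Q.toOp Z) h)
      rw [ContinuousLinearMap.adjoint_comp]
      rfl) _
  have hΦ' : ∀ Y Z, adjoint (R.Phi (m Y Z)) =
      B ((UCPMap.ofStarAlgHom α).toOp Y) ∘L adjoint (Q.Phi Z) := fun Y Z => by
    rw [hΦ, ContinuousLinearMap.adjoint_comp, ContinuousLinearMap.adjoint_adjoint]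
  suffices key : ∃ u : Iso ((UCPMap.ofStarAlgHom α).arveson.tensor Q.arveson) R.arveson,
      ∀ Y Z, u.toLinearEquiv (Correspondence.tmul Y Z) = m Y Z by
    obtain ⟨u, hu⟩ := key
    exact ⟨u, fun Y Z => by rw [hu]; rfl⟩
  refine exists_iso_of_total (UCPMap.ofStarAlgHom α).arveson Q.arveson R m
    (fun Y Z Y' Z' => Subtype.ext ?_) (fun a Y Z => R.toOp_injective (mul_assoc _ _ _)) ?_
  · rw [R.coe_inner, hΦ', hΦ, Q.coe_inner_lact, ContinuousLinearMap.comp_assoc,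
      ← ContinuousLinearMap.comp_assoc _ _ (adjoint (Q.Phi Z'))]
    congr 2
    refine Q.ext_tmul fun S h => ?_
    rw [ContinuousLinearMap.comp_apply, hB _ (hmem Y'), adjoint_tensorMap hR (hmem Y)
      (hB _ (hmem Y)), Q.oneTensor_tmul, coe_inner_ofStarAlgHom]
    rfl
  · intro z hz
    have h1 : ∀ Y, adjoint (B ((UCPMap.ofStarAlgHom α).toOp Y)) z = 0 := fun Y => by
      refine Q.eq_zero_of_inner_adjoint_Phi hQ fun Z h => ?_
      rw [ContinuousLinearMap.adjoint_inner_left]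
      exact (congrArg (fun A : H →L[ℂ] R.Stinespring => ⟪z, A h⟫_ℂ) (hΦ' Y Z)).symm.trans
        (hz Y Z h)
    refine eq_of_inner_kvec_left R.kernel fun S k => ?_
    rw [inner_zero_left]
    change ⟪z, R.tmul S k⟫_ℂ = 0
    have h2 : adjoint (R.tmul S) z = 0 := eq_zero_of_inner_endRep hα fun Y hY h => by
      have hY' : Y ∈ (UCPMap.ofStarAlgHom α).arvesonSpace := arvesonSpace_ofStarAlgHom α ▸ hY
      rw [ContinuousLinearMap.adjoint_inner_left, ← hB Y hY,
        ← ContinuousLinearMap.adjoint_inner_left]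
      have := h1 ((UCPMap.ofStarAlgHom α).mkArveson hY')
      rw [UCPMap.toOp_mkArveson] at this
      rw [this, inner_zero_left]
    rw [← ContinuousLinearMap.adjoint_inner_left, h2, inner_zero_left]

end Left

/-! ### Composition with an automorphism on the right -/

section Right
variable {β : M ≃⋆ₐ[ℂ] M} {P R : UCPMap M}

/-- The unitary `S ⊗ h ↦ β⁻¹ S ⊗ h` from `M ⊗_P H` to `M ⊗_{P ∘ β} H`. -/
theorem exists_autMap (hR : ∀ T, R T = P (β T)) :
    ∃ D : P.Stinespring →L[ℂ] R.Stinespring, ∀ S h, D (P.tmul S h) = R.tmul (β.symm S) h := by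
  refine exists_clm P.kernel (fun S => R.tmul (β.symm S)) (fun _ => (0 : H →L[ℂ] H)) 1 zero_le_one
    fun S S' => ?_
  rw [ContinuousLinearMap.comp_zero, add_zero, R.adjoint_tmul_comp, hR, map_mul, map_star,
    StarAlgEquiv.apply_symm_apply, StarAlgEquiv.apply_symm_apply, one_pow, Complex.ofReal_one,
    one_smul]
  rfl

theorem adjoint_autMap (hR : ∀ T, R T = P (β T)) {D : P.Stinespring →L[ℂ] R.Stinespring}
    (hD : ∀ S h, D (P.tmul S h) = R.tmul (β.symm S) h) (S : M) (h : H) :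
    adjoint D (R.tmul S h) = P.tmul (β S) h := by
  refine eq_of_inner_kvec_left P.kernel fun S' k => ?_
  rw [ContinuousLinearMap.adjoint_inner_left]
  change ⟪R.tmul S h, D (P.tmul S' k)⟫_ℂ = ⟪P.tmul (β S) h, P.tmul S' k⟫_ℂ
  rw [hD, R.inner_tmul, P.inner_tmul, hR, map_mul, map_star, StarAlgEquiv.apply_symm_apply]

theorem adjoint_comp_autMap_apply (hR : ∀ T, R T = P (β T))
    {D : P.Stinespring →L[ℂ] R.Stinespring} (hD : ∀ S h, D (P.tmul S h) = R.tmul (β.symm S) h)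
    (Y : P.arveson.carrier) {Z : H →L[ℂ] H}
    (hZ : Z ∈ intertwiners (endRep (β : M →⋆ₐ[ℂ] M))) (S : M) (h : H) :
    (adjoint Z ∘L (P.Phi Y ∘L adjoint D)) (R.tmul S h) =
      (S : H →L[ℂ] H) (adjoint (P.toOp Y * Z) h) := by
  rw [ContinuousLinearMap.comp_apply, ContinuousLinearMap.comp_apply, adjoint_autMap hR hD]
  refine (congrArg (adjoint Z) (P.Phi_tmul Y (β S) h)).trans ?_
  change _ = (S : H →L[ℂ] H) (adjoint (P.toOp Y ∘L Z) h)
  rw [ContinuousLinearMap.adjoint_comp]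
  exact (congrArg (fun A : H →L[ℂ] H => A (adjoint (P.toOp Y) h))
    (comp_adjoint_of_mem_intertwiners hZ S)).symm

/-- `X ⊗ F ≅ 𝓔_{P ∘ β}` by multiplication of operators, if `X ≅ 𝓔_P` and `F` is a correspondence of
operators in `𝓔_β` with inner product `⟨S, T⟩ = S⋆ T` whose ranges span a dense subspace. -/
theorem exists_iso_right (hR : ∀ T, R T = P (β T)) (hP : IsNormal (M := M) (N := M) P)
    {X F : Correspondence M.commutant M.commutant} (v : Iso X P.arveson)
    (op : F.carrier → H →L[ℂ] H) (hop : ∀ Z, op Z ∈ intertwiners (endRep (β : M →⋆ₐ[ℂ] M)))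
    (hlact : ∀ a Z, op (F.lact a Z) = (a : H →L[ℂ] H) * op Z)
    (hinner : ∀ Z Z', (F.inner Z Z' : H →L[ℂ] H) = adjoint (op Z) ∘L op Z')
    (htot : ∀ x, (∀ Z h, ⟪x, op Z h⟫_ℂ = 0) → x = 0) :
    ∃ u : Iso (X.tensor F) R.arveson, ∀ Y Z, R.toOp (u.toLinearEquiv (Correspondence.tmul Y Z)) =
      P.toOp (v.toLinearEquiv Y) * op Z := by
  obtain ⟨D, hD⟩ := exists_autMap hR
  let m : X.carrier → F.carrier → R.arveson.carrier := fun Y Z => R.mkArveson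
    (T := P.toOp (v.toLinearEquiv Y) * op Z) ⟨_, adjoint_comp_autMap_apply hR hD _ (hop Z)⟩
  have hΦ : ∀ Y Z, R.Phi (m Y Z) =
      adjoint (op Z) ∘L (P.Phi (v.toLinearEquiv Y) ∘L adjoint D) := fun Y Z =>
    R.Phi_mkArveson (adjoint_comp_autMap_apply hR hD _ (hop Z)) _
  have hΦ' : ∀ Y Z, adjoint (R.Phi (m Y Z)) =
      D ∘L (adjoint (P.Phi (v.toLinearEquiv Y)) ∘L op Z) := fun Y Z => by
    rw [hΦ, ContinuousLinearMap.adjoint_comp, ContinuousLinearMap.adjoint_comp,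
      ContinuousLinearMap.adjoint_adjoint, ContinuousLinearMap.adjoint_adjoint,
      ContinuousLinearMap.comp_assoc]
  have hDD : adjoint D ∘L D = ContinuousLinearMap.id ℂ _ := P.ext_tmul fun S h => by
    rw [ContinuousLinearMap.comp_apply, hD, adjoint_autMap hR hD, StarAlgEquiv.apply_symm_apply]
    rfl
  suffices key : ∃ u : Iso (X.tensor F) R.arveson,
      ∀ Y Z, u.toLinearEquiv (Correspondence.tmul Y Z) = m Y Z by
    obtain ⟨u, hu⟩ := key
    exact ⟨u, fun Y Z => by rw [hu]; rfl⟩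
  refine exists_iso_of_total X F R m
    (fun Y Z Y' Z' => Subtype.ext ?_) (fun a Y Z => R.toOp_injective ?_) ?_
  · rw [R.coe_inner, hΦ', hΦ, hinner, hlact, ← v.map_inner, P.coe_inner]
    simp only [ContinuousLinearMap.comp_assoc]
    rw [← ContinuousLinearMap.comp_assoc _ D, hDD, ContinuousLinearMap.id_comp]
    rfl
  · change P.toOp (v.toLinearEquiv (X.lact a Y)) * op Z =
      (a : H →L[ℂ] H) * (P.toOp (v.toLinearEquiv Y) * op Z)
    rw [v.map_lact, P.toOp_lact, mul_assoc]
  · intro z hz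
    have h1 : ∀ Y : P.arveson.carrier, P.Phi Y (adjoint D z) = 0 := fun Y => htot _ fun Z h => by
      have := hz (v.toLinearEquiv.symm Y) Z h
      rw [hΦ', LinearEquiv.apply_symm_apply] at this
      rwa [← ContinuousLinearMap.adjoint_inner_right, ContinuousLinearMap.adjoint_inner_left]
    have h2 : adjoint D z = 0 := P.eq_zero_of_inner_adjoint_Phi hP fun Y h => by
      rw [ContinuousLinearMap.adjoint_inner_right, h1 Y, inner_zero_left]
    refine eq_of_inner_kvec_left R.kernel fun S k => ?_
    rw [inner_zero_left]
    change ⟪z, R.tmul S k⟫_ℂ = 0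
    rw [← StarAlgEquiv.symm_apply_apply β S, ← hD, ← ContinuousLinearMap.adjoint_inner_left, h2,
      inner_zero_left]

theorem exists_iso_right_ofAut (hR : ∀ T, R T = P (β T)) (hβ : IsNormal (M := M) (N := M) β)
    (hP : IsNormal (M := M) (N := M) P) :
    ∃ u : Iso (P.arveson.tensor (UCPMap.ofAut β).arveson) R.arveson,
      ∀ Y Z, R.toOp (u.toLinearEquiv (Correspondence.tmul Y Z)) =
        P.toOp Y * (UCPMap.ofAut β).toOp Z := by
  refine exists_iso_right hR hP (Iso.refl _) (UCPMap.ofAut β).toOp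
    (fun Z => arvesonSpace_ofAut β ▸ (UCPMap.ofAut β).toOp_mem Z)
    (UCPMap.ofAut β).toOp_lact (coe_inner_ofAut β) fun x hx =>
    eq_zero_of_inner_endRep (α := (β : M →⋆ₐ[ℂ] M)) hβ fun V hV h => ?_
  exact hx ((UCPMap.ofAut β).mkArveson (arvesonSpace_ofAut β ▸ hV)) h

end Right

/-! ### Conjugation by an automorphism -/

section Conjugation
variable {α : M ≃⋆ₐ[ℂ] M} {P Q : UCPMap M}

theorem adjointToOp_adjointMk (T : (UCPMap.ofAut α).arveson.carrier) :
    adjointToOp α (adjointMk α T) = star ((UCPMap.ofAut α).toOp T) := rfl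

/-- `𝓔_α ⊗ 𝓔_Q ⊗ 𝓔_α⋆ ≅ 𝓔_P` by multiplication of operators, for `P = α ∘ Q ∘ α⁻¹`. Only the density
of the ranges of `𝓔_α⋆`, and not the normality of `α⁻¹`, enters. -/
theorem exists_iso_conj (hα : IsNormal (M := M) (N := M) α) (hQ : IsNormal (M := M) (N := M) Q)
    (hPQ : ∀ a, P a = α (Q (α.symm a))) :
    ∃ u : Iso (((UCPMap.ofAut α).arveson.tensor Q.arveson).tensor (arvesonAdjoint α)) P.arveson,
      ∀ R S T, P.toOp (u.toLinearEquiv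
        (Correspondence.tmul (Correspondence.tmul R S) (adjointMk α T))) =
          (UCPMap.ofAut α).toOp R * Q.toOp S * star ((UCPMap.ofAut α).toOp T) := by
  obtain ⟨v, hv⟩ := exists_iso_left (R := (UCPMap.ofAut α).comp Q) (α := (α : M →⋆ₐ[ℂ] M))
    (Q := Q) (fun _ => rfl) hα hQ
  obtain ⟨u, hu⟩ := exists_iso_right (β := α.symm) (P := (UCPMap.ofAut α).comp Q) (R := P)
    hPQ (hα.comp hQ) v (F := arvesonAdjoint α) (adjointToOp α)
    (fun T => adjointSpace_ofAut α ▸ adjointToOp_mem α T) (adjointToOp_lact α)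
    (coe_inner_arvesonAdjoint α) fun x hx => eq_zero_of_inner_endRep_symm α hα fun V hV h =>
      hx (adjointOf α ⟨V, adjointSpace_ofAut α ▸ hV⟩) h
  exact ⟨u, fun R S T => (hu _ _).trans (congrArg₂ (· * ·) (hv R S) (adjointToOp_adjointMk T))⟩

theorem stronglyMoritaEquivalent_of_conj (hα : IsNormal (M := M) (N := M) α)
    (hP : IsNormal (M := M) (N := M) P) (hQ : IsNormal (M := M) (N := M) Q)
    (hPQ : ∀ a, P a = α (Q (α.symm a))) : StronglyMoritaEquivalent P.arveson Q.arveson := by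
  obtain ⟨u, -⟩ := exists_iso_right_ofAut (P := P) (β := α) (R := P.comp (UCPMap.ofAut α))
    (fun _ => rfl) hα hP
  obtain ⟨v, -⟩ := exists_iso_left (R := P.comp (UCPMap.ofAut α)) (α := (α : M →⋆ₐ[ℂ] M))
    (Q := Q) (fun T => by
      refine (hPQ (α T)).trans ?_
      rw [StarAlgEquiv.symm_apply_apply]
      rfl) hα hQ
  exact ⟨(UCPMap.ofAut α).arveson, ⟨leftInner α, isEquivalenceBimoduleWith_leftInner hα⟩,
    ⟨u.trans v.symm⟩⟩

end Conjugation
end Compositions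
end VNCorr

open VNCorr Correspondence in
theorem proposition1p11 {H : Type u} [NormedAddCommGroup H] [InnerProductSpace ℂ H]
    [CompleteSpace H] (M : VonNeumannAlgebra H) :
    (∀ α : M ≃⋆ₐ[ℂ] M, IsNormal (M := M) (N := M) α →
      (UCPMap.ofAut α.symm).arvesonSpace = (UCPMap.ofAut α).adjointSpace ∧
      (∃ u : Iso (UCPMap.ofAut α.symm).arveson (arvesonAdjoint α),
        ∀ T, adjointToOp α (u.toLinearEquiv T) = (UCPMap.ofAut α.symm).toOp T) ∧
      (sigmaWeakClosure (Submodule.span ℂ {Z : H →L[ℂ] H |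
          ∃ X ∈ (UCPMap.ofAut α).arvesonSpace, ∃ Y ∈ (UCPMap.ofAut α).arvesonSpace,
            Z = X * star Y}) : Set (H →L[ℂ] H)) = M.commutant ∧
      (sigmaWeakClosure (Submodule.span ℂ {Z : H →L[ℂ] H |
          ∃ X ∈ (UCPMap.ofAut α).arvesonSpace, ∃ Y ∈ (UCPMap.ofAut α).arvesonSpace,
            Z = star X * Y}) : Set (H →L[ℂ] H)) = M.commutant ∧
      ∃ l : (UCPMap.ofAut α).arveson.carrier → (UCPMap.ofAut α).arveson.carrier → M.commutant,
        (UCPMap.ofAut α).arveson.IsEquivalenceBimoduleWith l ∧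
        ∀ X Y, (l X Y : H →L[ℂ] H) =
          (UCPMap.ofAut α).toOp X * star ((UCPMap.ofAut α).toOp Y)) ∧
    (∀ (α : M →⋆ₐ[ℂ] M) (Q : UCPMap M), IsNormal (M := M) (N := M) α →
      IsNormal (M := M) (N := M) Q →
      ∃ u : Iso ((UCPMap.ofStarAlgHom α).arveson.tensor Q.arveson)
          ((UCPMap.ofStarAlgHom α).comp Q).arveson,
        ∀ Y Z, ((UCPMap.ofStarAlgHom α).comp Q).toOp (u.toLinearEquiv (tmul Y Z)) =
          (UCPMap.ofStarAlgHom α).toOp Y * Q.toOp Z) ∧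
    (∀ (α : M ≃⋆ₐ[ℂ] M) (P : UCPMap M), IsNormal (M := M) (N := M) α →
      IsNormal (M := M) (N := M) P →
      ∃ u : Iso (P.arveson.tensor (UCPMap.ofAut α).arveson) (P.comp (UCPMap.ofAut α)).arveson,
        ∀ Y Z, (P.comp (UCPMap.ofAut α)).toOp (u.toLinearEquiv (tmul Y Z)) =
          P.toOp Y * (UCPMap.ofAut α).toOp Z) ∧
    (∀ (P Q : UCPMap M) (α : M ≃⋆ₐ[ℂ] M), IsNormal (M := M) (N := M) P →
      IsNormal (M := M) (N := M) Q → IsNormal (M := M) (N := M) α →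
      (∀ a : M, P a = α (Q (α.symm a))) →
      (∃ u : Iso (((UCPMap.ofAut α).arveson.tensor Q.arveson).tensor (arvesonAdjoint α)) P.arveson,
        ∀ R S T, P.toOp (u.toLinearEquiv (tmul (tmul R S) (adjointMk α T))) =
          (UCPMap.ofAut α).toOp R * Q.toOp S * star ((UCPMap.ofAut α).toOp T)) ∧
      StronglyMoritaEquivalent P.arveson Q.arveson) := by
  refine ⟨fun α hα => ⟨arvesonSpace_ofAut_symm α, exists_iso_arvesonAdjoint α,
    sigmaWeakClosure_span_ofAut hα, sigmaWeakClosure_span_ofAut' hα, leftInner α,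
    isEquivalenceBimoduleWith_leftInner hα, coe_leftInner α⟩,
    fun α Q hα hQ => exists_iso_left (fun _ => rfl) hα hQ,
    fun α P hα hP => exists_iso_right_ofAut (fun _ => rfl) hα hP,
    fun P Q α hP hQ hα hPQ => ⟨exists_iso_conj hα hQ hPQ,
      stronglyMoritaEquivalent_of_conj hα hP hQ hPQ⟩⟩
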